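/- Let $N\ge 0$ be an integer, $\eta\in\mathbb C$ with $\eta\notin i\pi\mathbb Z$, and let $\xi_1,\dots,\xi_N\in\mathbb C$ satisfy $\xi_i\neq\xi_j+r\eta+im\pi$ for all $i\ne j$, $r\in\{-1,0,1\}$, $m\in\mathbb Z$. Let $$R(u)=\begin{pmatrix}\sinh(u+\eta)&0&0&0\\0&\sinh u&\sinh\eta&0\\0&\sinh\eta&\sinh u&0\\0&0&0&\sinh(u+\eta)\end{pmatrix},\quad K^{(0,\alpha)}=\begin{pmatrix}e^{\alpha}&0\\0&e^{-\alpha}\end{pmatrix},\quad K^{(1,\alpha)}=\begin{pmatrix}0&e^{\alpha}\\e^{-\alpha}&0\end{pmatrix},$$ and for $a\in\{0,1\}$, $\alpha\in\mathbb C$, $K=K^{(a,\alpha)}$, let $T(\lambda)=\operatorname{tr}_0\big(K_0R_{0N}(\lambda-\xi_N)\cdots R_{01}(\lambda-\xi_1)\big)$ on $\mathcal H=(\mathbb C^2)^{\otimes N}$. Let $\Sigma_T$ be the set of functions $t:\mathbb C\to\mathbb C$ for which there is a vector $|t\rangle\ne0$ (an eigenvector for $t$) with $T(\lambda)|t\rangle=t(\lambda)|t\rangle$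 for all $\lambda$. Put $d(\lambda)=\prod_n\sinh(\lambda-\xi_n)$, $a(\lambda)=d(\lambda+\eta)$, $S_z=\sum_n\sigma^z_n$, $\Lambda=\{-N,2-N,\dots,N-2,N\}$, $$c_l=2\delta_{0,a}\frac{\cosh\alpha\,\cosh(\eta l/2)}{\cosh(\eta N/2)},\qquad g_n(\lambda)=\Big(\frac{\cosh(\eta N/2+\lambda-\xi_n)}{\cosh(\eta N/2)}\Big)^{\delta_{0,a}}\prod_{b\ne n}\frac{\sinh(\lambda-\xi_b)}{\sinh(\xi_n-\xi_b)}.$$ For $l\in\Lambda$ let $\Sigma^{(l)}$ be the set of $(x_1,\dots,x_N)\in\mathbb C^N$ which satisfy the $N$ quadratic equations $$x_n\Big[c_l\prod_{b=1}^N\sinh(\xi_n-\xi_b-\eta)+\sum_{b=1}^Ng_b(\xi_n-\eta)x_b\Big]=a(\xi_n)\,d(\xi_n-\eta)\det K,\qquad n=1,\dots,N,$$ and, if $a=0$, also the sum rule $$e^{\eta N/2}\cosh\big(\tfrac{\eta l}2+\alpha\big)-e^{-\eta N/2}\cosh\big(\tfrac{\eta l}2-\alpha\big)=\sum_{n=1}^N\frac{x_n}{\prod_{b\ne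 n}\sinh(\xi_n-\xi_b)}$$ (for $a=1$ the set does not depend on $l$). Let $\Sigma_T^{(l)}$ be the set of trigonometric polynomials $t(\lambda)=c_l\prod_n\sinh(\lambda-\xi_n)+\sum_ng_n(\lambda)x_n$ with $x\in\Sigma^{(l)}$. For a covector $\langle S|$ and $h\in\{0,1\}^N$ put $$\langle h_1,\dots,h_N|=\langle S|\prod_{n=1}^N\Big(\frac{T(\xi_n)}{(e^{\alpha})^{\delta_{0,a}}a(\xi_n)}\Big)^{h_n},$$ and call $\langle S|$ admissible if these $2^N$ covectors form a basis of $\mathcal H^*$ (the left SoV basis). (1) If $a=1$, then for every $\alpha$ almost every $\langle S|$ is admissible. If $a=0$, then for all $\alpha$ except those for which $e^{2\alpha}$ lies in some finite set, almost every $\langle S|$ is admissible. Assume from now on that $K\ne vI$ for all $v\in\mathbb C$ and, if $a=0$, that $\eta$ and $\alpha$ are generic in the sense that $k\eta\notin i\pi\mathbb Z$ for $1\le k\le N$ and $\alpha\notin\eta(\frac N2-j)+i\pi\mathbb Z$ for $1\le j\le N-1$. (2) $\Sigma_T=\bigcup_{l\in\Lambda}\Sigma_T^{(l)}$. (3) If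 $a=0$, then $l$ is determined without ambiguity: $x\in\Sigma^{(l)}\cap\Sigma^{(l')}$ implies $l=l'$; and for $t\in\Sigma_T^{(l)}$ every eigenvector $|t\rangle$ satisfies $S_z|t\rangle=l\,|t\rangle$. (4) Whenever an admissible $\langle S|$ exists, $T$ has $w$-simple spectrum: to each $t\in\Sigma_T$ there is, up to scalar factors, exactly one eigenvector. For every admissible $\langle S|$ and every $t\in\Sigma_T$ there is exactly one eigenvector $|t\rangle$ with $\langle S|t\rangle=1$, and for all $h\in\{0,1\}^N$ $$\langle h_1,\dots,h_N|t\rangle=\prod_{n=1}^N\Big(\frac{t(\xi_n)}{(e^{\alpha})^{\delta_{0,a}}a(\xi_n)}\Big)^{h_n}.$$ -/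

import Mathlib

noncomputable section

namespace XXZ

open Matrix Complex
open scoped BigOperators

/-- Labels of the product basis of `(ℂ²)^{⊗N}`; the value `0` is spin up, `1` is spin down. -/
abbrev Spins (N : ℕ) : Type := Fin N → Fin 2

/-- The space `(ℂ²)^{⊗N}` in coordinates with respect to its product basis. Covectors are
written in the dual basis and hence have the same type. -/
abbrev Space (N : ℕ) : Type := Spins N → ℂ

/-- The trigonometric 6-vertex matrix `R(u)` on `ℂ² ⊗ ℂ²`. -/
def sixVertexR (η u : ℂ) : Matrix (Fin 2 × Fin 2) (Fin 2 × Fin 2) ℂ :=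
  Matrix.of fun p q =>
    if p = q then (if p.1 = p.2 then sinh (u + η) else sinh u)
    else if p.1 = q.2 ∧ p.2 = q.1 then sinh η else 0

/-- The twist matrix `K^{(a,α)}`: diagonal for `a = 0`, antidiagonal for `a = 1`. -/
def twist (a : Fin 2) (α : ℂ) : Matrix (Fin 2) (Fin 2) ℂ :=
  if a = 0 then !![exp α, 0; 0, exp (-α)] else !![0, exp α; exp (-α), 0]

/-- `R_{0n}(u)` acting on (auxiliary space) ⊗ (quantum space): `R(u)` on the auxiliary factor
and the `n`-th quantum factor, the identity on the other factors. -/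
def siteR {N : ℕ} (η u : ℂ) (n : Fin N) : Matrix (Fin 2 × Spins N) (Fin 2 × Spins N) ℂ :=
  Matrix.of fun p q =>
    if ∀ m, m ≠ n → p.2 m = q.2 m then sixVertexR η u (p.1, p.2 n) (q.1, q.2 n) else 0

/-- `M₀(z) = K₀ R_{0N}(z - ξ_N) ⋯ R_{01}(z - ξ_1)`. -/
def monodromy {N : ℕ} (η : ℂ) (ξ : Fin N → ℂ) (a : Fin 2) (α z : ℂ) :
    Matrix (Fin 2 × Spins N) (Fin 2 × Spins N) ℂ :=
  Matrix.kronecker (twist a α) (1 : Matrix (Spins N) (Spins N) ℂ) *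
    ((List.finRange N).reverse.map fun n => siteR η (z - ξ n) n).prod

/-- The transfer matrix `T(z)`, the trace of the monodromy matrix over the auxiliary space. -/
def transfer {N : ℕ} (η : ℂ) (ξ : Fin N → ℂ) (a : Fin 2) (α z : ℂ) :
    Matrix (Spins N) (Spins N) ℂ :=
  Matrix.of fun s s' => ∑ i : Fin 2, monodromy η ξ a α z (i, s) (i, s')

/-- `S_z = ∑ₙ σₙᶻ`. -/
def spinZ (N : ℕ) : Matrix (Spins N) (Spins N) ℂ :=
  Matrix.diagonal fun s => ∑ n : Fin N, (if s n = 0 then 1 else -1)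

/-- `ξ_i ≠ ξ_j + r η + i m π` for all `i ≠ j`, `r ∈ {-1,0,1}` and `m ∈ ℤ`. -/
def InhomogeneityCondition {N : ℕ} (η : ℂ) (ξ : Fin N → ℂ) : Prop :=
  ∀ i j : Fin N, i ≠ j → ∀ r : ℤ, (r = -1 ∨ r = 0 ∨ r = 1) → ∀ m : ℤ,
    ξ i ≠ ξ j + r * η + I * m * Real.pi

/-- `d(z) = ∏ₙ sinh (z - ξₙ)`. -/
def dFun {N : ℕ} (ξ : Fin N → ℂ) (z : ℂ) : ℂ := ∏ n, sinh (z - ξ n)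

/-- `a(z) = d(z + η) = ∏ₙ sinh (z - ξₙ + η)`. -/
def aFun {N : ℕ} (η : ℂ) (ξ : Fin N → ℂ) (z : ℂ) : ℂ := dFun ξ (z + η)

/-- `ψ` is a nonzero common eigenvector of all `T(z)` with eigenvalue function `t`. -/
def IsEigenvector {N : ℕ} (η : ℂ) (ξ : Fin N → ℂ) (a : Fin 2) (α : ℂ) (t : ℂ → ℂ)
    (ψ : Space N) : Prop :=
  ψ ≠ 0 ∧ ∀ z, transfer η ξ a α z *ᵥ ψ = t z • ψ

/-- The spectrum of the family `T`: the set of its eigenvalue functions. -/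
def spectrum {N : ℕ} (η : ℂ) (ξ : Fin N → ℂ) (a : Fin 2) (α : ℂ) : Set (ℂ → ℂ) :=
  {t | ∃ ψ : Space N, IsEigenvector η ξ a α t ψ}

/-- To every eigenvalue function belongs one and, up to scalars, only one eigenvector. -/
def IsWSimple {N : ℕ} (η : ℂ) (ξ : Fin N → ℂ) (a : Fin 2) (α : ℂ) : Prop :=
  ∀ t ∈ spectrum η ξ a α, ∃ ψ : Space N, IsEigenvector η ξ a α t ψ ∧
    ∀ φ : Space N, IsEigenvector η ξ a α t φ → ∃ c : ℂ, φ = c • ψ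

/-- The interpolation functions `gₙ^{(a)}(z)`. -/
def interp {N : ℕ} (η : ℂ) (ξ : Fin N → ℂ) (a : Fin 2) (n : Fin N) (z : ℂ) : ℂ :=
  (if a = 0 then cosh (η * N / 2 + z - ξ n) / cosh (η * N / 2) else 1) *
    ∏ b ∈ Finset.univ.erase n, sinh (z - ξ b) / sinh (ξ n - ξ b)

/-- The coefficient `2 δ_{0,a} cosh α cosh (η l / 2) / cosh (η N / 2)`. -/
def leadCoeff (N : ℕ) (η : ℂ) (a : Fin 2) (α : ℂ) (l : ℤ) : ℂ :=
  if a = 0 then 2 * (cosh α * cosh (η * l / 2) / cosh (η * N / 2)) else 0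

/-- The trigonometric polynomial attached to `l` and `(x₁, …, x_N)`. -/
def interpolant {N : ℕ} (η : ℂ) (ξ : Fin N → ℂ) (a : Fin 2) (α : ℂ) (l : ℤ)
    (x : Fin N → ℂ) (z : ℂ) : ℂ :=
  leadCoeff N η a α l * (∏ n, sinh (z - ξ n)) + ∑ n, interp η ξ a n z * x n

/-- The sum rule which fixes `l` for the diagonal twist. -/
def SumRule {N : ℕ} (η : ℂ) (ξ : Fin N → ℂ) (α : ℂ) (l : ℤ) (x : Fin N → ℂ) : Prop :=
  exp (η * N / 2) * cosh (η / 2 * l + α) - exp (-(η * N / 2)) * cosh (η / 2 * l - α) =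
    ∑ n, x n / ∏ b ∈ Finset.univ.erase n, sinh (ξ n - ξ b)

/-- The solutions of the `N` quadratic equations which, for the diagonal twist `a = 0`, also
satisfy the sum rule. For `a = 1` neither the equations nor the set depend on `l`. -/
def solutions {N : ℕ} (η : ℂ) (ξ : Fin N → ℂ) (a : Fin 2) (α : ℂ) (l : ℤ) :
    Set (Fin N → ℂ) :=
  {x | (∀ n, x n * (leadCoeff N η a α l * (∏ b, sinh (ξ n - ξ b - η)) +
          ∑ b, interp η ξ a b (ξ n - η) * x b) =
        aFun η ξ (ξ n) * dFun ξ (ξ n - η) * (twist a α).det) ∧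
      (a = 0 → SumRule η ξ α l x)}

/-- The set `Σ^{(l)}` of trigonometric polynomials attached to the solutions. -/
def spectrumPart {N : ℕ} (η : ℂ) (ξ : Fin N → ℂ) (a : Fin 2) (α : ℂ) (l : ℤ) :
    Set (ℂ → ℂ) :=
  {t | ∃ x ∈ solutions η ξ a α l, ∀ z, t z = interpolant η ξ a α l x z}

/-- `{-N, 2 - N, …, N - 2, N}`. -/
def spinValues (N : ℕ) : Set ℤ := {l | ∃ k : ℕ, k ≤ N ∧ l = (N : ℤ) - 2 * k}

/-- The normalization `(e^α)^{δ_{0,a}} a(ξₙ)`. -/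
def sovNorm {N : ℕ} (η : ℂ) (ξ : Fin N → ℂ) (a : Fin 2) (α : ℂ) (n : Fin N) : ℂ :=
  (if a = 0 then exp α else 1) * aFun η ξ (ξ n)

/-- The covector `⟨h₁,…,h_N| = ⟨S| ∏ₙ (T(ξₙ) / ((e^α)^{δ_{0,a}} a(ξₙ)))^{hₙ}`. -/
def sovCovector {N : ℕ} (η : ℂ) (ξ : Fin N → ℂ) (a : Fin 2) (α : ℂ) (S : Space N)
    (h : Fin N → Fin 2) : Space N :=
  S ᵥ* ((List.finRange N).map fun n =>
    ((sovNorm η ξ a α n)⁻¹ • transfer η ξ a α (ξ n)) ^ (h n : ℕ)).prod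

/-- The covectors `⟨h₁,…,h_N|` form a basis of the dual space. -/
def IsSovBasis {N : ℕ} (η : ℂ) (ξ : Fin N → ℂ) (a : Fin 2) (α : ℂ) (S : Space N) : Prop :=
  LinearIndependent ℂ (sovCovector η ξ a α S) ∧
    Submodule.span ℂ (Set.range (sovCovector η ξ a α S)) = ⊤

/-- Genericity of `η` and of the diagonal twist parameter `α`: `k η ∉ iπℤ` for `1 ≤ k ≤ N`, and
`α ∉ η (N/2 - j) + iπℤ` for `1 ≤ j ≤ N - 1`. -/
def DiagonalGeneric (N : ℕ) (η α : ℂ) : Prop :=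
  (∀ k : ℕ, 1 ≤ k → k ≤ N → ∀ m : ℤ, (k : ℂ) * η ≠ I * m * Real.pi) ∧
  (∀ j : ℕ, 1 ≤ j → j < N → ∀ m : ℤ, α ≠ η * ((N : ℂ) / 2 - j) + I * m * Real.pi)

end XXZ

end

/-!
The proof is Sklyanin's separation of variables, with the basis of covectors generated by the
conserved charges `T(ξₙ)` themselves.

Write `A, B, C, D` for the entries of the untwisted monodromy matrix `mono`. The Yang–Baxter equation
gives the RTT relation `mono_rtt`, hence exchange relations and commuting charges `T(ξₙ)`, and fusion
at arguments which differ by `η` gives `T(ξₙ) T(ξₙ - η) = a(ξₙ) d(ξₙ - η) det K` (`transfer_fusion`). All matrix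
elements are trigonometric polynomials (`IsTrig`), and on the sector with `m` down spins the leading
coefficients of `A` and `D` at `±∞` are explicit powers of `e^η`. A trigonometric polynomial is
determined by its values at the nodes and one leading coefficient (`IsTrig.interpolation`).

*The SoV basis.* The operators `C(ξₙ)` applied to `⟨⇑|` give left eigenvectors of `D(z)` which are
separated by the operators `D(ξₙ)` (`leftVec_props`). For `a = 1` the covector `⟨⇑|` generates a basis
of such vectors. For `a = 0` the operator `e^α T(z) = e^{2α} A(z) + D(z)` is a pencil in `e^{2α}`,
which at `0` is `D(z)`, and the sum of its left eigenvectors generates a basis (the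
matrix of their eigenvalues is triangular), so only finitely many `e^{2α}` are excluded. Admissibility is the nonvanishing of a
polynomial in `⟨S|`, hence holds almost everywhere as soon as it holds for one `⟨S|`.

*Eigenvalues solve the equations.* Fusion gives the quadratic equations (`mem_solutions_iff`). For
`a = 0` any nonzero component of an eigenvector exhibits both leading coefficients of `t` as those of
a sector, and the sum rule says precisely this (`sumRule_of_isTrig`). The two coefficients together
determine the sector (`sector_unique`), which gives the uniqueness of `l` and the value of `S_z`.

*Solutions are eigenvalues.* In a basis generated by commuting charges that satisfy the fusion
relations, interpolation writes `T(z)` as an explicit matrix `shiftMat`, and the product vector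
`∏ₙ t(ξₙ)^{hₙ}` is its eigenvector (`exists_eigenvector_of_det_ne_zero`). This needs a scalar leading
coefficient and a basis. For `a = 1` both are at hand. For `a = 0` the twist is first made dependent
on the sector: `dynTransfer` is `κ A(z) e^{η m} + D(z) e^{-η m}`, with the same leading coefficient at
`+∞` on all sectors. A basis exists for all but finitely many `κ`, and the existence of an eigenvector
is a closed condition, since it is the vanishing of determinants (`exists_eigenvector_dynTransfer`).
With `κ = e^{2(α - η m)}`, `dynTransfer` is a multiple of `T(z)` on the sector with `m` down spins.
Comparing the leading coefficients at `-∞`, genericity leaves two possibilities: the eigenvector is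
supported on this sector and is an eigenvector of `T(z)`, or it has a component along `⇑` or `⇓`. In
the latter case `t` is a combination of `a(z)` and `d(z)` and `e^{2α} = e^{±ηN}`, and spin helix
states, product states that the monodromy matrix transports along the chain, supply the eigenvector
(`helix_mem_spectrum`).

*Simplicity.* An eigenvector is determined by its pairings with the SoV basis, which are
`∏ₙ (t(ξₙ) / sovNorm)^{hₙ} ⟨S|t⟩` (`sovCovector_dotProduct`).
-/

noncomputable section

namespace XXZ

open Matrix Complex
open scoped BigOperators

/-! ### Operators on one site -/

/-- The operator on `(ℂ²)^{⊗N}` acting as `X` on the `n`-th factor and as the identity on the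
others. -/
def siteOp {N : ℕ} (n : Fin N) (X : Matrix (Fin 2) (Fin 2) ℂ) :
    Matrix (Spins N) (Spins N) ℂ :=
  Matrix.of fun s s' => if ∀ m, m ≠ n → s m = s' m then X (s n) (s' n) else 0

lemma siteOp_mulVec {N : ℕ} (n : Fin N) (X : Matrix (Fin 2) (Fin 2) ℂ) (ψ : Space N)
    (s : Spins N) :
    (siteOp n X *ᵥ ψ) s = ∑ σ, X (s n) σ * ψ (Function.update s n σ) := by
  have hinj : Function.Injective (fun σ : Fin 2 => Function.update s n σ) :=
    Function.update_injective s n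
  simp only [mulVec, dotProduct, siteOp, of_apply]
  rw [← Finset.sum_subset (Finset.subset_univ (Finset.univ.image fun σ => Function.update s n σ)),
    Finset.sum_image hinj.injOn]
  · refine Finset.sum_congr rfl fun σ _ => ?_
    rw [if_pos, Function.update_self]
    intro m hm
    rw [Function.update_of_ne hm]
  · intro s' _ hs'
    rw [if_neg, zero_mul]
    intro h
    refine hs' (Finset.mem_image.2 ⟨s' n, Finset.mem_univ _, ?_⟩)
    funext m
    by_cases hm : m = n
    · subst hm; simp
    · rw [Function.update_of_ne hm, h m hm]

lemma ext_mulVec {n : Type*} [Fintype n] {X Y : Matrix n n ℂ}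
    (h : ∀ ψ : n → ℂ, X *ᵥ ψ = Y *ᵥ ψ) : X = Y :=
  Matrix.mulVec_injective (funext h)

lemma siteOp_mul {N : ℕ} (n : Fin N) (X Y : Matrix (Fin 2) (Fin 2) ℂ) :
    siteOp n X * siteOp n Y = siteOp n (X * Y) := by
  refine ext_mulVec fun ψ => ?_
  rw [← mulVec_mulVec]
  funext s
  simp only [siteOp_mulVec, Function.update_self, Function.update_idem, Matrix.mul_apply,
    Fin.sum_univ_two]
  ring

lemma siteOp_commute {N : ℕ} {n m : Fin N} (h : n ≠ m) (X Y : Matrix (Fin 2) (Fin 2) ℂ) :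
    Commute (siteOp n X) (siteOp m Y) := by
  refine ext_mulVec fun ψ => ?_
  rw [← mulVec_mulVec, ← mulVec_mulVec]
  funext s
  simp only [siteOp_mulVec, Fin.sum_univ_two, Function.update_of_ne h, Function.update_of_ne h.symm,
    Function.update_comm h]
  ring

lemma siteOp_one {N : ℕ} (n : Fin N) : siteOp n 1 = 1 := by
  refine ext_mulVec fun ψ => ?_
  funext s
  rw [siteOp_mulVec, one_mulVec, Finset.sum_eq_single (s n)]
  · simp
  · intro b _ hb
    rw [Matrix.one_apply_ne hb.symm, zero_mul]
  · simp

/-- `siteOp n` as an algebra homomorphism. -/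
def siteHom {N : ℕ} (n : Fin N) :
    Matrix (Fin 2) (Fin 2) ℂ →ₐ[ℂ] Matrix (Spins N) (Spins N) ℂ :=
  AlgHom.ofLinearMap
    { toFun := siteOp n
      map_add' := fun X Y => by ext s s'; simp [siteOp]; split_ifs <;> simp
      map_smul' := fun c X => by ext s s'; simp [siteOp] }
    (siteOp_one n) (fun X Y => (siteOp_mul n X Y).symm)

/-! ### The monodromy matrix as a `2 × 2` matrix of operators -/

/-- The operator entries `⟨i|R(u)|j⟩` of the `R`-matrix with respect to its auxiliary factor. -/
def rBlock (η u : ℂ) (i j : Fin 2) : Matrix (Fin 2) (Fin 2) ℂ :=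
  Matrix.of fun σ σ' => sixVertexR η u (i, σ) (j, σ')

/-- `R_{0n}(u)` as a `2 × 2` matrix of operators on the quantum space. -/
def lax {N : ℕ} (η u : ℂ) (n : Fin N) :
    Matrix (Fin 2) (Fin 2) (Matrix (Spins N) (Spins N) ℂ) :=
  Matrix.of fun i j => siteHom n (rBlock η u i j)

/-- The factor of the `k`-th site, read as the identity for `k ≥ N`. -/
def laxNat {N : ℕ} (η : ℂ) (ξ : Fin N → ℂ) (z : ℂ) (k : ℕ) :
    Matrix (Fin 2) (Fin 2) (Matrix (Spins N) (Spins N) ℂ) :=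
  if h : k < N then lax η (z - ξ ⟨k, h⟩) ⟨k, h⟩ else 1

/-- The untwisted monodromy matrix of the first `k` sites. -/
def mono {N : ℕ} (η : ℂ) (ξ : Fin N → ℂ) (z : ℂ) :
    ℕ → Matrix (Fin 2) (Fin 2) (Matrix (Spins N) (Spins N) ℂ)
  | 0 => 1
  | k + 1 => laxNat η ξ z k * mono η ξ z k

lemma mono_succ {N : ℕ} (η : ℂ) (ξ : Fin N → ℂ) (z : ℂ) {k : ℕ} (h : k < N) :
    mono η ξ z (k + 1) = lax η (z - ξ ⟨k, h⟩) ⟨k, h⟩ * mono η ξ z k := by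
  rw [mono, laxNat, dif_pos h]

lemma mono_succ_apply {N : ℕ} (η : ℂ) (ξ : Fin N → ℂ) (z : ℂ) {k : ℕ} (h : k < N) (i j : Fin 2) :
    mono η ξ z (k + 1) i j =
      siteOp ⟨k, h⟩ (rBlock η (z - ξ ⟨k, h⟩) i 0) * mono η ξ z k 0 j +
      siteOp ⟨k, h⟩ (rBlock η (z - ξ ⟨k, h⟩) i 1) * mono η ξ z k 1 j := by
  rw [mono_succ η ξ z h, Matrix.mul_apply, Fin.sum_univ_two]
  rfl

lemma prod_reverse_take_eq_mono {N : ℕ} (η : ℂ) (ξ : Fin N → ℂ) (z : ℂ) (k : ℕ) (hk : k ≤ N) :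
    (((List.finRange N).take k).reverse.map fun n => lax η (z - ξ n) n).prod = mono η ξ z k := by
  induction k with
  | zero => simp [mono]
  | succ k ih =>
    have hk' : k < (List.finRange N).length := by simpa using hk
    rw [List.take_succ_eq_append_getElem hk', List.reverse_append, List.reverse_singleton,
      List.singleton_append, List.map_cons, List.prod_cons, ih (by omega), mono_succ η ξ z (by omega)]
    simp

lemma siteR_eq_comp {N : ℕ} (η u : ℂ) (n : Fin N) :
    siteR η u n = compRingEquiv (Fin 2) (Spins N) ℂ (lax η u n) := by
  ext p q
  simp [siteR, lax, siteHom, siteOp, rBlock]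

lemma transfer_eq {N : ℕ} (η : ℂ) (ξ : Fin N → ℂ) (a : Fin 2) (α z : ℂ) :
    transfer η ξ a α z =
      ∑ i, ∑ j, twist a α i j • mono η ξ z N j i := by
  have h1 : ((List.finRange N).reverse.map fun n => siteR η (z - ξ n) n).prod =
      compRingEquiv (Fin 2) (Spins N) ℂ (mono η ξ z N) := by
    rw [← prod_reverse_take_eq_mono η ξ z N le_rfl, map_list_prod, List.map_map,
      List.take_of_length_le (by simp)]
    simp only [siteR_eq_comp]
    rfl
  ext s s'
  simp only [transfer, monodromy, h1, of_apply, Matrix.sum_apply, Matrix.mul_apply,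
    Fintype.sum_prod_type, Matrix.smul_apply, smul_eq_mul]
  refine Finset.sum_congr rfl fun i _ => Finset.sum_congr rfl fun j _ => ?_
  simp [Matrix.kronecker, Matrix.kroneckerMap_apply, Matrix.one_apply]

lemma transfer_zero {N : ℕ} (η : ℂ) (ξ : Fin N → ℂ) (α z : ℂ) :
    transfer η ξ 0 α z = exp α • mono η ξ z N 0 0 + exp (-α) • mono η ξ z N 1 1 := by
  simp [transfer_eq, twist, Fin.sum_univ_two]

lemma transfer_one {N : ℕ} (η : ℂ) (ξ : Fin N → ℂ) (α z : ℂ) :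
    transfer η ξ 1 α z = exp α • mono η ξ z N 1 0 + exp (-α) • mono η ξ z N 0 1 := by
  simp [transfer_eq, twist, Fin.sum_univ_two]

/-- Operators on sites `≥ k` commute with the monodromy matrix of the first `k` sites. -/
lemma commute_siteOp_mono {N : ℕ} (η : ℂ) (ξ : Fin N → ℂ) (z : ℂ) (n : Fin N)
    (X : Matrix (Fin 2) (Fin 2) ℂ) (k : ℕ) (hk : k ≤ n) (i j : Fin 2) :
    Commute (siteOp n X) (mono η ξ z k i j) := by
  induction k generalizing i j with
  | zero => rw [mono]; rw [Matrix.one_apply]; split_ifs <;> simp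
  | succ k ih =>
    have hkN : k < N := by omega
    have hne : n ≠ ⟨k, hkN⟩ := fun h => by subst h; simp at hk
    rw [mono_succ_apply η ξ z hkN]
    exact ((siteOp_commute hne _ _).mul_right (ih (by omega) _ _)).add_right
      ((siteOp_commute hne _ _).mul_right (ih (by omega) _ _))

/-! ### Products in two auxiliary spaces -/

section Box

variable {𝓡 : Type*} [Ring 𝓡]

/-- The product `X₁ Y₂` of two matrices of operators in two different auxiliary spaces. -/
def box (X Y : Matrix (Fin 2) (Fin 2) 𝓡) : Matrix (Fin 2 × Fin 2) (Fin 2 × Fin 2) 𝓡 :=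
  Matrix.of fun p q => X p.1 q.1 * Y p.2 q.2

/-- The product `Y₂ X₁`, which has the operators in the opposite order. -/
def boxOp (X Y : Matrix (Fin 2) (Fin 2) 𝓡) : Matrix (Fin 2 × Fin 2) (Fin 2 × Fin 2) 𝓡 :=
  Matrix.of fun p q => Y p.2 q.2 * X p.1 q.1

/-- A numerical matrix on the two auxiliary spaces. -/
def scal [Algebra ℂ 𝓡] (K : Matrix (Fin 2 × Fin 2) (Fin 2 × Fin 2) ℂ) :
    Matrix (Fin 2 × Fin 2) (Fin 2 × Fin 2) 𝓡 :=
  K.map (algebraMap ℂ 𝓡)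

lemma scal_mul [Algebra ℂ 𝓡] (K K' : Matrix (Fin 2 × Fin 2) (Fin 2 × Fin 2) ℂ) :
    (scal (K * K') : Matrix _ _ 𝓡) = scal K * scal K' := by
  simp [scal, Matrix.map_mul]

lemma box_mul (X Y X' Y' : Matrix (Fin 2) (Fin 2) 𝓡)
    (h : ∀ i j k l, Commute (X' i j) (Y k l)) :
    box (X * Y) (X' * Y') = box X X' * box Y Y' := by
  ext ⟨i, k⟩ ⟨j, l⟩
  simp only [box, of_apply, Matrix.mul_apply, Fintype.sum_prod_type, Finset.sum_mul_sum]
  refine Finset.sum_congr rfl fun p _ => Finset.sum_congr rfl fun q _ => ?_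
  rw [mul_assoc, ← mul_assoc (Y p j), ← (h k q p j).eq]
  simp only [mul_assoc]

lemma boxOp_mul (X Y X' Y' : Matrix (Fin 2) (Fin 2) 𝓡)
    (h : ∀ i j k l, Commute (X i j) (Y' k l)) :
    boxOp (X * Y) (X' * Y') = boxOp X X' * boxOp Y Y' := by
  ext ⟨i, k⟩ ⟨j, l⟩
  simp only [boxOp, of_apply, Matrix.mul_apply, Fintype.sum_prod_type, Finset.sum_mul_sum]
  rw [Finset.sum_comm]
  refine Finset.sum_congr rfl fun p _ => Finset.sum_congr rfl fun q _ => ?_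
  rw [mul_assoc, ← mul_assoc (Y' q l), ← (h i p q l).eq]
  simp only [mul_assoc]

lemma box_one : box (1 : Matrix (Fin 2) (Fin 2) 𝓡) 1 = 1 := by
  ext ⟨i, k⟩ ⟨j, l⟩
  fin_cases i <;> fin_cases j <;> fin_cases k <;> fin_cases l <;> simp [box, Matrix.one_apply]

lemma boxOp_one : boxOp (1 : Matrix (Fin 2) (Fin 2) 𝓡) 1 = 1 := by
  ext ⟨i, k⟩ ⟨j, l⟩
  fin_cases i <;> fin_cases j <;> fin_cases k <;> fin_cases l <;> simp [boxOp, Matrix.one_apply]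

end Box

/-- The unnormalized antisymmetrizer `1 - P` on `ℂ² ⊗ ℂ²`. -/
def antiSym : Matrix (Fin 2 × Fin 2) (Fin 2 × Fin 2) ℂ :=
  Matrix.of fun p q => (if p = q then 1 else 0) - if p.1 = q.2 ∧ p.2 = q.1 then 1 else 0

/-- The unnormalized symmetrizer `1 + P` on `ℂ² ⊗ ℂ²`. -/
def sym : Matrix (Fin 2 × Fin 2) (Fin 2 × Fin 2) ℂ :=
  Matrix.of fun p q => (if p = q then 1 else 0) + if p.1 = q.2 ∧ p.2 = q.1 then 1 else 0

lemma sym_mul_antiSym : sym * antiSym = 0 := by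
  ext ⟨i, k⟩ ⟨j, l⟩
  fin_cases i <;> fin_cases j <;> fin_cases k <;> fin_cases l <;>
    simp [sym, antiSym, Matrix.mul_apply, Fintype.sum_prod_type]

lemma sym_add_antiSym : sym + antiSym = (2 : ℂ) • 1 := by
  ext ⟨i, k⟩ ⟨j, l⟩
  fin_cases i <;> fin_cases j <;> fin_cases k <;> fin_cases l <;>
    simp [sym, antiSym] <;> norm_num

/-- The blocks of `R(u)` as a `2 × 2` matrix of one-site operators. -/
def rMat (η u : ℂ) : Matrix (Fin 2) (Fin 2) (Matrix (Fin 2) (Fin 2) ℂ) :=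
  Matrix.of fun i j => rBlock η u i j

lemma rMat_zero_zero (η u : ℂ) : rMat η u 0 0 = !![sinh (u + η), 0; 0, sinh u] := by
  ext σ τ; fin_cases σ <;> fin_cases τ <;> simp [rMat, rBlock, sixVertexR]

lemma rMat_zero_one (η u : ℂ) : rMat η u 0 1 = !![0, 0; sinh η, 0] := by
  ext σ τ; fin_cases σ <;> fin_cases τ <;> simp [rMat, rBlock, sixVertexR]

lemma rMat_one_zero (η u : ℂ) : rMat η u 1 0 = !![0, sinh η; 0, 0] := by
  ext σ τ; fin_cases σ <;> fin_cases τ <;> simp [rMat, rBlock, sixVertexR]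

lemma rMat_one_one (η u : ℂ) : rMat η u 1 1 = !![sinh u, 0; 0, sinh (u + η)] := by
  ext σ τ; fin_cases σ <;> fin_cases τ <;> simp [rMat, rBlock, sixVertexR]

lemma sinh_exchange₁ (u v η : ℂ) :
    sinh (u - v + η) * sinh u = sinh (u - v) * sinh (u + η) + sinh η * sinh v := by
  simp only [sinh_add, sinh_sub, cosh_sub]
  linear_combination (sinh η * sinh v) * Complex.cosh_sq u

lemma sinh_exchange₂ (u v η : ℂ) :
    sinh (u - v + η) * sinh (v + η) = sinh η * sinh (u + η) + sinh (u - v) * sinh v := by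
  simp only [sinh_add, sinh_sub, cosh_sub, sinh_add]
  linear_combination (sinh η * sinh u * cosh η + sinh η ^ 2 * cosh u) * Complex.cosh_sq v +
    (sinh u * cosh v * sinh v - cosh u * sinh v ^ 2) * Complex.cosh_sq η

lemma sinh_exchange₃ (u v η : ℂ) :
    sinh u * sinh (v + η) = sinh v * sinh (u + η) + sinh (u - v) * sinh η := by
  simp only [sinh_add, sinh_sub]
  ring

/-- The Yang–Baxter equation. -/
lemma rMat_rtt (η u v : ℂ) :
    scal (sixVertexR η (u - v)) * box (rMat η u) (rMat η v) =
      boxOp (rMat η u) (rMat η v) * scal (sixVertexR η (u - v)) := by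
  have h1 := sinh_exchange₁ u v η
  have h2 := sinh_exchange₂ u v η
  have h3 := sinh_exchange₃ u v η
  have h0 : (0 : Fin 2 → ℂ) = ![0, 0] := by ext i; fin_cases i <;> rfl
  ext1 ⟨i, k⟩ ⟨j, l⟩
  simp only [scal, box, boxOp, Matrix.mul_apply, Fintype.sum_prod_type, Fin.sum_univ_two,
    map_apply, of_apply]
  simp only [← Algebra.commutes (sixVertexR η (u - v) _ _), ← Algebra.smul_def]
  fin_cases i <;> fin_cases j <;> fin_cases k <;> fin_cases l <;>
    simp [sixVertexR, rMat_zero_zero, rMat_zero_one, rMat_one_zero, rMat_one_one]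
  · exact ⟨Or.inl (by ring), Or.inl (by ring)⟩
  · linear_combination sinh η * h1
  · linear_combination -sinh η * h1
  · exact ⟨Or.inl (by ring), Or.inl (by ring)⟩
  · exact ⟨h0, by linear_combination sinh η * h2⟩
  · exact ⟨by linear_combination sinh η * h3, by linear_combination -sinh η * h3⟩
  · linear_combination -sinh η * h2
  · linear_combination -sinh η * h2
  · exact ⟨by linear_combination -sinh η * h3, by linear_combination sinh η * h3⟩
  · exact ⟨by linear_combination sinh η * h2, h0⟩
  · exact ⟨Or.inl (by ring), Or.inl (by ring)⟩
  · linear_combination -sinh η * h1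
  · linear_combination sinh η * h1
  · exact ⟨Or.inl (by ring), Or.inl (by ring)⟩

/-- At spectral parameters differing by `η` the antisymmetric tensor is an eigenvector of the
product of two `R`-matrices. -/
lemma box_rMat_antiSym (η u : ℂ) :
    box (rMat η u) (rMat η (u - η)) * scal antiSym =
      (sinh (u + η) * sinh (u - η)) • scal antiSym := by
  have h3 := sinh_exchange₃ u (u - η) η
  simp only [sub_sub_cancel, sub_add_cancel] at h3
  ext1 ⟨i, k⟩ ⟨j, l⟩
  simp only [scal, box, Matrix.mul_apply, Fintype.sum_prod_type, Fin.sum_univ_two,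
    map_apply, of_apply, Matrix.smul_apply]
  simp only [← Algebra.commutes (antiSym _ _), ← Algebra.smul_def]
  fin_cases i <;> fin_cases j <;> fin_cases k <;> fin_cases l <;>
    simp [antiSym, rMat_zero_zero, rMat_zero_one, rMat_one_zero, rMat_one_one]
  all_goals
    ext σ τ
    fin_cases σ <;> fin_cases τ <;> simp <;>
      first | linear_combination h3 | linear_combination -h3 | ring1

/-- At `u = 0` the product of two `R`-matrices maps into the antisymmetric tensors. -/
lemma sym_box_rMat (η : ℂ) :
    scal sym * box (rMat η 0) (rMat η (-η)) = 0 := by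
  ext1 ⟨i, k⟩ ⟨j, l⟩
  simp only [scal, box, Matrix.mul_apply, Fintype.sum_prod_type, Fin.sum_univ_two,
    map_apply, of_apply]
  simp only [← Algebra.smul_def]
  fin_cases i <;> fin_cases j <;> fin_cases k <;> fin_cases l <;>
    simp [sym, rMat_zero_zero, rMat_zero_one, rMat_one_zero, rMat_one_one]
  all_goals
    ext σ τ
    fin_cases σ <;> fin_cases τ <;> simp

lemma box_map {𝓡 𝓢 : Type*} [Ring 𝓡] [Ring 𝓢] (f : 𝓡 →+* 𝓢) (X Y : Matrix (Fin 2) (Fin 2) 𝓡) :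
    box (X.map f) (Y.map f) = (box X Y).map f := by
  ext p q; simp [box]

lemma boxOp_map {𝓡 𝓢 : Type*} [Ring 𝓡] [Ring 𝓢] (f : 𝓡 →+* 𝓢) (X Y : Matrix (Fin 2) (Fin 2) 𝓡) :
    boxOp (X.map f) (Y.map f) = (boxOp X Y).map f := by
  ext p q; simp [boxOp]

lemma scal_map {𝓡 𝓢 : Type*} [Ring 𝓡] [Ring 𝓢] [Algebra ℂ 𝓡] [Algebra ℂ 𝓢] (f : 𝓡 →ₐ[ℂ] 𝓢)
    (K : Matrix (Fin 2 × Fin 2) (Fin 2 × Fin 2) ℂ) :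
    (scal K : Matrix _ _ 𝓡).map (f : 𝓡 →+* 𝓢) = scal K := by
  ext p q; simp [scal]

/-- The operator on the quantum space obtained by letting the one-site entries of `X` act on
site `n`. -/
def onSite {N : ℕ} (n : Fin N)
    (X : Matrix (Fin 2 × Fin 2) (Fin 2 × Fin 2) (Matrix (Fin 2) (Fin 2) ℂ)) :
    Matrix (Fin 2 × Fin 2) (Fin 2 × Fin 2) (Matrix (Spins N) (Spins N) ℂ) :=
  X.map ((siteHom n : Matrix (Fin 2) (Fin 2) ℂ →ₐ[ℂ] Matrix (Spins N) (Spins N) ℂ) :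
    Matrix (Fin 2) (Fin 2) ℂ →+* Matrix (Spins N) (Spins N) ℂ)

section OnSite

variable {N : ℕ} (n : Fin N)

lemma onSite_mul (X Y : Matrix (Fin 2 × Fin 2) (Fin 2 × Fin 2) (Matrix (Fin 2) (Fin 2) ℂ)) :
    onSite n (X * Y) = onSite n X * onSite n Y :=
  Matrix.map_mul

lemma onSite_scal (K : Matrix (Fin 2 × Fin 2) (Fin 2 × Fin 2) ℂ) :
    onSite n (scal K) = scal K :=
  scal_map (siteHom n) K

lemma onSite_smul (c : ℂ)
    (X : Matrix (Fin 2 × Fin 2) (Fin 2 × Fin 2) (Matrix (Fin 2) (Fin 2) ℂ)) :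
    onSite n (c • X) = c • onSite n X := by
  ext1 p q
  exact map_smul (siteHom n) c _

lemma onSite_zero : onSite n 0 = 0 := by
  ext1 p q
  exact map_zero (siteHom n)

end OnSite

section Global

variable {N : ℕ} (η : ℂ) (ξ : Fin N → ℂ)

lemma box_mono_succ (z w : ℂ) {k : ℕ} (h : k < N) :
    box (mono η ξ z (k + 1)) (mono η ξ w (k + 1)) =
      onSite ⟨k, h⟩ (box (rMat η (z - ξ ⟨k, h⟩)) (rMat η (w - ξ ⟨k, h⟩))) *
        box (mono η ξ z k) (mono η ξ w k) := by
  rw [mono_succ η ξ z h, mono_succ η ξ w h, box_mul, onSite, ← box_map]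
  · rfl
  · exact fun i j p q => commute_siteOp_mono η ξ z ⟨k, h⟩ _ k le_rfl p q

lemma boxOp_mono_succ (z w : ℂ) {k : ℕ} (h : k < N) :
    boxOp (mono η ξ z (k + 1)) (mono η ξ w (k + 1)) =
      onSite ⟨k, h⟩ (boxOp (rMat η (z - ξ ⟨k, h⟩)) (rMat η (w - ξ ⟨k, h⟩))) *
        boxOp (mono η ξ z k) (mono η ξ w k) := by
  rw [mono_succ η ξ z h, mono_succ η ξ w h, boxOp_mul, onSite, ← boxOp_map]
  · rfl
  · exact fun i j p q => commute_siteOp_mono η ξ w ⟨k, h⟩ _ k le_rfl p q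

/-- The RTT relation for the monodromy matrix. -/
lemma mono_rtt (z w : ℂ) (k : ℕ) (hk : k ≤ N) :
    scal (sixVertexR η (z - w)) * box (mono η ξ z k) (mono η ξ w k) =
      boxOp (mono η ξ z k) (mono η ξ w k) * scal (sixVertexR η (z - w)) := by
  induction k with
  | zero => simp [mono, box_one, boxOp_one]
  | succ k ih =>
    have h := congrArg (onSite (⟨k, hk⟩ : Fin N))
      (rMat_rtt η (z - ξ ⟨k, hk⟩) (w - ξ ⟨k, hk⟩))
    rw [sub_sub_sub_cancel_right, onSite_mul, onSite_mul, onSite_scal] at h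
    rw [box_mono_succ η ξ z w hk, boxOp_mono_succ η ξ z w hk, ← mul_assoc, h, mul_assoc,
      ih (by omega), mul_assoc]

/-- The quantum determinant of the monodromy matrix of the first `k` sites. -/
lemma box_mono_antiSym (z : ℂ) (k : ℕ) (hk : k ≤ N) :
    box (mono η ξ z k) (mono η ξ (z - η) k) * scal antiSym =
      (∏ i : Fin k, (sinh (z - ξ (i.castLE hk) + η) * sinh (z - ξ (i.castLE hk) - η))) •
        scal antiSym := by
  induction k with
  | zero => simp [mono, box_one]
  | succ k ih =>
    have h := congrArg (onSite (⟨k, hk⟩ : Fin N)) (box_rMat_antiSym η (z - ξ ⟨k, hk⟩))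
    rw [onSite_mul, onSite_smul, onSite_scal] at h
    rw [box_mono_succ η ξ z (z - η) hk, mul_assoc, ih (by omega), Matrix.mul_smul,
      sub_right_comm z η, h, smul_smul, Fin.prod_univ_castSucc]
    rfl

/-- At `z = ξₙ` the products of the entries of the two monodromy matrices are antisymmetric in
the row labels, since the factor `R(0) = sinh η · P` of site `n` turns the next factor into an
antisymmetrizer on the auxiliary spaces. -/
lemma sym_box_mono (n : Fin N) (k : ℕ) (hk : k ≤ N) (hn : n < k) :
    scal sym * box (mono η ξ (ξ n) k) (mono η ξ (ξ n - η) k) = 0 := by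
  induction k with
  | zero => omega
  | succ k ih =>
    rw [box_mono_succ η ξ _ _ hk]
    by_cases h : (n : ℕ) = k
    · obtain rfl : n = ⟨k, hk⟩ := Fin.ext h
      have h := congrArg (onSite (⟨k, hk⟩ : Fin N)) (sym_box_rMat η)
      rw [onSite_mul, onSite_scal, onSite_zero] at h
      rw [← mul_assoc, sub_self, sub_right_comm, sub_self, zero_sub, h, zero_mul]
    · have hS := ih (by omega) (by omega)
      set W := box (mono η ξ (ξ n) k) (mono η ξ (ξ n - η) k) with hW
      -- `W` is, up to a factor, its own antisymmetrization
      have hWA : (2 : ℂ) • W = scal antiSym * W := by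
        have h2 : (scal sym + scal antiSym : Matrix _ _ (Matrix (Spins N) (Spins N) ℂ)) =
            (2 : ℂ) • 1 := by
          have h3 : scal (sym + antiSym) = (scal sym + scal antiSym :
            Matrix _ _ (Matrix (Spins N) (Spins N) ℂ)) := Matrix.map_add _ (map_add _) _ _
          rw [← h3, sym_add_antiSym]
          ext1 p q
          simp only [scal, map_apply, Matrix.smul_apply, Matrix.one_apply]
          split_ifs <;> simp [Algebra.algebraMap_eq_smul_one]
        have h4 := congrArg (· * W) h2
        simpa [add_mul, hS] using h4.symm
      have h := congrArg (fun X => onSite (⟨k, hk⟩ : Fin N) (scal sym * X))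
        (box_rMat_antiSym η (ξ n - ξ ⟨k, hk⟩))
      have hz : (scal (0 : Matrix (Fin 2 × Fin 2) (Fin 2 × Fin 2) ℂ) :
          Matrix _ _ (Matrix (Fin 2) (Fin 2) ℂ)) = 0 := by ext1 p q; simp [scal]
      simp only [Matrix.mul_smul, ← scal_mul, sym_mul_antiSym, hz, smul_zero, onSite_zero,
        onSite_mul, onSite_scal] at h
      have h3 : (2 : ℂ) • (scal sym * (onSite ⟨k, hk⟩ (box (rMat η (ξ n - ξ ⟨k, hk⟩))
          (rMat η (ξ n - η - ξ ⟨k, hk⟩))) * W)) = 0 := by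
        rw [← Matrix.mul_smul, ← Matrix.mul_smul, hWA, sub_right_comm, ← mul_assoc (onSite _ _),
          ← mul_assoc, h, zero_mul]
      exact (smul_eq_zero.1 h3).resolve_left two_ne_zero

end Global

/-! ### Exchange relations and fusion relations of the monodromy entries -/

section Relations

variable {N : ℕ} (η : ℂ) (ξ : Fin N → ℂ)

/-- The entries of the RTT relation. -/
lemma rtt_entry (z w : ℂ) (i k j l : Fin 2) :
    ∑ p : Fin 2 × Fin 2, sixVertexR η (z - w) (i, k) p •
        (mono η ξ z N p.1 j * mono η ξ w N p.2 l) =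
      ∑ p : Fin 2 × Fin 2, sixVertexR η (z - w) p (j, l) •
        (mono η ξ w N k p.2 * mono η ξ z N i p.1) := by
  have h := congrFun (congrFun (mono_rtt η ξ z w N le_rfl) (i, k)) (j, l)
  simp only [scal, box, boxOp, Matrix.mul_apply, map_apply, of_apply] at h
  simpa only [← Algebra.commutes (sixVertexR η (z - w) _ _), ← Algebra.smul_def] using h

lemma mono_same_commute (z w : ℂ) (h : sinh (z - w + η) ≠ 0) (i j : Fin 2) :
    Commute (mono η ξ z N i j) (mono η ξ w N i j) := by
  have key := rtt_entry η ξ z w i i j j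
  rw [Commute, SemiconjBy]
  fin_cases i <;> fin_cases j <;>
    simpa [Fintype.sum_prod_type, Fin.sum_univ_two, sixVertexR, h] using key

lemma exchange_D_C (z w : ℂ) :
    sinh (z - w + η) • (mono η ξ z N 1 1 * mono η ξ w N 1 0) =
      sinh η • (mono η ξ w N 1 1 * mono η ξ z N 1 0) +
        sinh (z - w) • (mono η ξ w N 1 0 * mono η ξ z N 1 1) := by
  simpa [Fintype.sum_prod_type, Fin.sum_univ_two, sixVertexR] using rtt_entry η ξ z w 1 1 1 0

lemma exchange_B_C (z w : ℂ) :
    sinh (z - w) • (mono η ξ z N 0 1 * mono η ξ w N 1 0) +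
        sinh η • (mono η ξ z N 1 1 * mono η ξ w N 0 0) =
      sinh η • (mono η ξ w N 1 1 * mono η ξ z N 0 0) +
        sinh (z - w) • (mono η ξ w N 1 0 * mono η ξ z N 0 1) := by
  simpa [Fintype.sum_prod_type, Fin.sum_univ_two, sixVertexR] using rtt_entry η ξ z w 0 1 1 0

lemma exchange_C_B (z w : ℂ) :
    sinh η • (mono η ξ z N 0 0 * mono η ξ w N 1 1) +
        sinh (z - w) • (mono η ξ z N 1 0 * mono η ξ w N 0 1) =
      sinh (z - w) • (mono η ξ w N 0 1 * mono η ξ z N 1 0) +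
        sinh η • (mono η ξ w N 0 0 * mono η ξ z N 1 1) := by
  simpa [Fintype.sum_prod_type, Fin.sum_univ_two, sixVertexR] using rtt_entry η ξ z w 1 0 0 1

lemma exchange_A_D (z w : ℂ) :
    sinh (z - w) • (mono η ξ z N 0 0 * mono η ξ w N 1 1) +
        sinh η • (mono η ξ z N 1 0 * mono η ξ w N 0 1) =
      sinh (z - w) • (mono η ξ w N 1 1 * mono η ξ z N 0 0) +
        sinh η • (mono η ξ w N 1 0 * mono η ξ z N 0 1) := by
  simpa [Fintype.sum_prod_type, Fin.sum_univ_two, sixVertexR] using rtt_entry η ξ z w 0 1 0 1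

lemma exchange_D_A (z w : ℂ) :
    sinh η • (mono η ξ z N 0 1 * mono η ξ w N 1 0) +
        sinh (z - w) • (mono η ξ z N 1 1 * mono η ξ w N 0 0) =
      sinh η • (mono η ξ w N 0 1 * mono η ξ z N 1 0) +
        sinh (z - w) • (mono η ξ w N 0 0 * mono η ξ z N 1 1) := by
  simpa [Fintype.sum_prod_type, Fin.sum_univ_two, sixVertexR] using rtt_entry η ξ z w 1 0 1 0

lemma sinh_sq_sub_sinh_sq (u η : ℂ) :
    sinh u ^ 2 - sinh η ^ 2 = sinh (u + η) * sinh (u - η) := by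
  simp only [sinh_add, sinh_sub]
  linear_combination -sinh u ^ 2 * Complex.cosh_sq η + sinh η ^ 2 * Complex.cosh_sq u

lemma exchange_trace (z w : ℂ) (h : sinh (z - w + η) ≠ 0) (h' : sinh (z - w - η) ≠ 0) :
    mono η ξ z N 0 0 * mono η ξ w N 1 1 + mono η ξ z N 1 1 * mono η ξ w N 0 0 =
      mono η ξ w N 0 0 * mono η ξ z N 1 1 + mono η ξ w N 1 1 * mono η ξ z N 0 0 ∧
    mono η ξ z N 1 0 * mono η ξ w N 0 1 + mono η ξ z N 0 1 * mono η ξ w N 1 0 =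
      mono η ξ w N 1 0 * mono η ξ z N 0 1 + mono η ξ w N 0 1 * mono η ξ z N 1 0 := by
  have h1 := exchange_B_C η ξ z w
  have h2 := exchange_C_B η ξ z w
  have h3 := exchange_A_D η ξ z w
  have h4 := exchange_D_A η ξ z w
  have hne : sinh (z - w) ^ 2 - sinh η ^ 2 ≠ 0 := by
    rw [sinh_sq_sub_sinh_sq]; exact mul_ne_zero h h'
  constructor
  · refine sub_eq_zero.1 ((smul_eq_zero.1 (?_ : (sinh (z - w) ^ 2 - sinh η ^ 2) • _ = _)).resolve_left
      hne)
    linear_combination (norm := module) sinh (z - w) • h3 + sinh (z - w) • h4 - sinh η • h1 - sinh η • h2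
  · refine sub_eq_zero.1 ((smul_eq_zero.1 (?_ : (sinh (z - w) ^ 2 - sinh η ^ 2) • _ = _)).resolve_left
      hne)
    linear_combination (norm := module) sinh (z - w) • h1 + sinh (z - w) • h2 - sinh η • h3 - sinh η • h4

lemma fusion_sym (n : Fin N) (i k j l : Fin 2) :
    mono η ξ (ξ n) N i j * mono η ξ (ξ n - η) N k l +
      mono η ξ (ξ n) N k j * mono η ξ (ξ n - η) N i l = 0 := by
  have h := congrFun (congrFun (sym_box_mono η ξ n N le_rfl n.2) (i, k)) (j, l)
  simp only [scal, box, Matrix.mul_apply, map_apply, of_apply, ← Algebra.smul_def] at h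
  fin_cases i <;> fin_cases k <;>
    simpa [Fintype.sum_prod_type, Fin.sum_univ_two, sym, add_smul, two_smul, add_comm] using h

lemma prod_sinh_eq (z : ℂ) :
    (∏ i : Fin N, (sinh (z - ξ (i.castLE le_rfl) + η) * sinh (z - ξ (i.castLE le_rfl) - η))) =
      aFun η ξ z * dFun ξ (z - η) := by
  rw [Finset.prod_mul_distrib, aFun, dFun, dFun]
  congr 1 <;> refine Finset.prod_congr rfl fun i _ => ?_ <;> congr 1 <;> simp <;> ring

lemma fusion_det (z : ℂ) :
    mono η ξ z N 1 1 * mono η ξ (z - η) N 0 0 - mono η ξ z N 1 0 * mono η ξ (z - η) N 0 1 =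
      (aFun η ξ z * dFun ξ (z - η)) • 1 := by
  have h := congrFun (congrFun (box_mono_antiSym η ξ z N le_rfl) (1, 0)) (1, 0)
  rw [prod_sinh_eq] at h
  simp only [scal, box, Matrix.mul_apply, map_apply, of_apply, Matrix.smul_apply] at h
  simp only [← Algebra.commutes (antiSym _ _), ← Algebra.smul_def] at h
  simpa [Fintype.sum_prod_type, Fin.sum_univ_two, antiSym, sub_eq_add_neg, add_comm] using h

lemma fusion_same (n : Fin N) (i j : Fin 2) :
    mono η ξ (ξ n) N i j * mono η ξ (ξ n - η) N i j = 0 := by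
  have h := fusion_sym η ξ n i i j j
  rw [← two_smul ℂ] at h
  exact (smul_eq_zero.1 h).resolve_left two_ne_zero

lemma fusion_trace_diag (n : Fin N) :
    mono η ξ (ξ n) N 0 0 * mono η ξ (ξ n - η) N 1 1 +
      mono η ξ (ξ n) N 1 1 * mono η ξ (ξ n - η) N 0 0 =
      (aFun η ξ (ξ n) * dFun ξ (ξ n - η)) • 1 := by
  rw [← fusion_det, eq_neg_of_add_eq_zero_left (fusion_sym η ξ n 0 1 0 1)]
  abel

lemma fusion_trace_off (n : Fin N) :
    mono η ξ (ξ n) N 1 0 * mono η ξ (ξ n - η) N 0 1 +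
      mono η ξ (ξ n) N 0 1 * mono η ξ (ξ n - η) N 1 0 =
      -((aFun η ξ (ξ n) * dFun ξ (ξ n - η)) • 1) := by
  rw [← fusion_det, eq_neg_of_add_eq_zero_left (fusion_sym η ξ n 0 1 1 0)]
  abel

end Relations

/-! ### Consequences of the conditions on the parameters -/

lemma sinh_eq_zero_iff' (x : ℂ) : sinh x = 0 ↔ ∃ m : ℤ, x = I * m * Real.pi := by
  constructor
  · intro h
    have h2 : Complex.sin (x * I) = 0 := by rw [Complex.sin_mul_I, h, zero_mul]
    obtain ⟨k, hk⟩ := Complex.sin_eq_zero_iff.1 h2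
    refine ⟨-k, ?_⟩
    have : x = -(x * I) * I := by
      rw [neg_mul, mul_assoc, Complex.I_mul_I]; ring
    rw [this, hk]; push_cast; ring
  · rintro ⟨m, rfl⟩
    have : Complex.sinh (I * m * Real.pi) = Complex.sin (m * Real.pi) * I := by
      rw [← Complex.sinh_mul_I]; ring_nf
    rw [this, Complex.sin_int_mul_pi, zero_mul]

lemma exp_two_mul_eq_iff (x y : ℂ) :
    exp (2 * x) = exp (2 * y) ↔ ∃ m : ℤ, x = y + I * m * Real.pi := by
  rw [Complex.exp_eq_exp_iff_exists_int]
  refine exists_congr fun m => ?_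
  constructor
  · intro h; linear_combination h / 2
  · intro h; linear_combination 2 * h

lemma InhomogeneityCondition.sinh_ne {N : ℕ} {η : ℂ} {ξ : Fin N → ℂ}
    (hξ : InhomogeneityCondition η ξ) {i j : Fin N} (h : i ≠ j) (r : ℤ)
    (hr : r = -1 ∨ r = 0 ∨ r = 1) : sinh (ξ i - ξ j + r * η) ≠ 0 := by
  rw [Ne, sinh_eq_zero_iff']
  rintro ⟨m, hm⟩
  refine hξ i j h (-r) (by omega) m ?_
  push_cast
  linear_combination hm

section Parameters

variable {N : ℕ} {η : ℂ} {ξ : Fin N → ℂ}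

lemma InhomogeneityCondition.sinh_sub (hξ : InhomogeneityCondition η ξ) {i j : Fin N}
    (h : i ≠ j) : sinh (ξ i - ξ j) ≠ 0 := by
  simpa using hξ.sinh_ne h 0 (by simp)

lemma InhomogeneityCondition.sinh_sub_add (hξ : InhomogeneityCondition η ξ) {i j : Fin N}
    (h : i ≠ j) : sinh (ξ i - ξ j + η) ≠ 0 := by
  simpa using hξ.sinh_ne h 1 (by simp)

lemma InhomogeneityCondition.sinh_sub_sub (hξ : InhomogeneityCondition η ξ) {i j : Fin N}
    (h : i ≠ j) : sinh (ξ i - ξ j - η) ≠ 0 := by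
  simpa [sub_eq_add_neg] using hξ.sinh_ne h (-1) (by simp)

lemma sinh_eta_ne (hη : ∀ m : ℤ, η ≠ I * m * Real.pi) : sinh η ≠ 0 := by
  rw [Ne, sinh_eq_zero_iff']
  rintro ⟨m, hm⟩
  exact hη m hm

lemma aFun_ne (hη : ∀ m : ℤ, η ≠ I * m * Real.pi) (hξ : InhomogeneityCondition η ξ) (n : Fin N) :
    aFun η ξ (ξ n) ≠ 0 := by
  rw [aFun, dFun, Finset.prod_ne_zero_iff]
  intro b _
  by_cases h : n = b
  · subst h; simpa using sinh_eta_ne hη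
  · rw [add_sub_right_comm]; exact hξ.sinh_sub_add h

lemma dFun_ne (hη : ∀ m : ℤ, η ≠ I * m * Real.pi) (hξ : InhomogeneityCondition η ξ) (n : Fin N) :
    dFun ξ (ξ n - η) ≠ 0 := by
  rw [dFun, Finset.prod_ne_zero_iff]
  intro b _
  by_cases h : n = b
  · subst h; simpa using sinh_eta_ne hη
  · rw [sub_right_comm]; exact hξ.sinh_sub_sub h

lemma sovNorm_ne (hη : ∀ m : ℤ, η ≠ I * m * Real.pi) (hξ : InhomogeneityCondition η ξ)
    (a : Fin 2) (α : ℂ) (n : Fin N) : sovNorm η ξ a α n ≠ 0 := by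
  rw [sovNorm]
  refine mul_ne_zero ?_ (aFun_ne hη hξ n)
  split_ifs
  · exact Complex.exp_ne_zero _
  · exact one_ne_zero

end Parameters

/-! ### Commutation and fusion of the transfer matrix -/

section Transfer

variable {N : ℕ} {η : ℂ} {ξ : Fin N → ℂ}

lemma mono_commute_node (hξ : InhomogeneityCondition η ξ)
    (n m : Fin N) (i j : Fin 2) : Commute (mono η ξ (ξ n) N i j) (mono η ξ (ξ m) N i j) := by
  by_cases h : n = m
  · subst h; exact Commute.refl _
  · exact mono_same_commute η ξ _ _ (hξ.sinh_sub_add h) i j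

lemma transfer_one_commute (hξ : InhomogeneityCondition η ξ)
    (α : ℂ) (n m : Fin N) : Commute (transfer η ξ 1 α (ξ n)) (transfer η ξ 1 α (ξ m)) := by
  by_cases h : n = m
  · subst h; exact Commute.refl _
  have hC := (mono_commute_node hξ n m 1 0).eq
  have hB := (mono_commute_node hξ n m 0 1).eq
  have hX := (exchange_trace η ξ _ _ (hξ.sinh_sub_add h) (hξ.sinh_sub_sub h)).2
  rw [Commute, SemiconjBy, transfer_one, transfer_one]
  simp only [add_mul, mul_add, smul_mul_assoc, mul_smul_comm]
  linear_combination (norm := module) (exp α * exp α) • hC + (exp (-α) * exp (-α)) • hB +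
    (exp α * exp (-α)) • hX

lemma smul_eq_of_eq_one {M : Type*} [AddCommGroup M] [Module ℂ M] {c : ℂ} (hc : c = 1) {x y : M}
    (h : x = y) : c • x = y := by
  rw [hc, one_smul, h]

lemma twist_one_det (α : ℂ) : (twist 1 α).det = -1 := by
  simp [twist, Matrix.det_fin_two, ← Complex.exp_add]

lemma twist_zero_det (α : ℂ) : (twist 0 α).det = 1 := by
  simp [twist, Matrix.det_fin_two, ← Complex.exp_add]

lemma transfer_one_fusion (α : ℂ) (n : Fin N) :
    transfer η ξ 1 α (ξ n) * transfer η ξ 1 α (ξ n - η) =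
      (aFun η ξ (ξ n) * dFun ξ (ξ n - η) * (twist 1 α).det) • 1 := by
  have hC := fusion_same η ξ n 1 0
  have hB := fusion_same η ξ n 0 1
  have hX := fusion_trace_off η ξ n
  have he : exp α * exp (-α) = 1 := by rw [← Complex.exp_add]; simp
  rw [transfer_one, transfer_one, twist_one_det]
  have hX' := smul_eq_of_eq_one he hX
  simp only [add_mul, mul_add, smul_mul_assoc, mul_smul_comm]
  linear_combination (norm := module) (exp α * exp α) • hC + (exp (-α) * exp (-α)) • hB + hX'

lemma transfer_zero_fusion (α : ℂ) (n : Fin N) :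
    transfer η ξ 0 α (ξ n) * transfer η ξ 0 α (ξ n - η) =
      (aFun η ξ (ξ n) * dFun ξ (ξ n - η) * (twist 0 α).det) • 1 := by
  have hC := fusion_same η ξ n 0 0
  have hB := fusion_same η ξ n 1 1
  have hX := fusion_trace_diag η ξ n
  have he : exp α * exp (-α) = 1 := by rw [← Complex.exp_add]; simp
  rw [transfer_zero, transfer_zero, twist_zero_det]
  have hX' := smul_eq_of_eq_one he hX
  simp only [add_mul, mul_add, smul_mul_assoc, mul_smul_comm]
  linear_combination (norm := module) (exp α * exp α) • hC + (exp (-α) * exp (-α)) • hB + hX'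

end Transfer

/-! ### Trigonometric polynomials -/

section Trig

open Polynomial

/-- `f(z) = e^{-e z} P(e^{2z})` with a polynomial `P` of degree at most `k` whose coefficients in
degrees `k` and `0` are `t` and `b`. For `e = k` this is a trigonometric polynomial of degree `k`
with leading coefficients `t` at `+∞` and `b` at `-∞`. -/
def IsTrig (e : ℂ) (k : ℕ) (t b : ℂ) (f : ℂ → ℂ) : Prop :=
  ∃ P : ℂ[X], P.natDegree ≤ k ∧ P.coeff k = t ∧ P.coeff 0 = b ∧
    ∀ z, f z = exp (-(e * z)) * P.eval (exp (2 * z))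

variable {e e' : ℂ} {k k' : ℕ} {t t' b b' : ℂ} {f g : ℂ → ℂ}

lemma IsTrig.add (hf : IsTrig e k t b f) (hg : IsTrig e k t' b' g) :
    IsTrig e k (t + t') (b + b') fun z => f z + g z := by
  obtain ⟨P, hP, rfl, rfl, hf⟩ := hf
  obtain ⟨Q, hQ, rfl, rfl, hg⟩ := hg
  exact ⟨P + Q, natDegree_add_le_of_degree_le hP hQ, by simp, by simp,
    fun z => by simp only [hf, hg, eval_add]; ring⟩

lemma IsTrig.mul (hf : IsTrig e k t b f) (hg : IsTrig e' k' t' b' g) :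
    IsTrig (e + e') (k + k') (t * t') (b * b') fun z => f z * g z := by
  obtain ⟨P, hP, rfl, rfl, hf⟩ := hf
  obtain ⟨Q, hQ, rfl, rfl, hg⟩ := hg
  refine ⟨P * Q, natDegree_mul_le_of_le hP hQ, coeff_mul_add_eq_of_natDegree_le hP hQ,
    mul_coeff_zero P Q, fun z => ?_⟩
  simp only [hf, hg, eval_mul, add_mul, neg_add, Complex.exp_add]; ring

lemma IsTrig.const_mul (c : ℂ) (hf : IsTrig e k t b f) :
    IsTrig e k (c * t) (c * b) fun z => c * f z := by
  obtain ⟨P, hP, rfl, rfl, hf⟩ := hf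
  exact ⟨C c * P, (natDegree_C_mul_le c P).trans hP, by simp, by simp,
    fun z => by simp only [hf, eval_mul, eval_C]; ring⟩

lemma isTrig_zero (e : ℂ) (k : ℕ) : IsTrig e k 0 0 fun _ => 0 :=
  ⟨0, by simp, by simp, by simp, fun z => by simp⟩

lemma isTrig_const (c : ℂ) : IsTrig 0 0 c c fun _ => c :=
  ⟨C c, by simp, by simp, by simp, fun z => by simp⟩

lemma IsTrig.raise (hf : IsTrig e k t b f) : IsTrig e (k + 1) 0 b f := by
  obtain ⟨P, hP, rfl, rfl, hf⟩ := hf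
  exact ⟨P, hP.trans (Nat.le_succ k), coeff_eq_zero_of_natDegree_lt (Nat.lt_succ_of_le hP), rfl, hf⟩

lemma IsTrig.shift (hf : IsTrig e k t b f) : IsTrig (e + 2) (k + 1) t 0 f := by
  obtain ⟨P, hP, rfl, rfl, hf⟩ := hf
  refine ⟨X * P, ?_, by simp, by simp, fun z => ?_⟩
  · refine natDegree_mul_le.trans ?_
    rw [natDegree_X]; omega
  · rw [hf, eval_mul, eval_X, ← mul_assoc, ← Complex.exp_add]
    ring_nf

lemma IsTrig.sum {ι : Type*} (s : Finset ι) {t b : ι → ℂ} {f : ι → ℂ → ℂ}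
    (h : ∀ i ∈ s, IsTrig e k (t i) (b i) (f i)) :
    IsTrig e k (∑ i ∈ s, t i) (∑ i ∈ s, b i) fun z => ∑ i ∈ s, f i z := by
  classical
  induction s using Finset.induction_on with
  | empty => simpa using isTrig_zero e k
  | insert i s hi ih =>
    simp only [Finset.sum_insert hi]
    exact (h i (Finset.mem_insert_self i s)).add
      (ih fun j hj => h j (Finset.mem_insert_of_mem hj))

lemma IsTrig.prod {ι : Type*} (s : Finset ι) {t b : ι → ℂ} {f : ι → ℂ → ℂ}
    (h : ∀ i ∈ s, IsTrig 1 1 (t i) (b i) (f i)) :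
    IsTrig s.card s.card (∏ i ∈ s, t i) (∏ i ∈ s, b i) fun z => ∏ i ∈ s, f i z := by
  classical
  induction s using Finset.induction_on with
  | empty => simpa using isTrig_const 1
  | insert i s hi ih =>
    simp only [Finset.prod_insert hi, Finset.card_insert_of_notMem hi]
    have := (h i (Finset.mem_insert_self i s)).mul
      (ih fun j hj => h j (Finset.mem_insert_of_mem hj))
    rw [add_comm s.card 1]
    push_cast
    exact this

lemma isTrig_sinh (c : ℂ) : IsTrig 1 1 (exp (-c) / 2) (-(exp c / 2)) fun z => sinh (z - c) := by
  refine ⟨C (exp (-c) / 2) * X + C (-(exp c / 2)), natDegree_linear_le, by simp, by simp,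
    fun z => ?_⟩
  simp only [eval_add, eval_mul, eval_C, eval_X, Complex.sinh, sub_eq_add_neg, neg_add, neg_neg,
    Complex.exp_add, two_mul, one_mul]
  have h : exp (-z) * exp z = 1 := by rw [← Complex.exp_add]; simp
  linear_combination (-exp z * exp (-c) / 2) * h

lemma isTrig_cosh (c : ℂ) : IsTrig 1 1 (exp c / 2) (exp (-c) / 2) fun z => cosh (c + z) := by
  refine ⟨C (exp c / 2) * X + C (exp (-c) / 2), natDegree_linear_le, by simp, by simp,
    fun z => ?_⟩
  simp only [eval_add, eval_mul, eval_C, eval_X, Complex.cosh, neg_add,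
    Complex.exp_add, two_mul, one_mul]
  have h : exp (-z) * exp z = 1 := by rw [← Complex.exp_add]; simp
  linear_combination (-exp z * exp c / 2) * h

lemma exists_exp_two_mul {w : ℂ} (hw : w ≠ 0) : ∃ z, exp (2 * z) = w :=
  ⟨Complex.log w / 2, by rw [mul_div_cancel₀ _ two_ne_zero, Complex.exp_log hw]⟩

/-- The leading coefficients are determined by the function. -/
lemma IsTrig.unique (hf : IsTrig e k t b f) (hg : IsTrig e k t' b' f) : t = t' ∧ b = b' := by
  obtain ⟨P, hP, rfl, rfl, hf⟩ := hf
  obtain ⟨Q, hQ, rfl, rfl, hg⟩ := hg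
  have h : P = Q := by
    refine Polynomial.eq_of_infinite_eval_eq P Q (Set.Infinite.mono (s := {0}ᶜ) ?_ ?_)
    · intro w hw
      obtain ⟨z, rfl⟩ := exists_exp_two_mul hw
      exact mul_left_cancel₀ (Complex.exp_ne_zero _) ((hf z).symm.trans (hg z))
    · exact Set.Finite.infinite_compl (Set.finite_singleton 0)
  rw [h]
  exact ⟨rfl, rfl⟩

lemma IsTrig.congr (hf : IsTrig e k t b f) (he : e = e') (hk : k = k') (ht : t = t') (hb : b = b')
    (hg : ∀ z, g z = f z) : IsTrig e' k' t' b' g := by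
  subst he hk ht hb
  obtain ⟨P, h1, h2, h3, h4⟩ := hf
  exact ⟨P, h1, h2, h3, fun z => by rw [hg, h4]⟩

/-- Lagrange interpolation functions for the exponent `e` and the nodes `y`. -/
def lagr {N : ℕ} (e : ℂ) (y : Fin N → ℂ) (i : Fin N) (z : ℂ) : ℂ :=
  exp (-(e * (z - y i))) *
    ∏ j ∈ Finset.univ.erase i, (exp (2 * z) - exp (2 * y j)) / (exp (2 * y i) - exp (2 * y j))

/-- The function with leading coefficient `1` which vanishes at the nodes. -/
def nodal {N : ℕ} (e : ℂ) (y : Fin N → ℂ) (z : ℂ) : ℂ :=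
  exp (-(e * z)) * ∏ j, (exp (2 * z) - exp (2 * y j))

lemma IsTrig.interpolation {N : ℕ} {y : Fin N → ℂ} (hf : IsTrig e N t b f)
    (hy : Function.Injective fun i => exp (2 * y i)) :
    (∀ z, f z = t * nodal e y z + ∑ i, lagr e y i z * f (y i)) ∧
      ((∀ i, f (y i) = 0) → b = t * ∏ i, -exp (2 * y i)) := by
  obtain ⟨P, hP, rfl, rfl, hf⟩ := hf
  set Z : ℂ[X] := ∏ i, (X - C (exp (2 * y i))) with hZ
  have hZm : Z.Monic := monic_prod_of_monic _ _ fun i _ => monic_X_sub_C _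
  have hZd : Z.natDegree = N := by
    rw [hZ, natDegree_prod_of_monic _ _ fun i _ => monic_X_sub_C _]; simp
  have hdeg : (P - C (P.coeff N) * Z).degree < (Finset.univ : Finset (Fin N)).card := by
    rw [Finset.card_univ, Fintype.card_fin, degree_lt_iff_coeff_zero]
    intro m hm
    rcases hm.eq_or_lt with rfl | hm
    · have : Z.coeff N = 1 := by
        have h := hZm.coeff_natDegree
        rwa [hZd] at h
      simp [this]
    · rw [coeff_sub, coeff_C_mul, coeff_eq_zero_of_natDegree_lt (hP.trans_lt hm),
        coeff_eq_zero_of_natDegree_lt (hZd.trans_lt hm)]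
      simp
  have key := Lagrange.eq_interpolate (s := Finset.univ) (v := fun i => exp (2 * y i))
    hy.injOn hdeg
  have hZi : ∀ i, Z.eval (exp (2 * y i)) = 0 := fun i => by
    rw [hZ, eval_prod]
    exact Finset.prod_eq_zero (Finset.mem_univ i) (by simp)
  have hev : ∀ i, (P - C (P.coeff N) * Z).eval (exp (2 * y i)) = exp (e * y i) * f (y i) := by
    intro i
    rw [eval_sub, eval_mul, hZi, mul_zero, sub_zero, hf, ← mul_assoc, ← Complex.exp_add]
    simp
  simp only [hev] at key
  constructor
  · intro z
    have h := congrArg (eval (exp (2 * z))) key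
    rw [eval_sub, eval_mul, eval_C, Lagrange.interpolate_apply, eval_finsetSum,
      sub_eq_iff_eq_add] at h
    rw [hf, h, hZ, eval_prod, nodal, mul_add, Finset.mul_sum, add_comm]
    congr 1
    · simp only [eval_sub, eval_X, eval_C]; ring
    · refine Finset.sum_congr rfl fun i _ => ?_
      rw [eval_mul, eval_C, Lagrange.basis, eval_prod, lagr]
      have h1 : exp (-(e * (z - y i))) = exp (-(e * z)) * exp (e * y i) := by
        rw [← Complex.exp_add]; ring_nf
      have h2 : ∀ j, eval (exp (2 * z)) (Lagrange.basisDivisor (exp (2 * y i)) (exp (2 * y j))) =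
          (exp (2 * z) - exp (2 * y j)) / (exp (2 * y i) - exp (2 * y j)) := by
        intro j
        simp only [Lagrange.basisDivisor, eval_mul, eval_C, eval_sub, eval_X]
        rw [div_eq_inv_mul]
      simp only [h1, h2]
      ring
  · intro h0
    simp only [h0, mul_zero] at key
    have hPZ : P = C (P.coeff N) * Z := by
      rw [← sub_eq_zero, key, Lagrange.interpolate_apply]
      simp
    have h := congrArg (fun Q => Q.coeff 0) hPZ
    simp only [mul_coeff_zero, coeff_C_zero] at h
    rw [h]
    congr 1
    rw [coeff_zero_eq_eval_zero, hZ, eval_prod]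
    simp

end Trig

/-! ### Conservation of the spin -/

/-- The number of down spins. -/
def downs {N : ℕ} (s : Spins N) : ℕ := ∑ n, (s n : ℕ)

lemma rBlock_conserve (η u : ℂ) {i j σ τ : Fin 2} (h : rBlock η u i j σ τ ≠ 0) :
    (i : ℕ) + σ = j + τ := by
  revert h
  fin_cases i <;> fin_cases j <;> fin_cases σ <;> fin_cases τ <;> simp [rBlock, sixVertexR]

lemma siteOp_conserve {N : ℕ} (n : Fin N) (η u : ℂ) {i j : Fin 2} {s s' : Spins N}
    (h : siteOp n (rBlock η u i j) s s' ≠ 0) : (i : ℕ) + downs s = j + downs s' := by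
  simp only [siteOp, of_apply, ne_eq, ite_eq_right_iff, Classical.not_imp] at h
  have h1 := rBlock_conserve η u h.2
  have h2 : ∑ m ∈ Finset.univ.erase n, (s m : ℕ) = ∑ m ∈ Finset.univ.erase n, (s' m : ℕ) :=
    Finset.sum_congr rfl fun m hm => by rw [h.1 m (Finset.ne_of_mem_erase hm)]
  rw [downs, downs, ← Finset.add_sum_erase _ _ (Finset.mem_univ n),
    ← Finset.add_sum_erase _ (fun m => ((s' m : Fin 2) : ℕ)) (Finset.mem_univ n)]
  omega

lemma exists_of_mul_apply_ne_zero {n : Type*} [Fintype n] {X Y : Matrix n n ℂ} {s s' : n}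
    (h : (X * Y) s s' ≠ 0) : ∃ r, X s r ≠ 0 ∧ Y r s' ≠ 0 := by
  rw [Matrix.mul_apply] at h
  obtain ⟨r, _, hr⟩ := Finset.exists_ne_zero_of_sum_ne_zero h
  exact ⟨r, left_ne_zero_of_mul hr, right_ne_zero_of_mul hr⟩

/-- The six-vertex model conserves the number of down spins, counted on all spaces together. -/
lemma mono_conserve {N : ℕ} (η : ℂ) (ξ : Fin N → ℂ) (z : ℂ) (k : ℕ) (hk : k ≤ N) {i j : Fin 2}
    {s s' : Spins N} (h : mono η ξ z k i j s s' ≠ 0) : (i : ℕ) + downs s = j + downs s' := by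
  induction k generalizing i j s s' with
  | zero =>
    rw [mono, Matrix.one_apply] at h
    split_ifs at h with hij
    · rw [Matrix.one_apply] at h
      split_ifs at h with hs
      · rw [hij, hs]
      · exact absurd rfl h
    · simp at h
  | succ k ih =>
    rw [mono_succ_apply η ξ z hk, Matrix.add_apply] at h
    by_cases h0 : (siteOp ⟨k, hk⟩ (rBlock η (z - ξ ⟨k, hk⟩) i 0) * mono η ξ z k 0 j) s s' = 0
    · rw [h0, zero_add] at h
      obtain ⟨r, h1, h2⟩ := exists_of_mul_apply_ne_zero h
      exact (siteOp_conserve _ _ _ h1).trans (ih (by omega) h2)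
    · obtain ⟨r, h1, h2⟩ := exists_of_mul_apply_ne_zero h0
      exact (siteOp_conserve _ _ _ h1).trans (ih (by omega) h2)

/-! ### Leading coefficients of the monodromy entries -/

/-- Matrices whose entries are trigonometric polynomials. -/
def MTrig {N : ℕ} (e : ℂ) (k : ℕ) (T B : Matrix (Spins N) (Spins N) ℂ)
    (F : ℂ → Matrix (Spins N) (Spins N) ℂ) : Prop :=
  ∀ s s', IsTrig e k (T s s') (B s s') fun z => F z s s'

section MTrig

variable {N : ℕ} {e e' : ℂ} {k k' : ℕ} {T T' B B' : Matrix (Spins N) (Spins N) ℂ}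
  {F G : ℂ → Matrix (Spins N) (Spins N) ℂ}

lemma MTrig.add (hF : MTrig e k T B F) (hG : MTrig e k T' B' G) :
    MTrig e k (T + T') (B + B') fun z => F z + G z :=
  fun s s' => (hF s s').add (hG s s')

lemma MTrig.mul (hF : MTrig e k T B F) (hG : MTrig e' k' T' B' G) :
    MTrig (e + e') (k + k') (T * T') (B * B') fun z => F z * G z := by
  intro s s'
  simp only [Matrix.mul_apply]
  exact IsTrig.sum _ fun r _ => (hF s r).mul (hG r s')

lemma MTrig.smul (c : ℂ) (hF : MTrig e k T B F) :
    MTrig e k (c • T) (c • B) fun z => c • F z :=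
  fun s s' => (hF s s').const_mul c

lemma MTrig.raise (hF : MTrig e k T B F) : MTrig e (k + 1) 0 B F :=
  fun s s' => (hF s s').raise

lemma MTrig.shift (hF : MTrig e k T B F) : MTrig (e + 2) (k + 1) T 0 F :=
  fun s s' => (hF s s').shift

lemma MTrig.congr (hF : MTrig e k T B F) (he : e = e') (hk : k = k') (hT : T = T')
    (hB : B = B') (hG : ∀ z, G z = F z) : MTrig e' k' T' B' G :=
  fun s s' => (hF s s').congr he hk (by rw [hT]) (by rw [hB]) fun z => by rw [hG]

lemma mTrig_const (X : Matrix (Spins N) (Spins N) ℂ) : MTrig 0 0 X X fun _ => X :=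
  fun s s' => isTrig_const (X s s')

lemma siteOp_mTrig (n : Fin N) {X : ℂ → Matrix (Fin 2) (Fin 2) ℂ}
    {T B : Matrix (Fin 2) (Fin 2) ℂ} (h : ∀ σ τ, IsTrig e k (T σ τ) (B σ τ) fun z => X z σ τ) :
    MTrig e k (siteOp n T) (siteOp n B) fun z => siteOp n (X z) := by
  intro s s'
  simp only [siteOp, of_apply]
  split_ifs
  · exact h _ _
  · exact isTrig_zero e k

/-- Leading coefficient at `+∞` of the diagonal entry `⟨i|R(z - c)|i⟩` on the one-site state `σ`. -/
def siteTop (η c : ℂ) (i σ : Fin 2) : ℂ :=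
  exp (-c) / 2 * if σ = i then exp η else 1

/-- Leading coefficient at `-∞` of the diagonal entry `⟨i|R(z - c)|i⟩` on the one-site state `σ`. -/
def siteBot (η c : ℂ) (i σ : Fin 2) : ℂ :=
  -(exp c / 2) * if σ = i then exp (-η) else 1

lemma siteOp_diagonal (n : Fin N) (f : Fin 2 → ℂ) :
    siteOp n (diagonal f) = diagonal fun s : Spins N => f (s n) := by
  refine ext_mulVec fun ψ => ?_
  funext s
  rw [siteOp_mulVec, mulVec_diagonal, Finset.sum_eq_single (s n)]
  · simp
  · intro b _ hb
    rw [diagonal_apply_ne _ hb.symm, zero_mul]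
  · simp

lemma rBlock_diag_trig (η c : ℂ) (i σ τ : Fin 2) :
    IsTrig 1 1 (diagonal (siteTop η c i) σ τ) (diagonal (siteBot η c i) σ τ)
      fun z => rBlock η (z - c) i i σ τ := by
  by_cases hστ : σ = τ
  · subst hστ
    rw [diagonal_apply_eq, diagonal_apply_eq, siteTop, siteBot]
    by_cases hi : σ = i
    · subst hi
      refine (isTrig_sinh (c - η)).congr rfl rfl ?_ ?_ fun z => ?_
      · rw [if_pos rfl, neg_sub, sub_eq_add_neg, Complex.exp_add]; ring
      · rw [if_pos rfl, sub_eq_add_neg, Complex.exp_add]; ring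
      · simp only [rBlock, sixVertexR, of_apply, if_pos]; congr 1; ring
    · refine (isTrig_sinh c).congr rfl rfl ?_ ?_ fun z => ?_
      · rw [if_neg hi, mul_one]
      · rw [if_neg hi, mul_one]
      · simp [rBlock, sixVertexR, Ne.symm hi]
  · rw [diagonal_apply_ne _ hστ, diagonal_apply_ne _ hστ]
    refine (isTrig_zero 1 1).congr rfl rfl rfl rfl fun z => ?_
    simp only [rBlock, sixVertexR, of_apply, Prod.mk.injEq, true_and, if_neg hστ]
    rw [if_neg]
    rintro ⟨h1, h2⟩
    exact hστ (h2.trans h1)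

lemma rBlock_off (η u v : ℂ) {i j : Fin 2} (h : i ≠ j) : rBlock η u i j = rBlock η v i j := by
  ext σ τ
  simp [rBlock, sixVertexR, h]

/-- The off-diagonal entries of one `R`-matrix do not depend on `z`, so each pair of them costs one
power of `e^{±z}`: the leading coefficients of the diagonal entries come from the diagonal terms. -/
lemma mono_mTrig (η : ℂ) (ξ : Fin N → ℂ) (k : ℕ) (hk : k ≤ N) :
    (∀ i, MTrig k k (diagonal fun s => ∏ m : Fin k, siteTop η (ξ (m.castLE hk)) i (s (m.castLE hk)))
        (diagonal fun s => ∏ m : Fin k, siteBot η (ξ (m.castLE hk)) i (s (m.castLE hk)))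
        fun z => mono η ξ z k i i) ∧
      ∀ i j, i ≠ j → ∃ B, MTrig ((k : ℂ) - 1) k 0 B fun z => mono η ξ z k i j := by
  induction k with
  | zero =>
    constructor
    · intro i
      simp only [mono, Matrix.one_apply_eq, Finset.univ_eq_empty, Finset.prod_empty,
        Nat.cast_zero, diagonal_one]
      exact mTrig_const 1
    · intro i j hij
      refine ⟨0, fun s s' => ?_⟩
      simp only [mono, Matrix.one_apply_ne hij]
      exact isTrig_zero _ _
  | succ k ih =>
    obtain ⟨ihd, iho⟩ := ih (by omega)
    set n : Fin N := ⟨k, hk⟩ with hn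
    have hd : ∀ i, MTrig 1 1 (diagonal fun s : Spins N => siteTop η (ξ n) i (s n))
        (diagonal fun s => siteBot η (ξ n) i (s n))
        fun z => siteOp n (rBlock η (z - ξ n) i i) := fun i => by
      rw [← siteOp_diagonal, ← siteOp_diagonal]
      exact siteOp_mTrig n (rBlock_diag_trig η (ξ n) i)
    have ho : ∀ i j, i ≠ j → ∃ X : Matrix (Spins N) (Spins N) ℂ,
        MTrig 0 0 X X fun z => siteOp n (rBlock η (z - ξ n) i j) := fun i j hij =>
      ⟨_, (mTrig_const (siteOp n (rBlock η 0 i j))).congr rfl rfl rfl rfl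
        fun z => by rw [rBlock_off η _ 0 hij]⟩
    have hmono : ∀ z i j p, i ≠ p → mono η ξ z (k + 1) i j =
        siteOp n (rBlock η (z - ξ n) i i) * mono η ξ z k i j +
        siteOp n (rBlock η (z - ξ n) i p) * mono η ξ z k p j := by
      intro z i j p hip
      rw [mono_succ_apply η ξ z hk]
      revert hip
      fin_cases i <;> fin_cases p <;> intro hip
      · exact absurd rfl hip
      · rfl
      · exact add_comm _ _
      · exact absurd rfl hip
    constructor
    · intro i
      obtain ⟨p, hp⟩ : ∃ p : Fin 2, i ≠ p := ⟨i + 1, by fin_cases i <;> decide⟩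
      obtain ⟨X, hX⟩ := ho i p hp
      obtain ⟨B, hB⟩ := iho p i hp.symm
      have h1 := (hd i).mul (ihd i)
      have h2 := ((hX.mul hB).shift.congr (by ring : _ = 1 + (k : ℂ)) (by ring : _ = 1 + k)
        (mul_zero X) rfl fun z => rfl)
      refine (h1.add h2).congr (by push_cast; ring) (add_comm 1 k) ?_ ?_
        fun z => hmono z i i p hp
      · rw [add_zero, diagonal_mul_diagonal]
        congr 1; funext s
        rw [Fin.prod_univ_castSucc, mul_comm]; rfl
      · rw [add_zero, diagonal_mul_diagonal]
        congr 1; funext s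
        rw [Fin.prod_univ_castSucc, mul_comm]; rfl
    · intro i j hij
      obtain ⟨X, hX⟩ := ho i j hij
      obtain ⟨B, hB⟩ := iho i j hij
      have h1 := ((hd i).mul hB).congr (by ring : _ = (k : ℂ)) (rfl : _ = 1 + k) (mul_zero _) rfl
        fun z => rfl
      have h2 := (hX.mul (ihd j)).raise.congr (by ring : _ = (k : ℂ)) (by ring : _ = 1 + k) rfl rfl
        fun z => rfl
      exact ⟨_, (h1.add h2).congr (by push_cast; ring) (add_comm 1 k) (add_zero 0) rfl
        fun z => hmono z i j j hij⟩

end MTrig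

/-! ### Leading coefficients in terms of the number of down spins -/

lemma downs_le {N : ℕ} (s : Spins N) : downs s ≤ N := by
  have : downs s ≤ ∑ _n : Fin N, 1 := Finset.sum_le_sum fun n _ => Nat.lt_succ_iff.1 (s n).2
  simpa using this

lemma exists_downs_eq {N m : ℕ} (h : m ≤ N) : ∃ s : Spins N, downs s = m := by
  obtain ⟨t, ht⟩ := Finset.exists_subset_card_eq (s := (Finset.univ : Finset (Fin N)))
    (by simpa using h : m ≤ _)
  classical
  refine ⟨fun n => if n ∈ t then 1 else 0, ?_⟩
  rw [downs, ← ht.2]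
  simp [apply_ite]

lemma prod_ite_one {N : ℕ} (c : ℂ) (s : Spins N) :
    (∏ n, if s n = 1 then exp c else 1) = exp (c * downs s) := by
  have : ∀ n, (if s n = 1 then exp c else 1) = exp (c * ((s n : ℕ) : ℂ)) := by
    intro n
    rcases Fin.exists_fin_two.1 ⟨s n, rfl⟩ with h | h <;> simp [h]
  simp only [this, downs, Nat.cast_sum, Finset.mul_sum, Complex.exp_sum]

lemma prod_ite_zero {N : ℕ} (c : ℂ) (s : Spins N) :
    (∏ n, if s n = 0 then exp c else 1) = exp (c * (N - downs s)) := by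
  have h1 : (∏ n, if s n = 0 then exp c else 1) * (∏ n, if s n = 1 then exp c else 1) =
      exp (c * N) := by
    rw [← Finset.prod_mul_distrib, mul_comm c, Complex.exp_nat_mul]
    have : ∀ n, ((if s n = 0 then exp c else 1) * if s n = 1 then exp c else 1) = exp c := by
      intro n
      rcases Fin.exists_fin_two.1 ⟨s n, rfl⟩ with h | h <;> simp [h]
    simp [this]
  rw [prod_ite_one] at h1
  rw [mul_sub, Complex.exp_sub, eq_div_iff (Complex.exp_ne_zero _), h1]

/-- The common factor of the leading coefficients at `+∞`. -/
def topFactor {N : ℕ} (ξ : Fin N → ℂ) : ℂ := ∏ n, exp (-ξ n) / 2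

/-- The common factor of the leading coefficients at `-∞`. -/
def botFactor {N : ℕ} (ξ : Fin N → ℂ) : ℂ := ∏ n, -(exp (ξ n) / 2)

lemma topFactor_ne {N : ℕ} (ξ : Fin N → ℂ) : topFactor ξ ≠ 0 :=
  Finset.prod_ne_zero_iff.2 fun _ _ => div_ne_zero (Complex.exp_ne_zero _) two_ne_zero

lemma botFactor_eq {N : ℕ} (ξ : Fin N → ℂ) :
    botFactor ξ = topFactor ξ * ∏ n, -exp (2 * ξ n) := by
  rw [botFactor, topFactor, ← Finset.prod_mul_distrib]
  refine Finset.prod_congr rfl fun n _ => ?_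
  have h : exp (-ξ n) * exp (ξ n) = 1 := by rw [← Complex.exp_add]; simp
  rw [two_mul, Complex.exp_add]
  linear_combination (exp (ξ n) / 2) * h

lemma botFactor_ne {N : ℕ} (ξ : Fin N → ℂ) : botFactor ξ ≠ 0 :=
  Finset.prod_ne_zero_iff.2 fun _ _ =>
    neg_ne_zero.2 (div_ne_zero (Complex.exp_ne_zero _) two_ne_zero)

section Asymptotics

variable {N : ℕ} (η : ℂ) (ξ : Fin N → ℂ)

lemma mono_zero_zero_mTrig :
    MTrig N N (diagonal fun s => topFactor ξ * exp (η * (N - downs s)))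
      (diagonal fun s => botFactor ξ * exp (-η * (N - downs s))) fun z => mono η ξ z N 0 0 := by
  refine ((mono_mTrig η ξ N le_rfl).1 0).congr rfl rfl ?_ ?_ fun z => rfl
  · congr 1; funext s
    rw [← prod_ite_zero, topFactor, ← Finset.prod_mul_distrib]; rfl
  · congr 1; funext s
    rw [← prod_ite_zero, botFactor, ← Finset.prod_mul_distrib]; rfl

lemma mono_one_one_mTrig :
    MTrig N N (diagonal fun s => topFactor ξ * exp (η * downs s))
      (diagonal fun s => botFactor ξ * exp (-η * downs s)) fun z => mono η ξ z N 1 1 := by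
  refine ((mono_mTrig η ξ N le_rfl).1 1).congr rfl rfl ?_ ?_ fun z => rfl
  · congr 1; funext s
    rw [← prod_ite_one, topFactor, ← Finset.prod_mul_distrib]; rfl
  · congr 1; funext s
    rw [← prod_ite_one, botFactor, ← Finset.prod_mul_distrib]; rfl

lemma transfer_one_mTrig (α : ℂ) :
    ∃ B, MTrig ((N : ℂ) - 1) N 0 B fun z => transfer η ξ 1 α z := by
  obtain ⟨B, hB⟩ := (mono_mTrig η ξ N le_rfl).2 1 0 (by decide)
  obtain ⟨B', hB'⟩ := (mono_mTrig η ξ N le_rfl).2 0 1 (by decide)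
  exact ⟨_, ((hB.smul (exp α)).add (hB'.smul (exp (-α)))).congr rfl rfl (by simp) rfl
    fun z => transfer_one η ξ α z⟩

end Asymptotics

/-! ### Product vectors -/

/-- The product vector `⊗ₙ vₙ`. -/
def tens {N : ℕ} (v : Fin N → Fin 2 → ℂ) : Space N := fun s => ∏ n, v n (s n)

section Transport

variable {N : ℕ} (η : ℂ) (ξ : Fin N → ℂ) (z : ℂ)

lemma tens_update (v : Fin N → Fin 2 → ℂ) (n : Fin N) (x : Fin 2 → ℂ) (s : Spins N) :
    tens (Function.update v n x) s = x (s n) * ∏ m ∈ Finset.univ.erase n, v m (s m) := by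
  rw [tens, ← Finset.mul_prod_erase _ _ (Finset.mem_univ n), Function.update_self]
  congr 1
  exact Finset.prod_congr rfl fun m hm => by
    rw [Function.update_of_ne (Finset.ne_of_mem_erase hm)]

lemma siteOp_mulVec_tens (n : Fin N) (X : Matrix (Fin 2) (Fin 2) ℂ) (v : Fin N → Fin 2 → ℂ) :
    siteOp n X *ᵥ tens v = tens (Function.update v n (X *ᵥ v n)) := by
  funext s
  rw [siteOp_mulVec, tens_update, mulVec, dotProduct, Finset.sum_mul]
  refine Finset.sum_congr rfl fun σ _ => ?_
  rw [tens, ← Finset.mul_prod_erase _ _ (Finset.mem_univ n), Function.update_self, mul_assoc]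
  congr 2
  exact Finset.prod_congr rfl fun m hm => by
    rw [Function.update_of_ne (Finset.ne_of_mem_erase hm)]

lemma siteOp_sum_mulVec_tens (n : Fin N) (X Y : Matrix (Fin 2) (Fin 2) ℂ) (a b c : ℂ)
    (v : Fin N → Fin 2 → ℂ) (v' : Fin 2 → ℂ) (h : a • (X *ᵥ v n) + b • (Y *ᵥ v n) = c • v') :
    a • (siteOp n X *ᵥ tens v) + b • (siteOp n Y *ᵥ tens v) =
      c • tens (Function.update v n v') := by
  funext s
  have hs := congrFun h (s n)
  simp only [Pi.add_apply, Pi.smul_apply, smul_eq_mul] at hs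
  simp only [siteOp_mulVec_tens, Pi.add_apply, Pi.smul_apply, smul_eq_mul, tens_update]
  linear_combination (∏ m ∈ Finset.univ.erase n, v m (s m)) * hs

/-- If the auxiliary column vectors `c` are transported through the sites of a product vector,
then the monodromy matrix maps the first one to the last one. -/
lemma mono_transport_col (c : ℕ → Fin 2 → ℂ) (v v' : Fin N → Fin 2 → ℂ) (r : Fin N → ℂ)
    (h : ∀ (n : Fin N) (i : Fin 2), c n 0 • (rBlock η (z - ξ n) i 0 *ᵥ v n) +
      c n 1 • (rBlock η (z - ξ n) i 1 *ᵥ v n) = (r n * c (n + 1) i) • v' n)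
    (k : ℕ) (hk : k ≤ N) (i : Fin 2) :
    c 0 0 • (mono η ξ z k i 0 *ᵥ tens v) + c 0 1 • (mono η ξ z k i 1 *ᵥ tens v) =
      ((∏ m : Fin k, r (m.castLE hk)) * c k i) • tens fun n => if (n : ℕ) < k then v' n else v n := by
  induction k generalizing i with
  | zero =>
    simp only [mono, Finset.univ_eq_empty, Finset.prod_empty, one_mul, Nat.not_lt_zero, if_false]
    rcases Fin.exists_fin_two.1 ⟨i, rfl⟩ with rfl | rfl <;> simp
  | succ k ih =>
    set n : Fin N := ⟨k, hk⟩ with hn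
    set w : Fin N → Fin 2 → ℂ := fun n => if (n : ℕ) < k then v' n else v n with hw
    have h0 := ih (by omega) 0
    have h1 := ih (by omega) 1
    have hwn : w n = v n := by simp [hw, hn]
    have hstep := siteOp_sum_mulVec_tens n (rBlock η (z - ξ n) i 0) (rBlock η (z - ξ n) i 1)
      (c k 0) (c k 1) (r n * c (k + 1) i) w (v' n) (by rw [hwn]; exact h n i)
    have hupd : (fun m : Fin N => if (m : ℕ) < k + 1 then v' m else v m) =
        Function.update w n (v' n) := by
      funext m
      by_cases hm : m = n
      · subst hm; simp [hn]
      · have : (m : ℕ) ≠ k := fun h => hm (Fin.ext h)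
        rw [Function.update_of_ne hm, hw]
        simp only [show ((m : ℕ) < k + 1) = ((m : ℕ) < k) by
          rw [eq_iff_iff]; omega]
    rw [hupd, mono_succ_apply η ξ z hk, mono_succ_apply η ξ z hk, Fin.prod_univ_castSucc, add_mulVec,
      add_mulVec, ← mulVec_mulVec, ← mulVec_mulVec, ← mulVec_mulVec, ← mulVec_mulVec]
    have e0 := congrArg (siteOp n (rBlock η (z - ξ n) i 0) *ᵥ ·) h0
    have e1 := congrArg (siteOp n (rBlock η (z - ξ n) i 1) *ᵥ ·) h1
    simp only [mulVec_add, mulVec_smul] at e0 e1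
    have e2 := congrArg ((∏ m : Fin k, r (m.castLE (by omega))) • ·) hstep
    simp only [smul_add, smul_smul] at e2
    simp only [← hn]
    have hr : r (Fin.castLE hk (Fin.last k)) = r n := rfl
    have hrc : ∀ m : Fin k, r (Fin.castLE hk m.castSucc) = r (m.castLE (by omega)) := fun m => rfl
    simp only [hr, hrc]
    linear_combination (norm := module) e0 + e1 + e2

/-- The analogue of `mono_transport_col` for auxiliary row vectors, which are transported in the
opposite direction. -/
lemma mono_transport_row (c : ℕ → Fin 2 → ℂ) (v v' : Fin N → Fin 2 → ℂ) (r : Fin N → ℂ)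
    (k : ℕ) (hk : k ≤ N)
    (h : ∀ (n : Fin N) (j : Fin 2), (n : ℕ) < k →
      c (n + 1) 0 • (rBlock η (z - ξ n) 0 j *ᵥ v n) +
        c (n + 1) 1 • (rBlock η (z - ξ n) 1 j *ᵥ v n) = (r n * c n j) • v' n)
    (j : Fin 2) :
    c k 0 • (mono η ξ z k 0 j *ᵥ tens v) + c k 1 • (mono η ξ z k 1 j *ᵥ tens v) =
      ((∏ m : Fin k, r (m.castLE hk)) * c 0 j) • tens fun n => if (n : ℕ) < k then v' n else v n := by
  induction k generalizing j v with
  | zero =>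
    simp only [mono, Finset.univ_eq_empty, Finset.prod_empty, one_mul, Nat.not_lt_zero, if_false]
    rcases Fin.exists_fin_two.1 ⟨j, rfl⟩ with rfl | rfl <;> simp
  | succ k ih =>
    set n : Fin N := ⟨k, hk⟩ with hn
    have hs : ∀ p, _ := fun p => siteOp_sum_mulVec_tens n (rBlock η (z - ξ n) 0 p)
      (rBlock η (z - ξ n) 1 p) (c (k + 1) 0) (c (k + 1) 1) (r n * c k p) v (v' n)
      (h n p (by simp [hn]))
    have hi := ih (Function.update v n (v' n)) (by omega) (fun m j hm => by
      rw [Function.update_of_ne (fun hmn => by rw [hmn] at hm; simp [hn] at hm)]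
      exact h m j (by omega)) j
    have hupd : (fun m : Fin N => if (m : ℕ) < k + 1 then v' m else v m) =
        fun m : Fin N => if (m : ℕ) < k then v' m else Function.update v n (v' n) m := by
      funext m
      by_cases hm : m = n
      · subst hm; simp [hn]
      · have : (m : ℕ) ≠ k := fun h => hm (Fin.ext h)
        rw [Function.update_of_ne hm]
        simp only [show ((m : ℕ) < k + 1) = ((m : ℕ) < k) by
          rw [eq_iff_iff]; omega]
    have hc : ∀ i p, siteOp n (rBlock η (z - ξ n) i p) * mono η ξ z k p j =
        mono η ξ z k p j * siteOp n (rBlock η (z - ξ n) i p) := fun i p =>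
      (commute_siteOp_mono η ξ z n _ k le_rfl p j).eq
    rw [hupd, mono_succ_apply η ξ z hk, mono_succ_apply η ξ z hk, Fin.prod_univ_castSucc]
    simp only [← hn, hc, add_mulVec, ← mulVec_mulVec]
    have e0 := congrArg (mono η ξ z k 0 j *ᵥ ·) (hs 0)
    have e1 := congrArg (mono η ξ z k 1 j *ᵥ ·) (hs 1)
    simp only [mulVec_add, mulVec_smul] at e0 e1
    have e2 := congrArg (r n • ·) hi
    simp only [smul_add, smul_smul] at e2
    have hr : r (Fin.castLE hk (Fin.last k)) = r n := rfl
    have hrc : ∀ m : Fin k, r (Fin.castLE hk m.castSucc) = r (m.castLE (by omega)) := fun m => rfl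
    simp only [hr, hrc]
    linear_combination (norm := module) e0 + e1 + e2

end Transport

/-! ### Spin helix states and reference states -/

lemma rBlock_mulVec (η u : ℂ) (v : Fin 2 → ℂ) :
    rBlock η u 0 0 *ᵥ v = ![sinh (u + η) * v 0, sinh u * v 1] ∧
    rBlock η u 0 1 *ᵥ v = ![0, sinh η * v 0] ∧
    rBlock η u 1 0 *ᵥ v = ![sinh η * v 1, 0] ∧
    rBlock η u 1 1 *ᵥ v = ![sinh u * v 0, sinh (u + η) * v 1] := by
  refine ⟨?_, ?_, ?_, ?_⟩ <;> ext σ <;> fin_cases σ <;>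
    simp [rBlock, sixVertexR, mulVec, dotProduct, Fin.sum_univ_two]

lemma sinh_exp₁ (u η : ℂ) : sinh u * exp η + sinh η * exp (-u) = sinh (u + η) := by
  have h1 : exp u * exp (-u) = 1 := by rw [← Complex.exp_add]; simp
  have h2 : exp η * exp (-η) = 1 := by rw [← Complex.exp_add]; simp
  simp only [Complex.sinh, neg_add, Complex.exp_add]
  ring

lemma sinh_exp₂ (u η : ℂ) : sinh u * exp (-η) + sinh η * exp u = sinh (u + η) := by
  simp only [Complex.sinh, neg_add, Complex.exp_add]
  ring

section Helix

variable {N : ℕ} (η : ℂ) (ξ : Fin N → ℂ)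

/-- The one-site factors of a spin helix state of amplitude `c` and chirality `ε = ±1`. -/
def helix (ε c : ℂ) (n : Fin N) : Fin 2 → ℂ :=
  ![1, c * exp (ε * (ξ n - n * η))]

lemma tens_twisted (ε c δ : ℂ) (s : Spins N) :
    tens (fun n => ![1, exp δ * helix η ξ ε c n 1]) s =
      exp (δ * downs s) * tens (helix η ξ ε c) s := by
  rw [tens, tens, ← prod_ite_one, ← Finset.prod_mul_distrib]
  refine Finset.prod_congr rfl fun n _ => ?_
  rcases Fin.exists_fin_two.1 ⟨s n, rfl⟩ with h | h <;> simp [h, helix]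

lemma prod_aFun (z : ℂ) :
    ∏ m : Fin N, sinh (z - ξ (m.castLE le_rfl) + η) = aFun η ξ z := by
  rw [aFun, dFun]
  refine Finset.prod_congr rfl fun i _ => ?_
  rw [add_sub_right_comm]; rfl

/-- The action of the monodromy matrix on spin helix states: after conjugation of the auxiliary space
by the unipotent matrices with entry `x k`, the diagonal entries twist the helix by a factor for each
down spin. The off-diagonal remainders cancel in `T(z)` if the twist closes the helix. -/
lemma mono_helix {ε : ℂ} (hε : ε = 1 ∨ ε = -1) (c z : ℂ) :
    let x : ℕ → ℂ := fun k => c * exp (ε * (z + η - k * η))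
    (∀ s, (mono η ξ z N 0 0 *ᵥ tens (helix η ξ ε c)) s +
        x 0 * (mono η ξ z N 0 1 *ᵥ tens (helix η ξ ε c)) s =
      aFun η ξ z * exp (ε * η * downs s) * tens (helix η ξ ε c) s) ∧
    (∀ s, (mono η ξ z N 1 1 *ᵥ tens (helix η ξ ε c)) s -
        x N * (mono η ξ z N 0 1 *ᵥ tens (helix η ξ ε c)) s =
      dFun ξ z * exp (-(ε * η) * downs s) * tens (helix η ξ ε c) s) := by
  intro x
  -- the three identities behind the local transport relations
  have I1 : ∀ u, sinh u + sinh η * exp (ε * (u + η)) = sinh (u + η) * exp (ε * η) := by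
    intro u
    rw [mul_add, Complex.exp_add]
    rcases hε with rfl | rfl
    · rw [← sinh_exp₂ u η]
      have h2 : exp η * exp (-η) = 1 := by rw [← Complex.exp_add]; simp
      simp only [one_mul]
      linear_combination (-sinh u) * h2
    · rw [← sinh_exp₁ u η]
      have h2 : exp η * exp (-η) = 1 := by rw [← Complex.exp_add]; simp
      simp only [neg_mul, one_mul]
      linear_combination (-sinh u) * h2
  have I2 : ∀ u, sinh η + exp (ε * (u + η)) * sinh u = sinh (u + η) * exp (ε * u) := by
    intro u
    have h2 : exp u * exp (-u) = 1 := by rw [← Complex.exp_add]; simp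
    rw [mul_add, Complex.exp_add]
    rcases hε with rfl | rfl
    · rw [← sinh_exp₁ u η]
      simp only [one_mul]
      linear_combination (-sinh η) * h2
    · rw [← sinh_exp₂ u η]
      simp only [neg_mul, one_mul]
      linear_combination (-sinh η) * h2
  have I3 : ∀ u, sinh (u + η) - exp (ε * u) * sinh η = sinh u * exp (-(ε * η)) := by
    intro u
    rcases hε with rfl | rfl
    · rw [← sinh_exp₂ u η]; simp only [one_mul]; ring
    · rw [← sinh_exp₁ u η]; simp only [neg_mul, one_mul, neg_neg]; ring
  have hx : ∀ n : Fin N, x n = helix η ξ ε c n 1 * exp (ε * (z - ξ n + η)) := fun n => by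
    simp only [x, helix, cons_val_one, cons_val_fin_one]
    rw [mul_assoc, ← Complex.exp_add]; congr 2; ring
  have hx' : ∀ n : Fin N, x (n + 1) = helix η ξ ε c n 1 * exp (ε * (z - ξ n)) := fun n => by
    simp only [x, helix, cons_val_one, cons_val_fin_one]
    rw [mul_assoc, ← Complex.exp_add]; congr 2; push_cast; ring
  have hE : ∀ u : ℂ, exp (ε * (u + η)) = exp (ε * u) * exp (ε * η) := fun u => by
    rw [mul_add, Complex.exp_add]
  have hEE : exp (ε * η) * exp (-(ε * η)) = 1 := by rw [← Complex.exp_add]; simp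
  constructor
  · intro s
    have key := mono_transport_col η ξ z (fun k => ![1, x k]) (helix η ξ ε c)
      (fun n => ![1, exp (ε * η) * helix η ξ ε c n 1]) (fun n => sinh (z - ξ n + η)) ?_ N le_rfl 0
    · have hs := congrFun key s
      simp only [Fin.is_lt, if_true, tens_twisted, prod_aFun, Pi.add_apply, Pi.smul_apply,
        smul_eq_mul, cons_val_zero, cons_val_one, cons_val_fin_one, one_mul, mul_one] at hs
      rw [hs]; ring
    · intro n i
      obtain ⟨h00, h01, h10, h11⟩ := rBlock_mulVec η (z - ξ n) (helix η ξ ε c n)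
      have hh : helix η ξ ε c n 0 = 1 := rfl
      have i1 := I1 (z - ξ n)
      have i2 := I2 (z - ξ n)
      set y := helix η ξ ε c n 1 with hy
      fin_cases i <;> ext σ <;> fin_cases σ <;>
        simp [h00, h01, h10, h11, hh, ← hy, hx n, hx' n]
      · linear_combination y * i1
      · linear_combination y * i2
      · rw [hE]; ring
  · intro s
    have key := mono_transport_row η ξ z (fun k => ![-x k, 1]) (helix η ξ ε c)
      (fun n => ![1, exp (-(ε * η)) * helix η ξ ε c n 1]) (fun n => sinh (z - ξ n)) N le_rfl ?_ 1
    · have hs := congrFun key s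
      have hd : ∏ m : Fin N, sinh (z - ξ (m.castLE le_rfl)) = dFun ξ z := rfl
      simp only [Fin.is_lt, if_true, tens_twisted, hd, Pi.add_apply, Pi.smul_apply,
        smul_eq_mul, cons_val_zero, cons_val_one, cons_val_fin_one, one_mul, mul_one] at hs
      linear_combination hs
    · intro n j _
      obtain ⟨h00, h01, h10, h11⟩ := rBlock_mulVec η (z - ξ n) (helix η ξ ε c n)
      have hh : helix η ξ ε c n 0 = 1 := rfl
      have i2 := I2 (z - ξ n)
      have i3 := I3 (z - ξ n)
      set y := helix η ξ ε c n 1 with hy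
      fin_cases j <;> ext σ <;> fin_cases σ <;>
        simp [h00, h01, h10, h11, hh, ← hy, hx n, hx' n]
      · linear_combination y * i2
      · rw [hE]; linear_combination (-y * exp (ε * (z - ξ n)) * sinh (z - ξ n) * y) * hEE
      · linear_combination y * i3

/-- The state with all spins up. -/
def allUp (N : ℕ) : Spins N := fun _ => 0

/-- The state with all spins down. -/
def allDown (N : ℕ) : Spins N := fun _ => 1

lemma downs_eq_zero {s : Spins N} (h : downs s = 0) : s = allUp N := by
  funext n
  have := Finset.sum_eq_zero_iff.1 h n (Finset.mem_univ n)
  exact Fin.ext this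

lemma downs_eq_top {s : Spins N} (h : downs s = N) : s = allDown N := by
  funext n
  have h1 : ∑ n, (s n : ℕ) = ∑ _n : Fin N, 1 := by rw [← downs, h]; simp
  have := (Finset.sum_eq_sum_iff_of_le fun n _ => Nat.lt_succ_iff.1 (s n).2).1 h1 n
    (Finset.mem_univ n)
  exact Fin.ext this

lemma downs_allUp : downs (allUp N) = 0 := by simp [downs, allUp]

lemma downs_allDown : downs (allDown N) = N := by simp [downs, allDown]

/-- An operator that conserves the number of down spins acts as a scalar on a state that is
determined by this number. -/
lemma mulVec_apply_of_unique {X : Matrix (Spins N) (Spins N) ℂ}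
    (hX : ∀ s s', X s s' ≠ 0 → downs s = downs s') {s₀ : Spins N}
    (hs : ∀ s, downs s = downs s₀ → s = s₀) (ψ : Space N) : (X *ᵥ ψ) s₀ = X s₀ s₀ * ψ s₀ := by
  rw [mulVec, dotProduct, Finset.sum_eq_single s₀]
  · intro s _ h
    by_contra h0
    exact h (hs s (hX _ _ (left_ne_zero_of_mul h0)).symm)
  · simp

lemma mono_diag_conserve (z : ℂ) (i : Fin 2) (s s' : Spins N)
    (h : mono η ξ z N i i s s' ≠ 0) : downs s = downs s' := by
  have := mono_conserve η ξ z N le_rfl h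
  omega

lemma mono_allUp (z : ℂ) : mono η ξ z N 0 0 (allUp N) (allUp N) = aFun η ξ z ∧
    mono η ξ z N 1 1 (allUp N) (allUp N) = dFun ξ z := by
  have h := mono_helix η ξ (ε := 1) (Or.inl rfl) 0 z
  have ht : tens (helix η ξ 1 0) (allUp N) = 1 := by simp [tens, helix, allUp]
  have hu : ∀ s : Spins N, downs s = downs (allUp N) → s = allUp N := fun s hs =>
    downs_eq_zero (hs.trans downs_allUp)
  have h1 := h.1 (allUp N)
  have h2 := h.2 (allUp N)
  rw [mulVec_apply_of_unique (mono_diag_conserve η ξ z _) hu] at h1 h2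
  simp only [ht, downs_allUp] at h1 h2
  exact ⟨by simpa using h1, by simpa using h2⟩

lemma mono_allDown (z : ℂ) : mono η ξ z N 0 0 (allDown N) (allDown N) = dFun ξ z ∧
    mono η ξ z N 1 1 (allDown N) (allDown N) = aFun η ξ z := by
  have hu : ∀ s : Spins N, downs s = downs (allDown N) → s = allDown N := fun s hs =>
    downs_eq_top (hs.trans downs_allDown)
  have ht : tens (fun _ : Fin N => ![0, 1]) (allDown N) = 1 := by simp [tens, allDown]
  constructor
  · have key := mono_transport_row η ξ z (fun _ => ![1, 0]) (fun _ => ![0, 1])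
      (fun _ => ![0, 1]) (fun n => sinh (z - ξ n)) N le_rfl ?_ 0
    · have hs := congrFun key (allDown N)
      simp only [ite_self, Pi.add_apply, Pi.smul_apply, smul_eq_mul, cons_val_zero, cons_val_one,
        cons_val_fin_one, one_mul, mul_one, zero_mul, add_zero, ht,
        mulVec_apply_of_unique (mono_diag_conserve η ξ z _) hu] at hs
      exact hs
    · intro n j _
      obtain ⟨h00, h01, h10, h11⟩ := rBlock_mulVec η (z - ξ n) ![0, 1]
      fin_cases j <;> ext σ <;> fin_cases σ <;> simp [h00, h01]
  · have key := mono_transport_col η ξ z (fun _ => ![0, 1]) (fun _ => ![0, 1])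
      (fun _ => ![0, 1]) (fun n => sinh (z - ξ n + η)) ?_ N le_rfl 1
    · have hs := congrFun key (allDown N)
      simp only [ite_self, Pi.add_apply, Pi.smul_apply, smul_eq_mul, cons_val_zero, cons_val_one,
        cons_val_fin_one, one_mul, mul_one, zero_mul, zero_add, ht, prod_aFun,
        mulVec_apply_of_unique (mono_diag_conserve η ξ z _) hu] at hs
      exact hs
    · intro n i
      obtain ⟨h00, h01, h10, h11⟩ := rBlock_mulVec η (z - ξ n) ![0, 1]
      fin_cases i <;> ext σ <;> fin_cases σ <;> simp [h01, h11]

/-- If the twist closes the spin helix, then `T(z)` has an eigenvector with `m` down spins whose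
eigenvalue contains no Bethe roots. -/
lemma helix_mem_spectrum {ε : ℂ} (hε : ε = 1 ∨ ε = -1) (α : ℂ) {m : ℕ} (hm : m ≤ N)
    (hα : exp (2 * α) = exp (-(ε * η * N))) :
    (fun z => exp (α + ε * η * m) * aFun η ξ z + exp (-(α + ε * η * m)) * dFun ξ z) ∈
      spectrum η ξ 0 α := by
  set ψ := tens (helix η ξ ε 1) with hψ
  have hψ0 : ∀ s, ψ s ≠ 0 := fun s => by
    rw [hψ, tens, Finset.prod_ne_zero_iff]
    intro n _
    rcases Fin.exists_fin_two.1 ⟨s n, rfl⟩ with h | h <;> simp [h, helix]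
  -- the helix is mapped to itself by `T(z)` in each sector
  have hT : ∀ z s, (transfer η ξ 0 α z *ᵥ ψ) s =
      (exp (α + ε * η * downs s) * aFun η ξ z + exp (-(α + ε * η * downs s)) * dFun ξ z) * ψ s := by
    intro z s
    obtain ⟨h1, h2⟩ := mono_helix η ξ hε 1 z
    have h1 := h1 s
    have h2 := h2 s
    have h3 : exp (-α) * exp (ε * (z + η - N * η)) = exp α * exp (ε * (z + η - (0 : ℕ) * η)) := by
      have e1 : exp (-α) * exp (ε * (z + η - N * η)) =
          exp (-(ε * η * N)) * (exp (-α) * exp (ε * (z + η - (0 : ℕ) * η))) := by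
        rw [← Complex.exp_add, ← Complex.exp_add, ← Complex.exp_add]; congr 1; push_cast; ring
      rw [e1, ← hα, ← mul_assoc, ← Complex.exp_add]
      congr 2; ring
    rw [transfer_zero, add_mulVec, smul_mulVec, smul_mulVec]
    simp only [Pi.add_apply, Pi.smul_apply, smul_eq_mul]
    rw [neg_add, Complex.exp_add, Complex.exp_add, ← neg_mul (ε * η)]
    simp only [one_mul] at h1 h2
    linear_combination exp α * h1 + exp (-α) * h2 + (mono η ξ z N 0 1 *ᵥ ψ) s * h3
  obtain ⟨s₀, hs₀⟩ := exists_downs_eq hm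
  refine ⟨fun s => if downs s = m then ψ s else 0, fun h => ?_, fun z => ?_⟩
  · have := congrFun h s₀
    simp only [hs₀, if_true, Pi.zero_apply] at this
    exact hψ0 s₀ this
  · have hcons : ∀ s s', transfer η ξ 0 α z s s' ≠ 0 → downs s = downs s' := by
      intro s s' h
      rw [transfer_zero] at h
      simp only [Matrix.add_apply, Matrix.smul_apply, smul_eq_mul] at h
      by_cases h0 : mono η ξ z N 0 0 s s' = 0
      · rw [h0, mul_zero, zero_add] at h
        exact mono_diag_conserve η ξ z 1 s s' (right_ne_zero_of_mul h)
      · exact mono_diag_conserve η ξ z 0 s s' h0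
    funext s
    have hs : (transfer η ξ 0 α z *ᵥ fun s => if downs s = m then ψ s else 0) s =
        if downs s = m then (transfer η ξ 0 α z *ᵥ ψ) s else 0 := by
      rw [mulVec, mulVec, dotProduct, dotProduct]
      split_ifs with hsm
      · refine Finset.sum_congr rfl fun s' _ => ?_
        by_cases h0 : transfer η ξ 0 α z s s' = 0
        · rw [h0, zero_mul, zero_mul]
        · rw [if_pos ((hcons s s' h0).symm.trans hsm)]
      · refine Finset.sum_eq_zero fun s' _ => ?_
        by_cases h0 : transfer η ξ 0 α z s s' = 0
        · rw [h0, zero_mul]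
        · rw [if_neg (fun h => hsm ((hcons s s' h0).trans h)), mul_zero]
    rw [hs]
    simp only [Pi.smul_apply, smul_eq_mul]
    split_ifs with hsm
    · rw [hT, hsm]
    · rw [mul_zero]

end Helix

/-! ### Families of covectors generated by commuting operators -/

section SovMat

variable {N : ℕ}

/-- The ordered product `∏ₙ Xₙ^{hₙ}`. -/
def powProd (X : Fin N → Matrix (Spins N) (Spins N) ℂ) (h : Fin N → Fin 2) :
    Matrix (Spins N) (Spins N) ℂ :=
  ((List.finRange N).map fun n => X n ^ (h n : ℕ)).prod

/-- The matrix with rows `⟨S| ∏ₙ Xₙ^{hₙ}`. -/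
def sovMat (S : Space N) (X : Fin N → Matrix (Spins N) (Spins N) ℂ) :
    Matrix (Spins N) (Spins N) ℂ :=
  Matrix.of fun h => S ᵥ* powProd X h

lemma linearIndependent_sovMat_iff (S : Space N) (X : Fin N → Matrix (Spins N) (Spins N) ℂ) :
    LinearIndependent ℂ (fun h => S ᵥ* powProd X h) ↔ (sovMat S X).det ≠ 0 := by
  rw [← isUnit_iff_ne_zero, ← Matrix.isUnit_iff_isUnit_det, ← linearIndependent_rows_iff_isUnit]
  rfl

lemma powProd_smul (c : Fin N → ℂ) (X : Fin N → Matrix (Spins N) (Spins N) ℂ) (h : Fin N → Fin 2) :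
    powProd (fun n => c n • X n) h = (∏ n, c n ^ (h n : ℕ)) • powProd X h := by
  rw [powProd, powProd, ← List.prod_ofFn, List.ofFn_eq_map]
  induction List.finRange N with
  | nil => simp
  | cons n l ih =>
    rw [List.map_cons, List.prod_cons, ih, smul_pow, smul_mul_assoc, mul_smul_comm, smul_smul,
      List.map_cons, List.prod_cons, List.map_cons, List.prod_cons]

lemma det_sovMat_smul_ne_zero {c : Fin N → ℂ} (hc : ∀ n, c n ≠ 0) (S : Space N)
    (X : Fin N → Matrix (Spins N) (Spins N) ℂ) :
    (sovMat S fun n => c n • X n).det ≠ 0 ↔ (sovMat S X).det ≠ 0 := by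
  have h : sovMat S (fun n => c n • X n) =
      Matrix.of fun h s => (∏ n, c n ^ ((h n : Fin 2) : ℕ)) * sovMat S X h s := by
    ext h s
    simp [sovMat, powProd_smul, vecMul_smul]
  rw [h, Matrix.det_mul_column]
  refine ⟨right_ne_zero_of_mul, mul_ne_zero ?_⟩
  exact Finset.prod_ne_zero_iff.2 fun h _ => Finset.prod_ne_zero_iff.2 fun n _ =>
    pow_ne_zero _ (hc n)

lemma isSovBasis_iff {η : ℂ} {ξ : Fin N → ℂ} (hη : ∀ m : ℤ, η ≠ I * m * Real.pi)
    (hξ : InhomogeneityCondition η ξ) (a : Fin 2) (α : ℂ) (S : Space N) :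
    IsSovBasis η ξ a α S ↔ (sovMat S fun n => transfer η ξ a α (ξ n)).det ≠ 0 := by
  rw [← det_sovMat_smul_ne_zero (fun n => inv_ne_zero (sovNorm_ne hη hξ a α n)),
    ← linearIndependent_sovMat_iff]
  refine ⟨fun h => h.1, fun h => ⟨h, ?_⟩⟩
  exact h.span_eq_top_of_card_eq_finrank' (by simp)

/-- The determinant is polynomial in a parameter on which the operators depend linearly. -/
lemma exists_polynomial_det (S : Space N) (A D : Fin N → Matrix (Spins N) (Spins N) ℂ) :
    ∃ Q : Polynomial ℂ, ∀ κ, Q.eval κ = (sovMat S fun n => κ • A n + D n).det := by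
  classical
  set Y : Fin N → Matrix (Spins N) (Spins N) (Polynomial ℂ) := fun n =>
    (Polynomial.X : Polynomial ℂ) • (A n).map Polynomial.C + (D n).map Polynomial.C with hY
  refine ⟨(Matrix.of fun h : Spins N => (fun s => Polynomial.C (S s)) ᵥ*
    ((List.finRange N).map fun n => Y n ^ (h n : ℕ)).prod).det, fun κ => ?_⟩
  rw [← Polynomial.coe_evalRingHom, RingHom.map_det]
  congr 1
  ext h s
  have h1 : ((Polynomial.evalRingHom κ).mapMatrix
      ((List.finRange N).map fun n => Y n ^ (h n : ℕ)).prod) =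
      powProd (fun n => κ • A n + D n) h := by
    rw [map_list_prod, List.map_map, powProd]
    congr 1
    refine List.map_congr_left fun n _ => ?_
    simp only [Function.comp, map_pow]
    congr 1
    ext i j
    simp [hY, mul_comm κ]
  rw [RingHom.mapMatrix_apply] at h1
  rw [RingHom.mapMatrix_apply, Matrix.map_apply, Matrix.of_apply, RingHom.map_vecMul, h1]
  have h2 : (⇑(Polynomial.evalRingHom κ) ∘ fun s => Polynomial.C (S s)) = S := by
    funext s; simp
  rw [h2]
  rfl

/-- If one covector generates a basis, so does almost every covector. -/
lemma ae_det_sovMat_ne_zero (X : Fin N → Matrix (Spins N) (Spins N) ℂ) {S₀ : Space N}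
    (h₀ : (sovMat S₀ X).det ≠ 0) :
    ∀ᵐ S : Space N ∂MeasureTheory.volume, (sovMat S X).det ≠ 0 := by
  have hcont : Continuous fun S : Space N => (sovMat S X).det := by
    refine Continuous.matrix_det (continuous_pi fun h => continuous_pi fun s => ?_)
    simp only [sovMat, of_apply, vecMul, dotProduct]
    fun_prop
  -- on every line in the direction of `S₀` there are only finitely many exceptions
  have hfin : ∀ S : Space N, {c : ℂ | (sovMat (S + c • S₀) X).det = 0}.Finite := by
    intro S
    set M := (sovMat S₀ X)⁻¹ * sovMat S X with hM
    have hu : IsUnit (sovMat S₀ X).det := isUnit_iff_ne_zero.2 h₀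
    have hd : ∀ c : ℂ, (sovMat (S + c • S₀) X).det = (sovMat S₀ X).det * (-M).charpoly.eval c := by
      intro c
      rw [Matrix.eval_charpoly, ← Matrix.det_mul]
      congr 1
      rw [mul_sub, mul_neg, hM, Matrix.mul_nonsing_inv_cancel_left _ _ hu]
      ext h s
      simp only [sovMat, add_vecMul, smul_vecMul, of_apply, Pi.add_apply, Pi.smul_apply, sub_neg_eq_add,
        Matrix.add_apply, Matrix.mul_apply, Matrix.scalar_apply, smul_eq_mul]
      simp [diagonal_apply, add_comm, mul_comm]
    refine ((-M).charpoly.roots.toFinset.finite_toSet).subset fun c hc => ?_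
    rw [Set.mem_ofPred_eq, hd] at hc
    simpa [(Matrix.charpoly_monic (-M)).ne_zero] using (mul_eq_zero.1 hc).resolve_left h₀
  set W : Set (ℂ × Space N) := {p | (sovMat (p.2 + p.1 • S₀) X).det = 0} with hW
  have hWm : MeasurableSet W := by
    refine (isClosed_eq (hcont.comp ?_) continuous_const).measurableSet
    exact continuous_snd.add (continuous_fst.smul continuous_const)
  have h1 : (MeasureTheory.volume.prod MeasureTheory.volume : MeasureTheory.Measure _) W = 0 := by
    rw [MeasureTheory.Measure.prod_apply_symm hWm]
    simp only [hW, Set.preimage_ofPred_eq]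
    have : ∀ S : Space N, MeasureTheory.volume {c : ℂ | (sovMat (S + c • S₀) X).det = 0} = 0 :=
      fun S => (hfin S).measure_zero _
    simp [this]
  rw [MeasureTheory.Measure.measure_prod_null hWm] at h1
  obtain ⟨c, hc⟩ := h1.exists
  have h2 : MeasureTheory.volume {S : Space N | (sovMat (S + c • S₀) X).det = 0} = 0 := hc
  have h3 := MeasureTheory.measure_preimage_add_right MeasureTheory.volume (-(c • S₀))
    {S : Space N | (sovMat (S + c • S₀) X).det = 0}
  rw [h2] at h3
  rw [MeasureTheory.ae_iff]
  convert h3 using 2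
  ext S
  simp

/-- Covectors which are joint eigenvectors of operators `Xₙ` are independent if the `n`-th
eigenvalue vanishes exactly for `hₙ = 0`. -/
lemma linearIndependent_of_eigen {X : Fin N → Matrix (Spins N) (Spins N) ℂ}
    {w : Spins N → Space N} (hw : ∀ h, w h ≠ 0) {χ : Spins N → Fin N → ℂ}
    (hX : ∀ h n, w h ᵥ* X n = χ h n • w h) (hχ : ∀ h n, χ h n ≠ 0 ↔ h n = 1) :
    LinearIndependent ℂ w ∧ (sovMat (∑ h, w h) X).det ≠ 0 := by
  -- the triangular matrix of eigenvalues
  set c : Spins N → Spins N → ℂ := fun h k => ∏ n, χ h n ^ (k n : ℕ) with hc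
  have hpow : ∀ h k, w h ᵥ* powProd X k = c h k • w h := by
    intro h k
    rw [powProd, hc]
    simp only
    rw [← List.prod_ofFn, List.ofFn_eq_map]
    induction List.finRange N with
    | nil => simp
    | cons n l ih =>
      have hn : w h ᵥ* X n ^ (k n : ℕ) = χ h n ^ (k n : ℕ) • w h := by
        rcases Fin.exists_fin_two.1 ⟨k n, rfl⟩ with h1 | h1
        · simp [h1]
        · simp [h1, hX]
      simp only [List.map_cons, List.prod_cons]
      rw [← vecMul_vecMul, hn, smul_vecMul, ih, smul_smul]
  have hc0 : ∀ h k, c h k ≠ 0 → downs k ≤ downs h ∧ (downs k = downs h → k = h) := by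
    intro h k hk
    have hle : ∀ n, (k n : ℕ) ≤ h n := by
      intro n
      rcases Fin.exists_fin_two.1 ⟨k n, rfl⟩ with h1 | h1
      · simp [h1]
      · have := Finset.prod_ne_zero_iff.1 hk n (Finset.mem_univ n)
        rw [h1] at this
        rw [h1, (hχ h n).1 (by simpa using this)]
    refine ⟨Finset.sum_le_sum fun n _ => hle n, fun he => ?_⟩
    funext n
    exact Fin.ext ((Finset.sum_eq_sum_iff_of_le fun n _ => hle n).1 he n (Finset.mem_univ n))
  have hcd : ∀ h, c h h ≠ 0 := by
    intro h
    refine Finset.prod_ne_zero_iff.2 fun n _ => ?_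
    rcases Fin.exists_fin_two.1 ⟨h n, rfl⟩ with h1 | h1
    · simp [h1]
    · rw [h1]; simpa using (hχ h n).2 h1
  -- a maximal `h` in a linear relation is isolated by `powProd X h`
  have hli : LinearIndependent ℂ w := by
    rw [Fintype.linearIndependent_iff]
    intro g hg
    by_contra! hne
    obtain ⟨h₁, hh₁⟩ := hne
    obtain ⟨h, hh, hmax⟩ := Finset.exists_max_image (Finset.univ.filter fun h => g h ≠ 0) downs
      ⟨h₁, by simpa using hh₁⟩
    have hgh : g h ≠ 0 := (Finset.mem_filter.1 hh).2
    have e := congrArg (· ᵥ* powProd X h) hg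
    simp only [sum_vecMul, smul_vecMul, hpow, zero_vecMul] at e
    rw [Finset.sum_eq_single h] at e
    · rw [smul_smul] at e
      exact (smul_ne_zero (mul_ne_zero hgh (hcd h)) (hw h)) e
    · intro k _ hk
      by_cases hgk : g k = 0
      · rw [hgk, zero_smul]
      · by_cases hck : c k h = 0
        · rw [hck, zero_smul, smul_zero]
        · obtain ⟨h1, h2⟩ := hc0 k h hck
          exact absurd (h2 (le_antisymm h1 (hmax k (by simpa using hgk)))).symm hk
    · simp
  refine ⟨hli, ?_⟩
  rw [← linearIndependent_sovMat_iff, Fintype.linearIndependent_iff]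
  intro g hg
  simp only [sum_vecMul, hpow, Finset.smul_sum, smul_smul] at hg
  rw [Finset.sum_comm] at hg
  simp only [← Finset.sum_smul] at hg
  have hg' := Fintype.linearIndependent_iff.1 hli _ hg
  by_contra! hne
  obtain ⟨h₁, hh₁⟩ := hne
  obtain ⟨h, hh, hmin⟩ := Finset.exists_min_image (Finset.univ.filter fun h => g h ≠ 0) downs
    ⟨h₁, by simpa using hh₁⟩
  have hgh : g h ≠ 0 := (Finset.mem_filter.1 hh).2
  have e := hg' h
  rw [Finset.sum_eq_single h] at e
  · exact (mul_ne_zero hgh (hcd h)) e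
  · intro k _ hk
    by_cases hgk : g k = 0
    · rw [hgk, zero_mul]
    · by_cases hck : c h k = 0
      · rw [hck, mul_zero]
      · obtain ⟨h1, h2⟩ := hc0 h k hck
        exact absurd (h2 (le_antisymm h1 (hmin k (by simpa using hgk)))) hk
  · simp

end SovMat

/-! ### Left eigenvectors of `D(z)` -/

section LeftEigen

variable {N : ℕ} {η : ℂ} {ξ : Fin N → ℂ}

lemma mono_one_one_continuous (η : ℂ) (ξ : Fin N → ℂ) (s s' : Spins N) :
    Continuous fun z => mono η ξ z N 1 1 s s' := by
  obtain ⟨P, -, -, -, h⟩ := mono_one_one_mTrig η ξ s s'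
  simp only [h]
  fun_prop

/-- Left eigenvectors of `D(z)`, obtained from `⟨⇑|` by the operators `C(ξₙ)`, `n ∈ l`. -/
def leftVec (η : ℂ) (ξ : Fin N → ℂ) (l : List (Fin N)) : Space N :=
  Pi.single (allUp N) 1 ᵥ* (l.map fun n => mono η ξ (ξ n) N 1 0).prod

lemma leftVec_append (η : ℂ) (ξ : Fin N → ℂ) (l : List (Fin N)) (n : Fin N) :
    leftVec η ξ (l ++ [n]) = leftVec η ξ l ᵥ* mono η ξ (ξ n) N 1 0 := by
  rw [leftVec, leftVec, vecMul_vecMul, List.map_append, List.prod_append]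
  simp

lemma dense_sinh_ne (c : ℂ) : Dense {z : ℂ | sinh (z - c) ≠ 0} := by
  have h : {z : ℂ | sinh (z - c) = 0}.Countable := by
    refine (Set.countable_range fun m : ℤ => c + I * m * Real.pi).mono fun z hz => ?_
    obtain ⟨m, hm⟩ := (sinh_eq_zero_iff' _).1 hz
    exact ⟨m, by simp only; rw [← hm]; ring⟩
  exact h.dense_compl ℝ

/-- By the exchange relation of `D` and `C` at `z` and `ξₙ` the operator `C(ξₙ)` multiplies the
eigenvalue of `D(z)` by `sinh (z - ξₙ + η) / sinh (z - ξₙ)`, since `D(ξₙ)` annihilates the vector. The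
annihilation by `B(ξₙ)` carries the induction in `leftVec_transfer`. -/
lemma leftVec_props (hξ : InhomogeneityCondition η ξ) (l : List (Fin N)) (hl : l.Nodup) :
    (∀ z, leftVec η ξ l ᵥ* mono η ξ z N 1 1 =
        (∏ b, sinh (z - ξ b + if b ∈ l then η else 0)) • leftVec η ξ l) ∧
      (∀ n, n ∉ l → leftVec η ξ l ᵥ* mono η ξ (ξ n) N 0 1 = 0) ∧
      (∀ s, leftVec η ξ l s ≠ 0 → downs s = l.length) := by
  induction l using List.reverseRecOn with
  | nil =>
    have h0 : leftVec η ξ [] = Pi.single (allUp N) 1 := by simp [leftVec]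
    rw [h0]
    refine ⟨fun z => ?_, fun n _ => ?_, fun s hs => ?_⟩
    · rw [single_one_vecMul]
      funext s
      simp only [List.not_mem_nil, if_false, add_zero, Pi.smul_apply, smul_eq_mul, row_apply]
      by_cases hs : s = allUp N
      · subst hs
        rw [(mono_allUp η ξ z).2, Pi.single_eq_same, mul_one]; rfl
      · rw [Pi.single_eq_of_ne hs, mul_zero]
        by_contra hne
        have h1 := mono_diag_conserve η ξ z 1 _ _ hne
        exact hs (downs_eq_zero (h1.symm.trans downs_allUp))
    · rw [single_one_vecMul]
      funext s
      simp only [row_apply, Pi.zero_apply]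
      by_contra hne
      have h1 := mono_conserve η ξ (ξ n) N le_rfl hne
      rw [downs_allUp] at h1
      simp at h1
      omega
    · have : s = allUp N := by
        by_contra h; exact hs (Pi.single_eq_of_ne h _)
      rw [this, downs_allUp]; rfl
  | append_singleton l n ih =>
    obtain ⟨hl1, hl2⟩ : l.Nodup ∧ n ∉ l := by
      rw [List.nodup_append] at hl
      exact ⟨hl.1, fun h => hl.2.2 n h n (by simp) rfl⟩
    obtain ⟨ihD, ihB, ihS⟩ := ih hl1
    set v := leftVec η ξ l with hv
    have hD0 : ∀ m, m ∉ l → v ᵥ* mono η ξ (ξ m) N 1 1 = 0 := by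
      intro m hm
      rw [ihD, Finset.prod_eq_zero (Finset.mem_univ m) (by simp [hm]), zero_smul]
    rw [leftVec_append, ← hv]
    refine ⟨fun z => ?_, fun m hm => ?_, fun s hs => ?_⟩
    · funext s
      revert z
      refine congrFun (Continuous.ext_on (dense_sinh_ne (ξ n)) ?_ ?_ fun z hz => ?_)
      -- the exchange relation can be divided by `sinh (z - ξₙ)` on a dense set
      · simp only [vecMul, dotProduct]
        refine continuous_finsetSum _ fun s' _ => continuous_const.mul
          (mono_one_one_continuous η ξ s' s)
      · simp only [Pi.smul_apply, smul_eq_mul]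
        refine Continuous.mul (continuous_finsetProd _ fun b _ => ?_) continuous_const
        exact Complex.continuous_sinh.comp (by fun_prop)
      · have h := congrArg (v ᵥ* ·) (exchange_D_C η ξ z (ξ n))
        simp only [vecMul_smul, vecMul_add, ← vecMul_vecMul] at h
        rw [hD0 n hl2, zero_vecMul, smul_zero, zero_add, ihD z, smul_vecMul] at h
        have hs := congrFun h s
        simp only [Pi.smul_apply, smul_eq_mul] at hs
        refine mul_left_cancel₀ hz ?_
        rw [← hs, Pi.smul_apply, smul_eq_mul, ← Finset.mul_prod_erase _ _ (Finset.mem_univ n),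
          ← Finset.mul_prod_erase Finset.univ (fun b => sinh (z - ξ b + if b ∈ l ++ [n] then η else 0))
            (Finset.mem_univ n)]
        have he : ∏ b ∈ Finset.univ.erase n, sinh (z - ξ b + if b ∈ l ++ [n] then η else 0) =
            ∏ b ∈ Finset.univ.erase n, sinh (z - ξ b + if b ∈ l then η else 0) := by
          refine Finset.prod_congr rfl fun b hb => ?_
          simp [Finset.ne_of_mem_erase hb]
        rw [he, if_neg hl2, if_pos (by simp), add_zero]
        ring
    · simp only [List.mem_append, List.mem_singleton, not_or] at hm
      have h := congrArg (v ᵥ* ·) (exchange_B_C η ξ (ξ m) (ξ n))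
      simp only [vecMul_smul, vecMul_add, ← vecMul_vecMul] at h
      rw [hD0 n hl2, hD0 m hm.1, ihB m hm.1] at h
      simp only [zero_vecMul, smul_zero, zero_add] at h
      exact (smul_eq_zero.1 h.symm).resolve_left (hξ.sinh_sub hm.2)
    · rw [vecMul, dotProduct] at hs
      obtain ⟨s', _, hs'⟩ := Finset.exists_ne_zero_of_sum_ne_zero hs
      have h1 := ihS s' (left_ne_zero_of_mul hs')
      have h2 := mono_conserve η ξ (ξ n) N le_rfl (right_ne_zero_of_mul hs')
      rw [List.length_append, List.length_singleton, ← h1]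
      simp at h2
      omega

lemma leftVec_transfer (hξ : InhomogeneityCondition η ξ) (α : ℂ) (l : List (Fin N))
    (hl : l.Nodup) :
    Pi.single (allUp N) 1 ᵥ* (l.map fun n => transfer η ξ 1 α (ξ n)).prod =
      exp α ^ l.length • leftVec η ξ l := by
  induction l using List.reverseRecOn with
  | nil => simp [leftVec]
  | append_singleton l n ih =>
    obtain ⟨hl1, hl2⟩ : l.Nodup ∧ n ∉ l := by
      rw [List.nodup_append] at hl
      exact ⟨hl.1, fun h => hl.2.2 n h n (by simp) rfl⟩
    rw [List.map_append, List.prod_append, ← vecMul_vecMul, ih hl1, leftVec_append]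
    simp only [List.map_cons, List.map_nil, List.prod_cons, List.prod_nil, mul_one]
    rw [smul_vecMul, transfer_one, vecMul_add, vecMul_smul, vecMul_smul,
      (leftVec_props hξ l hl1).2.1 n hl2, smul_zero, add_zero, smul_smul, List.length_append,
      List.length_singleton, pow_succ]

/-- The covectors do not vanish since the transfer matrices `T(ξₙ)` with antidiagonal twist are
invertible. -/
lemma leftVec_ne_zero (hη : ∀ m : ℤ, η ≠ I * m * Real.pi) (hξ : InhomogeneityCondition η ξ)
    (l : List (Fin N)) (hl : l.Nodup) : leftVec η ξ l ≠ 0 := by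
  intro h
  have h1 := leftVec_transfer hξ 0 l hl
  rw [h, smul_zero] at h1
  clear h hl
  induction l using List.reverseRecOn with
  | nil => simpa using congrFun h1 (allUp N)
  | append_singleton l n ih =>
    refine ih ?_
    rw [List.map_append, List.prod_append, ← vecMul_vecMul] at h1
    simp only [List.map_cons, List.map_nil, List.prod_cons, List.prod_nil, mul_one] at h1
    have h2 := congrArg (· ᵥ* transfer η ξ 1 0 (ξ n - η)) h1
    simp only [vecMul_vecMul, zero_vecMul, mul_assoc, transfer_one_fusion] at h2
    rw [← vecMul_vecMul, vecMul_smul, vecMul_one, twist_one_det] at h2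
    exact (smul_eq_zero.1 h2).resolve_left (mul_ne_zero (aFun_ne hη hξ n)
      (mul_ne_zero (dFun_ne hη hξ n) (neg_ne_zero.2 one_ne_zero)))

/-- The positions of the down spins. -/
def downList (h : Spins N) : List (Fin N) := (List.finRange N).filter fun n => h n = 1

lemma mem_downList {h : Spins N} {n : Fin N} : n ∈ downList h ↔ h n = 1 := by
  simp [downList]

lemma downList_nodup (h : Spins N) : (downList h).Nodup := (List.nodup_finRange N).filter _

lemma powProd_eq_downList (X : Fin N → Matrix (Spins N) (Spins N) ℂ) (h : Spins N) :
    powProd X h = ((downList h).map X).prod := by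
  rw [powProd, downList]
  induction List.finRange N with
  | nil => simp
  | cons n l ih =>
    rcases Fin.exists_fin_two.1 ⟨h n, rfl⟩ with h1 | h1 <;> simp [h1, ih]

lemma leftVec_vecMul_node (hη : ∀ m : ℤ, η ≠ I * m * Real.pi) (hξ : InhomogeneityCondition η ξ)
    (f : ℕ → ℂ) (hf : ∀ m, f m ≠ 0) :
    ∃ χ : Spins N → Fin N → ℂ, (∀ h n, leftVec η ξ (downList h) ᵥ*
        (mono η ξ (ξ n) N 1 1 * diagonal fun s => f (downs s)) =
          χ h n • leftVec η ξ (downList h)) ∧ ∀ h n, χ h n ≠ 0 ↔ h n = 1 := by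
  refine ⟨fun h n => f (downList h).length * ∏ b, sinh (ξ n - ξ b + if b ∈ downList h then η else 0),
    fun h n => ?_, fun h n => ?_⟩
  · obtain ⟨h1, -, h3⟩ := leftVec_props hξ (downList h) (downList_nodup h)
    rw [← vecMul_vecMul, h1, smul_vecMul]
    simp only
    rw [mul_comm, ← smul_smul]
    congr 1
    funext s
    rw [vecMul_diagonal, Pi.smul_apply, smul_eq_mul, mul_comm]
    by_cases hs : leftVec η ξ (downList h) s = 0
    · rw [hs, mul_zero, mul_zero]
    · rw [h3 s hs]
  · rw [mul_ne_zero_iff, Finset.prod_ne_zero_iff]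
    constructor
    · rintro ⟨-, h1⟩
      by_contra h2
      have := h1 n (Finset.mem_univ n)
      rw [mem_downList.not.2 h2 |> if_neg] at this
      simp at this
    · intro h1
      refine ⟨hf _, fun b _ => ?_⟩
      by_cases hb : n = b
      · subst hb
        rw [if_pos (mem_downList.2 h1), sub_self, zero_add]
        exact sinh_eta_ne hη
      · split_ifs
        · exact hξ.sinh_sub_add hb
        · rw [add_zero]; exact hξ.sinh_sub hb

/-- For the antidiagonal twist `⟨⇑|` is admissible: it generates left eigenvectors of `D(z)`. -/
lemma det_sovMat_one_ne_zero (hη : ∀ m : ℤ, η ≠ I * m * Real.pi)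
    (hξ : InhomogeneityCondition η ξ) (α : ℂ) :
    (sovMat (Pi.single (allUp N) 1) fun n => transfer η ξ 1 α (ξ n)).det ≠ 0 := by
  rw [← linearIndependent_sovMat_iff]
  obtain ⟨χ, h1, h2⟩ := leftVec_vecMul_node hη hξ (fun _ => 1) fun _ => one_ne_zero
  have hli := (linearIndependent_of_eigen
    (fun h => leftVec_ne_zero hη hξ _ (downList_nodup h)) h1 h2).1
  have h3 := hli.units_smul fun h => Units.mk0 (exp α ^ (downList h).length)
    (pow_ne_zero _ (Complex.exp_ne_zero _))
  convert h3 using 1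
  funext h
  rw [powProd_eq_downList, leftVec_transfer hξ α _ (downList_nodup h)]
  rfl

/-- The operators `κ A(z) f + D(z) g` with functions `f` and `g` of the number of down spins. -/
def pencil (η : ℂ) (ξ : Fin N → ℂ) (f g : ℕ → ℂ) (κ z : ℂ) :
    Matrix (Spins N) (Spins N) ℂ :=
  κ • (mono η ξ z N 0 0 * diagonal fun s => f (downs s)) +
    mono η ξ z N 1 1 * diagonal fun s => g (downs s)

/-- At `κ = 0` the sum of the left eigenvectors of `D(z)` generates a basis, hence so it does for
almost all `κ`. -/
lemma exists_polynomial_pencil (hη : ∀ m : ℤ, η ≠ I * m * Real.pi)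
    (hξ : InhomogeneityCondition η ξ) (f g : ℕ → ℂ) (hg : ∀ m, g m ≠ 0) :
    ∃ S : Space N, ∃ Q : Polynomial ℂ, Q ≠ 0 ∧
      ∀ κ, Q.eval κ = (sovMat S fun n => pencil η ξ f g κ (ξ n)).det := by
  obtain ⟨χ, h1, h2⟩ := leftVec_vecMul_node hη hξ g hg
  have hdet := (linearIndependent_of_eigen
    (fun h => leftVec_ne_zero hη hξ _ (downList_nodup h)) h1 h2).2
  obtain ⟨Q, hQ⟩ := exists_polynomial_det (∑ h, leftVec η ξ (downList h))
    (fun n => mono η ξ (ξ n) N 0 0 * diagonal fun s => f (downs s))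
    (fun n => mono η ξ (ξ n) N 1 1 * diagonal fun s => g (downs s))
  refine ⟨_, Q, fun h => hdet ?_, hQ⟩
  have := hQ 0
  simpa [h] using this.symm

lemma ae_isSovBasis_one (hη : ∀ m : ℤ, η ≠ I * m * Real.pi) (hξ : InhomogeneityCondition η ξ)
    (α : ℂ) : ∀ᵐ S : Space N ∂MeasureTheory.volume, IsSovBasis η ξ 1 α S := by
  simp only [isSovBasis_iff hη hξ]
  exact ae_det_sovMat_ne_zero _ (det_sovMat_one_ne_zero hη hξ α)

lemma transfer_zero_eq_pencil (η : ℂ) (ξ : Fin N → ℂ) (α z : ℂ) :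
    transfer η ξ 0 α z = exp (-α) • pencil η ξ (fun _ => 1) (fun _ => 1) (exp (2 * α)) z := by
  rw [transfer_zero, pencil]
  simp only [diagonal_one, mul_one, smul_add, smul_smul, ← Complex.exp_add]
  ring_nf

lemma ae_isSovBasis_zero (hη : ∀ m : ℤ, η ≠ I * m * Real.pi) (hξ : InhomogeneityCondition η ξ) :
    ∃ F : Finset ℂ, ∀ α : ℂ, exp (2 * α) ∉ F →
      ∀ᵐ S : Space N ∂MeasureTheory.volume, IsSovBasis η ξ 0 α S := by
  obtain ⟨S, Q, hQ, hdet⟩ := exists_polynomial_pencil hη hξ (fun _ => 1) (fun _ => 1)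
    fun _ => one_ne_zero
  refine ⟨Q.roots.toFinset, fun α hα => ?_⟩
  simp only [isSovBasis_iff hη hξ, transfer_zero_eq_pencil]
  refine ae_det_sovMat_ne_zero _ (S₀ := S) ?_
  rw [det_sovMat_smul_ne_zero fun _ => Complex.exp_ne_zero _, ← hdet]
  simpa [hQ] using hα

end LeftEigen

/-! ### Common eigenvectors of commuting operators -/

/-- Commuting endomorphisms have a common eigenvector in every nonzero invariant subspace. -/
lemma exists_common_eigenvector {V ι : Type*} [AddCommGroup V] [Module ℂ V] [FiniteDimensional ℂ V]
    [Finite ι] (f : ι → Module.End ℂ V) (hf : ∀ i j, Commute (f i) (f j)) (W : Submodule ℂ V)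
    (hW : W ≠ ⊥) (hfW : ∀ i, ∀ x ∈ W, f i x ∈ W) :
    ∃ φ ∈ W, φ ≠ 0 ∧ ∃ χ : ι → ℂ, ∀ i, f i φ = χ i • φ := by
  classical
  have := Fintype.ofFinite ι
  have key : ∀ s : Finset ι, ∃ W' : Submodule ℂ V, W' ≤ W ∧ W' ≠ ⊥ ∧ (∀ i, ∀ x ∈ W', f i x ∈ W') ∧
      ∀ i ∈ s, ∃ μ : ℂ, ∀ x ∈ W', f i x = μ • x := by
    intro s
    induction s using Finset.induction_on with
    | empty => exact ⟨W, le_rfl, hW, hfW, by simp⟩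
    | insert i s hi ih =>
      obtain ⟨W', h1, h2, h3, h4⟩ := ih
      have : Nontrivial W' := Submodule.nontrivial_iff_ne_bot.2 h2
      obtain ⟨μ, hμ⟩ := Module.End.exists_eigenvalue ((f i).restrict (h3 i))
      obtain ⟨x, hx⟩ := hμ.exists_hasEigenvector
      have hfx : f i x = μ • (x : V) := congrArg Subtype.val hx.apply_eq_smul
      refine ⟨W' ⊓ Module.End.eigenspace (f i) μ, inf_le_left.trans h1, ?_, ?_, ?_⟩
      · refine (Submodule.ne_bot_iff _).2 ⟨x, ⟨x.2, Module.End.mem_eigenspace_iff.2 hfx⟩, ?_⟩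
        exact fun h => hx.2 (Subtype.ext h)
      · rintro j y ⟨hy1, hy2⟩
        refine ⟨h3 j y hy1, Module.End.mem_eigenspace_iff.2 ?_⟩
        rw [← Module.End.mul_apply, (hf i j).eq, Module.End.mul_apply,
          Module.End.mem_eigenspace_iff.1 hy2, map_smul]
      · intro j hj
        rcases Finset.mem_insert.1 hj with rfl | hj
        · exact ⟨μ, fun y hy => Module.End.mem_eigenspace_iff.1 hy.2⟩
        · obtain ⟨ν, hν⟩ := h4 j hj
          exact ⟨ν, fun y hy => hν y hy.1⟩
  obtain ⟨W', h1, h2, -, h4⟩ := key Finset.univ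
  obtain ⟨φ, hφ, hφ0⟩ := (Submodule.ne_bot_iff _).1 h2
  choose χ hχ using fun i => h4 i (Finset.mem_univ i)
  exact ⟨φ, h1 hφ, hφ0, χ, fun i => hχ i φ hφ⟩

/-- If all linear combinations of finitely many commuting matrices are singular, then the matrices
have a common null vector: otherwise a linear combination avoids the finitely many joint
eigenvalues. -/
lemma exists_common_kernel {n ι : Type*} [Fintype n] [DecidableEq n] [Fintype ι]
    (Y : ι → Matrix n n ℂ) (hY : ∀ i j, Commute (Y i) (Y j))
    (hdet : ∀ c : ι → ℂ, (∑ i, c i • Y i).det = 0) :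
    ∃ φ : n → ℂ, φ ≠ 0 ∧ ∀ i, Y i *ᵥ φ = 0 := by
  classical
  set f : ι → Module.End ℂ (n → ℂ) := fun i => Matrix.toLin' (Y i) with hf
  have hfc : ∀ i j, Commute (f i) (f j) := fun i j => by
    rw [Commute, SemiconjBy, hf]
    simp only [Module.End.mul_eq_comp, ← Matrix.toLin'_mul, (hY i j).eq]
  have hfin : {χ : ι → ℂ | ∃ φ : n → ℂ, φ ≠ 0 ∧ ∀ i, f i φ = χ i • φ}.Finite := by
    refine (Set.Finite.pi' fun i => Module.End.finite_hasEigenvalue (f i)).subset ?_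
    rintro χ ⟨φ, hφ, h⟩ i
    exact Module.End.hasEigenvalue_of_hasEigenvector
      (Module.End.hasEigenvector_iff.2 ⟨Module.End.mem_eigenspace_iff.2 (h i), hφ⟩)
  have := hfin.to_subtype
  -- every `c` lies in one of the finitely many subspaces `∑ᵢ cᵢ χᵢ = 0`, so one of them is everything
  set p : {χ : ι → ℂ | ∃ φ : n → ℂ, φ ≠ 0 ∧ ∀ i, f i φ = χ i • φ} → Submodule ℂ (ι → ℂ) :=
    fun χ => LinearMap.ker (Fintype.linearCombination ℂ χ.1) with hp
  have hcov : ⋃ χ, (p χ : Set (ι → ℂ)) = Set.univ := by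
    refine Set.eq_univ_of_forall fun c => ?_
    obtain ⟨x, hx0, hx⟩ := Matrix.exists_mulVec_eq_zero_iff.2 (hdet c)
    have happ : ∀ y, (∑ i, c i • Y i) *ᵥ y = ∑ i, c i • f i y := fun y => by
      rw [Matrix.sum_mulVec]
      simp only [smul_mulVec, hf, Matrix.toLin'_apply]
    obtain ⟨φ, hφW, hφ, χ, hχ⟩ := exists_common_eigenvector f hfc
      (LinearMap.ker (Matrix.toLin' (∑ i, c i • Y i)))
      ((Submodule.ne_bot_iff _).2 ⟨x, by
        rw [LinearMap.mem_ker, Matrix.toLin'_apply]; exact hx, hx0⟩) (fun i y hy => by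
        rw [LinearMap.mem_ker, Matrix.toLin'_apply, happ] at hy ⊢
        have h := congrArg (f i) hy
        rw [map_zero, map_sum] at h
        rw [← h]
        refine Finset.sum_congr rfl fun j _ => ?_
        rw [map_smul, ← Module.End.mul_apply, ← Module.End.mul_apply, (hfc i j).eq])
    refine Set.mem_iUnion.2 ⟨⟨χ, φ, hφ, hχ⟩, ?_⟩
    rw [LinearMap.mem_ker, Matrix.toLin'_apply, happ] at hφW
    simp only [hχ, smul_smul, ← Finset.sum_smul] at hφW
    rw [SetLike.mem_coe, hp, LinearMap.mem_ker, Fintype.linearCombination_apply]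
    simpa using (smul_eq_zero.1 hφW).resolve_right hφ
  obtain ⟨⟨χ, φ, hφ, hχ⟩, htop⟩ := Subspace.exists_eq_top_of_iUnion_eq_univ hcov
  refine ⟨φ, hφ, fun i => ?_⟩
  have hi : Pi.single i 1 ∈ p ⟨χ, φ, hφ, hχ⟩ := by rw [htop]; trivial
  rw [hp, LinearMap.mem_ker, Fintype.linearCombination_apply_single] at hi
  have h := hχ i
  rw [show χ i = 0 by simpa using hi, zero_smul] at h
  simpa [hf] using h

/-! ### The transfer matrix in the basis of separate variables -/

section Shift

variable {N : ℕ}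

lemma powProd_mul_of_commute {X : Fin N → Matrix (Spins N) (Spins N) ℂ}
    (hX : ∀ n m, Commute (X n) (X m)) {h : Spins N} {b : Fin N} (hb : h b = 0) :
    powProd X h * X b = powProd X (Function.update h b 1) := by
  rw [powProd_eq_downList, powProd_eq_downList]
  have hperm : (downList h ++ [b]).Perm (downList (Function.update h b 1)) := by
    rw [List.perm_ext_iff_of_nodup _ (downList_nodup _)]
    · intro n
      rw [List.mem_append, List.mem_singleton, mem_downList, mem_downList]
      by_cases hn : n = b
      · subst hn; simp
      · simp [hn]
    · rw [List.nodup_append]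
      refine ⟨downList_nodup h, by simp, fun n hn m hm hnm => ?_⟩
      rw [List.mem_singleton] at hm
      rw [mem_downList, hnm, hm, hb] at hn
      simp at hn
  have h2 := (hperm.map X).prod_eq' (List.pairwise_of_forall_mem_list fun x hx y hy => by
    obtain ⟨n, -, rfl⟩ := List.mem_map.1 hx
    obtain ⟨m, -, rfl⟩ := List.mem_map.1 hy
    exact hX n m)
  rw [← h2]
  simp

/-- The shifted inhomogeneities `ξ_b - h_b η`. -/
def node (η : ℂ) (ξ : Fin N → ℂ) (h : Spins N) (b : Fin N) : ℂ := ξ b - ((h b : ℕ) : ℂ) * η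

lemma node_injective {η : ℂ} {ξ : Fin N → ℂ} (hξ : InhomogeneityCondition η ξ) (h : Spins N) :
    Function.Injective fun b => exp (2 * node η ξ h b) := by
  intro i j hij
  by_contra hne
  obtain ⟨m, hm⟩ := (exp_two_mul_eq_iff _ _).1 hij
  refine hξ i j hne (((h i : ℕ) : ℤ) - ((h j : ℕ) : ℤ)) (by omega) m ?_
  simp only [node] at hm
  push_cast
  linear_combination hm

/-- The action of `F(z)` on the covectors `⟨S| ∏ₙ F(ξₙ)^{hₙ}`, by interpolation at the nodes
`ξ_b - h_b η`; the scalar `τ` is the leading coefficient of `F`, and `F(ξ_b) F(ξ_b - η) = q_b`. -/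
def shiftMat (η : ℂ) (ξ : Fin N → ℂ) (e τ : ℂ) (q : Fin N → ℂ) (z : ℂ) :
    Matrix (Spins N) (Spins N) ℂ :=
  Matrix.of fun h h' => τ * nodal e (node η ξ h) z * (if h = h' then 1 else 0) +
    ∑ b, lagr e (node η ξ h) b z *
      if h b = 0 then (if Function.update h b 1 = h' then 1 else 0)
      else q b * (if Function.update h b 0 = h' then 1 else 0)

lemma shiftMat_mulVec (η : ℂ) (ξ : Fin N → ℂ) (e τ : ℂ) (q : Fin N → ℂ) (z : ℂ) (v : Space N)
    (h : Spins N) : (shiftMat η ξ e τ q z *ᵥ v) h = τ * nodal e (node η ξ h) z * v h +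
      ∑ b, lagr e (node η ξ h) b z *
        if h b = 0 then v (Function.update h b 1) else q b * v (Function.update h b 0) := by
  simp only [shiftMat, mulVec, dotProduct, of_apply, add_mul, Finset.sum_add_distrib,
    Finset.sum_mul]
  rw [Finset.sum_comm]
  congr 1
  · simp [mul_assoc]
  · refine Finset.sum_congr rfl fun b _ => ?_
    split_ifs <;> simp [mul_assoc]

variable {η : ℂ} {ξ : Fin N → ℂ} {e τ : ℂ} {q : Fin N → ℂ}
  {F : ℂ → Matrix (Spins N) (Spins N) ℂ} {B : Matrix (Spins N) (Spins N) ℂ}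

lemma MTrig.interpolation (hξ : InhomogeneityCondition η ξ) (hF : MTrig e N (τ • 1) B F)
    (h : Spins N) (z : ℂ) : F z = (τ * nodal e (node η ξ h) z) • (1 : Matrix (Spins N) (Spins N) ℂ) +
      ∑ b, lagr e (node η ξ h) b z • F (node η ξ h b) := by
  ext s s'
  rw [((hF s s').interpolation (node_injective hξ h)).1 z]
  simp only [Matrix.add_apply, Matrix.smul_apply, Matrix.sum_apply, smul_eq_mul]
  ring

lemma sovMat_mul_eq (hξ : InhomogeneityCondition η ξ) (hF : MTrig e N (τ • 1) B F)
    (hcomm : ∀ n m, Commute (F (ξ n)) (F (ξ m)))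
    (hfus : ∀ n, F (ξ n) * F (ξ n - η) = q n • 1) (S : Space N) (z : ℂ) :
    sovMat S (fun n => F (ξ n)) * F z =
      shiftMat η ξ e τ q z * sovMat S (fun n => F (ξ n)) := by
  ext h s
  have h1 : (shiftMat η ξ e τ q z * sovMat S (fun n => F (ξ n))) h s =
      (shiftMat η ξ e τ q z *ᵥ fun h => sovMat S (fun n => F (ξ n)) h s) h := rfl
  have h2 : (sovMat S (fun n => F (ξ n)) * F z) h s =
      (S ᵥ* (powProd (fun n => F (ξ n)) h * F z)) s := by
    rw [← vecMul_vecMul]; rfl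
  rw [h1, h2, shiftMat_mulVec, MTrig.interpolation hξ hF h z, mul_add, vecMul_add, mul_smul_comm,
    mul_one, vecMul_smul, Finset.mul_sum, Pi.add_apply, Pi.smul_apply, smul_eq_mul]
  congr 1
  have h3 : S ᵥ* (∑ b, powProd (fun n => F (ξ n)) h * lagr e (node η ξ h) b z • F (node η ξ h b)) =
      ∑ b, lagr e (node η ξ h) b z • (S ᵥ* (powProd (fun n => F (ξ n)) h * F (node η ξ h b))) := by
    rw [vecMul_sum]
    simp only [mul_smul_comm, vecMul_smul]
  rw [h3, Finset.sum_apply]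
  refine Finset.sum_congr rfl fun b _ => ?_
  rw [Pi.smul_apply, smul_eq_mul]
  congr 1
  split_ifs with hb
  · have : node η ξ h b = ξ b := by simp [node, hb]
    rw [this, powProd_mul_of_commute hcomm hb]
    rfl
  · have hb1 : h b = 1 := by omega
    have : node η ξ h b = ξ b - η := by simp [node, hb1]
    have hu : Function.update (Function.update h b 0) b 1 = h := by
      rw [Function.update_idem, ← hb1, Function.update_eq_self]
    have hp := powProd_mul_of_commute hcomm (h := Function.update h b 0) (b := b) (by simp)
    rw [hu] at hp
    rw [this, ← hp, mul_assoc, hfus, mul_smul_comm, mul_one, vecMul_smul]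
    rfl

/-- The vector `∏ₙ xₙ^{hₙ}` of the values of a separated wave function. -/
def sepVec (x : Fin N → ℂ) : Space N := fun h => ∏ n, x n ^ ((h n : Fin 2) : ℕ)

lemma sepVec_update (x : Fin N → ℂ) (h : Spins N) (b : Fin N) (hb : h b = 0) :
    sepVec x (Function.update h b 1) = x b * sepVec x h := by
  rw [sepVec, sepVec, ← Finset.mul_prod_erase _ _ (Finset.mem_univ b),
    ← Finset.mul_prod_erase Finset.univ (fun n => x n ^ ((h n : Fin 2) : ℕ)) (Finset.mem_univ b),
    hb, Function.update_self]
  simp only [Fin.val_one, pow_one, Fin.val_zero, pow_zero, one_mul]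
  congr 1
  exact Finset.prod_congr rfl fun n hn => by rw [Function.update_of_ne (Finset.ne_of_mem_erase hn)]

lemma sepVec_ne_zero (x : Fin N → ℂ) : sepVec x ≠ 0 := fun h => by
  have := congrFun h (allUp N)
  simp [sepVec, allUp] at this

lemma shiftMat_mulVec_sepVec (hξ : InhomogeneityCondition η ξ) {t : ℂ → ℂ} {b : ℂ}
    (ht : IsTrig e N τ b t) (hfus : ∀ n, t (ξ n) * t (ξ n - η) = q n) (z : ℂ) :
    shiftMat η ξ e τ q z *ᵥ sepVec (fun n => t (ξ n)) = t z • sepVec (fun n => t (ξ n)) := by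
  funext h
  rw [shiftMat_mulVec, Pi.smul_apply, smul_eq_mul,
    (ht.interpolation (node_injective hξ h)).1 z, add_mul, Finset.sum_mul]
  congr 1
  refine Finset.sum_congr rfl fun b _ => ?_
  rw [mul_assoc]
  congr 1
  split_ifs with hb
  · rw [sepVec_update _ _ _ hb]
    simp [node, hb]
  · have hb1 : h b = 1 := by omega
    have : node η ξ h b = ξ b - η := by simp [node, hb1]
    have hu : Function.update (Function.update h b 0) b 1 = h := by
      rw [Function.update_idem, ← hb1, Function.update_eq_self]
    have hp := sepVec_update (fun n => t (ξ n)) (Function.update h b 0) b (by simp)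
    rw [hu] at hp
    rw [this, hp, ← hfus]
    ring

/-- In a basis of separate variables every solution of the fusion equations gives an
eigenvector. -/
lemma exists_eigenvector_of_det_ne_zero (hξ : InhomogeneityCondition η ξ)
    (hF : MTrig e N (τ • 1) B F) (hcomm : ∀ n m, Commute (F (ξ n)) (F (ξ m)))
    (hfus : ∀ n, F (ξ n) * F (ξ n - η) = q n • 1) {S : Space N}
    (hS : (sovMat S fun n => F (ξ n)).det ≠ 0) {t : ℂ → ℂ} {b : ℂ}
    (ht : IsTrig e N τ b t) (htf : ∀ n, t (ξ n) * t (ξ n - η) = q n) :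
    ∃ φ : Space N, φ ≠ 0 ∧ ∀ z, F z *ᵥ φ = t z • φ := by
  set E := sovMat S fun n => F (ξ n) with hE
  have hu : IsUnit E.det := isUnit_iff_ne_zero.2 hS
  have hinj : Function.Injective E.mulVec := Matrix.mulVec_injective_iff_isUnit.2
    ((Matrix.isUnit_iff_isUnit_det E).2 hu)
  have hφ : E *ᵥ (E⁻¹ *ᵥ sepVec fun n => t (ξ n)) = sepVec fun n => t (ξ n) := by
    rw [mulVec_mulVec, Matrix.mul_nonsing_inv _ hu, one_mulVec]
  refine ⟨E⁻¹ *ᵥ sepVec (fun n => t (ξ n)), fun h => ?_, fun z => hinj ?_⟩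
  · rw [h, mulVec_zero] at hφ
    exact sepVec_ne_zero _ hφ.symm
  · rw [mulVec_mulVec, sovMat_mul_eq hξ hF hcomm hfus S z, ← mulVec_mulVec, hφ, mulVec_smul, hφ,
      shiftMat_mulVec_sepVec hξ ht htf z]

end Shift

/-! ### The pencil with scalar asymptotics -/

section Pencil

variable {N : ℕ} {η : ℂ} {ξ : Fin N → ℂ}

/-- The operators `κ A(z) e^{η m} + D(z) e^{-η m}`, where `m` is the number of down spins. On each
sector this is a multiple of a transfer matrix, with a twist that depends on the sector in such a
way that the leading coefficient at `+∞` is the same scalar on all sectors. -/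
def dynTransfer (η : ℂ) (ξ : Fin N → ℂ) (κ z : ℂ) : Matrix (Spins N) (Spins N) ℂ :=
  pencil η ξ (fun m => exp (η * m)) (fun m => exp (-η * m)) κ z

lemma mul_diagonal_comm {X : Matrix (Spins N) (Spins N) ℂ}
    (hX : ∀ s s', X s s' ≠ 0 → downs s = downs s') (f : ℕ → ℂ) :
    Commute (diagonal fun s => f (downs s)) X := by
  ext s s'
  rw [diagonal_mul, mul_diagonal]
  by_cases h : X s s' = 0
  · rw [h, mul_zero, zero_mul]
  · rw [hX s s' h, mul_comm]

lemma mul_mul_mul_comm_of_commute {R : Type*} [Monoid R] {A U A' W : R} (h : Commute U A') :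
    A * U * (A' * W) = A * A' * (U * W) := by
  rw [mul_assoc, ← mul_assoc U, h.eq]
  simp only [mul_assoc]

/-- In the coefficient of `κ` the diagonal factors of `A` and `D` cancel, so commutation and fusion of
the transfer matrix carry over to the pencil. -/
lemma dynTransfer_mul (κ z w : ℂ) :
    dynTransfer η ξ κ z * dynTransfer η ξ κ w =
      (κ * κ) • (mono η ξ z N 0 0 * mono η ξ w N 0 0 *
        diagonal fun s => exp (η * downs s) * exp (η * downs s)) +
      κ • (mono η ξ z N 0 0 * mono η ξ w N 1 1 + mono η ξ z N 1 1 * mono η ξ w N 0 0) +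
      mono η ξ z N 1 1 * mono η ξ w N 1 1 *
        diagonal fun s => exp (-η * downs s) * exp (-η * downs s) := by
  have hU := fun i : Fin 2 => mul_diagonal_comm (mono_diag_conserve η ξ w i) fun m => exp (η * m)
  have hV := fun i : Fin 2 => mul_diagonal_comm (mono_diag_conserve η ξ w i) fun m => exp (-η * m)
  have hone : ∀ s : Spins N, exp (η * downs s) * exp (-η * downs s) = 1 := fun s => by
    rw [← Complex.exp_add]; simp
  have hone' : ∀ s : Spins N, exp (-η * downs s) * exp (η * downs s) = 1 := fun s => by
    rw [← Complex.exp_add]; simp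
  rw [dynTransfer, dynTransfer, pencil, pencil]
  simp only [add_mul, mul_add, smul_mul_assoc, mul_smul_comm]
  rw [mul_mul_mul_comm_of_commute (hU 0), mul_mul_mul_comm_of_commute (hU 1),
    mul_mul_mul_comm_of_commute (hV 0), mul_mul_mul_comm_of_commute (hV 1)]
  simp only [diagonal_mul_diagonal, hone, hone', diagonal_one, mul_one]
  module

lemma dynTransfer_commute (hξ : InhomogeneityCondition η ξ) (κ : ℂ) (n m : Fin N) :
    Commute (dynTransfer η ξ κ (ξ n)) (dynTransfer η ξ κ (ξ m)) := by
  by_cases h : n = m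
  · subst h; exact Commute.refl _
  rw [Commute, SemiconjBy, dynTransfer_mul, dynTransfer_mul, (mono_commute_node hξ n m 0 0).eq,
    (mono_commute_node hξ n m 1 1).eq,
    (exchange_trace η ξ _ _ (hξ.sinh_sub_add h) (hξ.sinh_sub_sub h)).1]

lemma dynTransfer_fusion (κ : ℂ) (n : Fin N) :
    dynTransfer η ξ κ (ξ n) * dynTransfer η ξ κ (ξ n - η) =
      (κ * (aFun η ξ (ξ n) * dFun ξ (ξ n - η))) • 1 := by
  rw [dynTransfer_mul, fusion_same, fusion_same, fusion_trace_diag, zero_mul, zero_mul, smul_zero,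
    zero_add, add_zero, smul_smul]

lemma pencil_mTrig (η : ℂ) (ξ : Fin N → ℂ) (f g : ℕ → ℂ) (κ : ℂ) :
    MTrig N N
      (diagonal fun s => topFactor ξ * (κ * (exp (η * (N - downs s)) * f (downs s)) +
        exp (η * downs s) * g (downs s)))
      (diagonal fun s => botFactor ξ * (κ * (exp (-η * (N - downs s)) * f (downs s)) +
        exp (-η * downs s) * g (downs s)))
      (pencil η ξ f g κ) := by
  have h1 := ((mono_zero_zero_mTrig η ξ).mul (mTrig_const (diagonal fun s => f (downs s)))).smul κ
  have h2 := (mono_one_one_mTrig η ξ).mul (mTrig_const (diagonal fun s => g (downs s)))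
  refine (h1.add h2).congr (add_zero _) (add_zero _) ?_ ?_ fun z => rfl
  · rw [diagonal_mul_diagonal, diagonal_mul_diagonal, ← diagonal_smul, diagonal_add]
    congr 1; funext s
    simp only [Pi.smul_apply, smul_eq_mul]; ring
  · rw [diagonal_mul_diagonal, diagonal_mul_diagonal, ← diagonal_smul, diagonal_add]
    congr 1; funext s
    simp only [Pi.smul_apply, smul_eq_mul]; ring

/-- The leading coefficient of `dynTransfer` at `+∞`. -/
def dynTop (η : ℂ) (ξ : Fin N → ℂ) (κ : ℂ) : ℂ :=
  topFactor ξ * (κ * exp (η * N) + 1)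

lemma dynTransfer_mTrig (η : ℂ) (ξ : Fin N → ℂ) (κ : ℂ) :
    MTrig N N (dynTop η ξ κ • 1)
      (diagonal fun s => botFactor ξ * (κ * (exp (-η * (N - downs s)) * exp (η * downs s)) +
        exp (-η * downs s) * exp (-η * downs s)))
      (dynTransfer η ξ κ) := by
  refine (pencil_mTrig η ξ (fun m => exp (η * m)) (fun m => exp (-η * m)) κ).congr rfl rfl ?_ rfl
    fun z => rfl
  rw [← diagonal_one, ← diagonal_smul]
  congr 1; funext s
  simp only [Pi.smul_apply, smul_eq_mul, dynTop, mul_one, ← Complex.exp_add]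
  rw [show η * (N - downs s : ℂ) + η * downs s = η * N by ring,
    show η * (downs s : ℂ) + -η * downs s = 0 by ring, Complex.exp_zero]

/-- Every solution of the fusion equations with the right leading coefficient is an eigenvalue of
`dynTransfer`. For almost all `κ` there is a basis of separate variables, in which `dynTransfer` is
given by `shiftMat`. So all linear combinations of the two families have the same characteristic
polynomials, first for almost all `κ` and by continuity for all `κ`. -/
lemma exists_eigenvector_dynTransfer (hη : ∀ m : ℤ, η ≠ I * m * Real.pi)
    (hξ : InhomogeneityCondition η ξ) {κ₀ b : ℂ} {t : ℂ → ℂ}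
    (ht : IsTrig N N (dynTop η ξ κ₀) b t)
    (htf : ∀ n, t (ξ n) * t (ξ n - η) = κ₀ * (aFun η ξ (ξ n) * dFun ξ (ξ n - η))) :
    ∃ φ : Space N, φ ≠ 0 ∧ ∀ z, dynTransfer η ξ κ₀ z *ᵥ φ = t z • φ := by
  set q : ℂ → Fin N → ℂ := fun κ n => κ * (aFun η ξ (ξ n) * dFun ξ (ξ n - η)) with hq
  obtain ⟨S, Q, hQ, hdet⟩ := exists_polynomial_pencil hη hξ (fun m => exp (η * m))
    (fun m => exp (-η * m)) fun _ => Complex.exp_ne_zero _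
  have hsing : ∀ c : Fin N → ℂ,
      (∑ n, c n • (dynTransfer η ξ κ₀ (ξ n) - t (ξ n) • 1)).det = 0 := by
    intro c
    set f₁ : ℂ → ℂ := fun κ => (∑ n, c n • (dynTransfer η ξ κ (ξ n) - t (ξ n) • 1)).det with hf₁
    set f₂ : ℂ → ℂ := fun κ =>
      (∑ n, c n • (shiftMat η ξ N (dynTop η ξ κ) (q κ) (ξ n) - t (ξ n) • 1)).det with hf₂
    have hc₁ : Continuous f₁ := by
      refine Continuous.matrix_det (continuous_finsetSum _ fun n _ => ?_)
      have h : Continuous fun κ => dynTransfer η ξ κ (ξ n) := by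
        unfold dynTransfer pencil
        exact (continuous_id.smul continuous_const).add continuous_const
      exact (h.sub continuous_const).const_smul (c n)
    have hc₂ : Continuous f₂ := by
      refine Continuous.matrix_det (continuous_finsetSum _ fun n _ => ?_)
      have h : Continuous fun κ => shiftMat η ξ N (dynTop η ξ κ) (q κ) (ξ n) := by
        refine continuous_matrix fun h h' => ?_
        simp only [shiftMat, of_apply, dynTop, hq]
        refine Continuous.add (by fun_prop) (continuous_finsetSum _ fun b _ => ?_)
        split_ifs <;> fun_prop
      exact (h.sub continuous_const).const_smul (c n)
    -- where the basis exists, the two families are conjugate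
    have heq : f₁ = f₂ := by
      refine Continuous.ext_on (s := {κ | Q.eval κ = 0}ᶜ) ?_ hc₁ hc₂ fun κ hκ => ?_
      · refine (Set.Finite.subset Q.roots.toFinset.finite_toSet fun κ hκ => ?_).countable.dense_compl ℝ
        simpa [hQ] using hκ
      · have hne : (sovMat S fun n => dynTransfer η ξ κ (ξ n)).det ≠ 0 := by
          rw [← show _ = (sovMat S fun n => dynTransfer η ξ κ (ξ n)).det from hdet κ]
          exact hκ
        refine mul_left_cancel₀ hne ?_
        rw [hf₁, hf₂]
        simp only
        rw [← Matrix.det_mul, mul_comm, ← Matrix.det_mul]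
        congr 1
        rw [Finset.mul_sum, Finset.sum_mul]
        refine Finset.sum_congr rfl fun n _ => ?_
        rw [mul_smul_comm, smul_mul_assoc, mul_sub, sub_mul,
          sovMat_mul_eq hξ (dynTransfer_mTrig η ξ κ) (dynTransfer_commute hξ κ)
            (dynTransfer_fusion κ) S (ξ n)]
        simp [hq]
    change f₁ κ₀ = 0
    rw [heq]
    refine Matrix.exists_mulVec_eq_zero_iff.1 ⟨_, sepVec_ne_zero fun n => t (ξ n), ?_⟩
    rw [Matrix.sum_mulVec]
    refine Finset.sum_eq_zero fun n _ => ?_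
    rw [smul_mulVec, sub_mulVec, shiftMat_mulVec_sepVec hξ ht htf, smul_mulVec, one_mulVec, sub_self,
      smul_zero]
  obtain ⟨φ, hφ, h0⟩ := exists_common_kernel _ (fun n m =>
    ((dynTransfer_commute hξ κ₀ n m).sub_left (((Commute.one_left _).smul_left _))).sub_right
      ((Commute.one_right _).smul_right _)) hsing
  refine ⟨φ, hφ, fun z => ?_⟩
  have hnode : ∀ b, node η ξ (allUp N) b = ξ b := fun b => by simp [node, allUp]
  rw [MTrig.interpolation hξ (dynTransfer_mTrig η ξ κ₀) (allUp N) z,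
    (ht.interpolation (node_injective hξ (allUp N))).1 z, add_mulVec, smul_mulVec, one_mulVec,
    Matrix.sum_mulVec, add_smul, Finset.sum_smul]
  congr 1
  refine Finset.sum_congr rfl fun b _ => ?_
  have hb := h0 b
  rw [sub_mulVec, smul_mulVec, one_mulVec, sub_eq_zero] at hb
  rw [smul_mulVec, hnode, hb, smul_smul]

end Pencil

/-! ### The interpolation formula -/

section Interpolation

variable {N : ℕ} {η : ℂ} {ξ : Fin N → ℂ}

/-- An eigenvalue function inherits the exponential form of the matrix elements, and its leading
coefficients are read off from any nonzero component of the eigenvector. -/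
lemma MTrig.eigenvalue {e : ℂ} {k : ℕ} {T B : Matrix (Spins N) (Spins N) ℂ}
    {F : ℂ → Matrix (Spins N) (Spins N) ℂ} (hF : MTrig e k T B F) {t : ℂ → ℂ} {φ : Space N}
    (hφ : ∀ z, F z *ᵥ φ = t z • φ) {s : Spins N} (hs : φ s ≠ 0) :
    IsTrig e k ((φ s)⁻¹ * ∑ s', φ s' * T s s') ((φ s)⁻¹ * ∑ s', φ s' * B s s') t := by
  refine ((IsTrig.sum Finset.univ fun s' _ => (hF s s').const_mul (φ s')).const_mul
    (φ s)⁻¹).congr rfl rfl rfl rfl fun z => ?_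
  have h := congrFun (hφ z) s
  rw [mulVec, dotProduct, Pi.smul_apply, smul_eq_mul] at h
  rw [eq_inv_mul_iff_mul_eq₀ hs, mul_comm, ← h]
  exact Finset.sum_congr rfl fun s' _ => mul_comm _ _

lemma MTrig.eigenvalue_diagonal {e : ℂ} {k : ℕ} {τ β : Spins N → ℂ}
    {F : ℂ → Matrix (Spins N) (Spins N) ℂ} (hF : MTrig e k (diagonal τ) (diagonal β) F)
    {t : ℂ → ℂ} {φ : Space N} (hφ : ∀ z, F z *ᵥ φ = t z • φ) {s : Spins N} (hs : φ s ≠ 0) :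
    IsTrig e k (τ s) (β s) t := by
  have h : ∀ δ : Spins N → ℂ, (φ s)⁻¹ * ∑ s', φ s' * diagonal δ s s' = δ s := fun δ => by
    rw [Finset.sum_eq_single s, diagonal_apply_eq, inv_mul_cancel_left₀ hs]
    · exact fun s' _ hne => by rw [diagonal_apply_ne _ hne.symm, mul_zero]
    · simp
  exact (hF.eigenvalue hφ hs).congr rfl rfl (h τ) (h β) fun z => rfl

lemma exp_two_mul_injective (hξ : InhomogeneityCondition η ξ) :
    Function.Injective fun n => exp (2 * ξ n) := by
  have h := node_injective hξ (allUp N)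
  simpa [node, allUp] using h

lemma IsTrig.ext_node (hξ : InhomogeneityCondition η ξ) {e t b b' : ℂ} {f g : ℂ → ℂ}
    (hf : IsTrig e N t b f) (hg : IsTrig e N t b' g) (h : ∀ n, f (ξ n) = g (ξ n)) (z : ℂ) :
    f z = g z := by
  rw [(hf.interpolation (exp_two_mul_injective hξ)).1 z,
    (hg.interpolation (exp_two_mul_injective hξ)).1 z]
  simp only [h]

lemma cosh_ne_of_generic {α : ℂ} (h : DiagonalGeneric N η α) : cosh (η * N / 2) ≠ 0 := by
  rcases Nat.eq_zero_or_pos N with rfl | hN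
  · simp
  -- `cosh (ηN/2) = 0` means `e^{ηN} = -1`, hence `e^{2ηN} = 1`
  intro h0
  rw [Complex.cosh, div_eq_zero_iff, or_iff_left two_ne_zero] at h0
  have h1 : exp (2 * (η * N)) = exp (2 * 0) := by
    have h2 : exp (2 * (η * N)) = exp (η * N / 2) ^ 4 := by rw [← Complex.exp_nat_mul]; ring_nf
    have h3 : exp (η * N / 2) * exp (-(η * N / 2)) = 1 := by rw [← Complex.exp_add]; simp
    rw [h2, mul_zero, Complex.exp_zero]
    rw [eq_neg_of_add_eq_zero_right h0] at h3
    linear_combination (1 - exp (η * N / 2) ^ 2) * h3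
  obtain ⟨m, hm⟩ := (exp_two_mul_eq_iff _ _).1 h1
  exact h.1 N hN le_rfl m (by rw [mul_comm, hm, zero_add])

variable (ξ) in
lemma isTrig_prod_sinh : IsTrig N N (topFactor ξ) (botFactor ξ) fun z => ∏ n, sinh (z - ξ n) := by
  refine (IsTrig.prod Finset.univ fun n _ => isTrig_sinh (ξ n)).congr ?_ ?_ rfl rfl fun z => rfl <;>
  simp

/-- The denominators of the interpolation functions. -/
def delta (ξ : Fin N → ℂ) (n : Fin N) : ℂ :=
  ∏ b ∈ Finset.univ.erase n, sinh (ξ n - ξ b)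

lemma isTrig_prod_erase (ξ : Fin N → ℂ) (n : Fin N) : IsTrig ((N : ℂ) - 1) (N - 1)
    (∏ b ∈ Finset.univ.erase n, exp (-ξ b) / 2) (∏ b ∈ Finset.univ.erase n, -(exp (ξ b) / 2))
    fun z => ∏ b ∈ Finset.univ.erase n, sinh (z - ξ b) := by
  have hN : 1 ≤ N := Nat.one_le_iff_ne_zero.2 fun h => by subst h; exact n.elim0
  refine (IsTrig.prod (Finset.univ.erase n) fun b _ => isTrig_sinh (ξ b)).congr ?_ ?_ rfl rfl
    fun z => rfl <;>
  simp [Nat.cast_sub hN]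

lemma interp_zero_isTrig (η : ℂ) (ξ : Fin N → ℂ) (n : Fin N) :
    IsTrig N N (topFactor ξ * (exp (η * N / 2) / cosh (η * N / 2)) * (delta ξ n)⁻¹)
      (-(botFactor ξ * (exp (-(η * N / 2)) / cosh (η * N / 2)) * (delta ξ n)⁻¹))
      (interp η ξ 0 n) := by
  have hN : 1 ≤ N := Nat.one_le_iff_ne_zero.2 fun h => by subst h; exact n.elim0
  have h1 : ∀ c : ℂ, exp (c - ξ n) * exp (ξ n) = exp c := fun c => by
    rw [← Complex.exp_add, sub_add_cancel]
  have h2 : ∀ c : ℂ, exp (-c) * exp c = 1 := fun c => by rw [← Complex.exp_add]; simp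
  refine ((((isTrig_cosh (η * N / 2 - ξ n)).mul (isTrig_prod_erase ξ n)).const_mul
    ((cosh (η * N / 2))⁻¹ * (delta ξ n)⁻¹))).congr (by ring) (by omega) ?_ ?_ fun z => ?_
  · rw [topFactor, ← Finset.mul_prod_erase _ _ (Finset.mem_univ n), sub_eq_add_neg,
      Complex.exp_add]
    ring
  · rw [botFactor, ← Finset.mul_prod_erase _ _ (Finset.mem_univ n), neg_sub, sub_eq_add_neg,
      Complex.exp_add]
    ring
  · rw [interp, if_pos rfl, Finset.prod_div_distrib, delta,
      show η * N / 2 + z - ξ n = η * N / 2 - ξ n + z by ring]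
    ring

lemma interp_one_isTrig (η : ℂ) (ξ : Fin N → ℂ) (n : Fin N) :
    ∃ b, IsTrig ((N : ℂ) - 1) N 0 b (interp η ξ 1 n) := by
  have hN : 1 ≤ N := Nat.one_le_iff_ne_zero.2 fun h => by subst h; exact n.elim0
  refine ⟨_, ((isTrig_prod_erase ξ n).raise.const_mul (delta ξ n)⁻¹).congr rfl (by omega)
    (mul_zero _) rfl fun z => ?_⟩
  rw [interp, if_neg one_ne_zero, Finset.prod_div_distrib, delta]
  ring

lemma interpolant_zero_isTrig (η : ℂ) (ξ : Fin N → ℂ) (α : ℂ) (l : ℤ) (x : Fin N → ℂ) :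
    IsTrig N N
      (topFactor ξ * (leadCoeff N η 0 α l +
        exp (η * N / 2) / cosh (η * N / 2) * ∑ n, x n / delta ξ n))
      (botFactor ξ * (leadCoeff N η 0 α l -
        exp (-(η * N / 2)) / cosh (η * N / 2) * ∑ n, x n / delta ξ n))
      (interpolant η ξ 0 α l x) := by
  refine (((isTrig_prod_sinh ξ).const_mul (leadCoeff N η 0 α l)).add
    (IsTrig.sum Finset.univ fun n _ => (interp_zero_isTrig η ξ n).const_mul (x n))).congr rfl rfl
    ?_ ?_ fun z => ?_
  · rw [mul_add, Finset.mul_sum, Finset.mul_sum, mul_comm]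
    congr 1
    exact Finset.sum_congr rfl fun n _ => by ring
  · rw [mul_sub, Finset.mul_sum, Finset.mul_sum, mul_comm, sub_eq_add_neg, ← Finset.sum_neg_distrib]
    congr 1
    exact Finset.sum_congr rfl fun n _ => by ring
  · rw [interpolant]
    congr 1
    exact Finset.sum_congr rfl fun n _ => mul_comm _ _

lemma interpolant_one_isTrig (η : ℂ) (ξ : Fin N → ℂ) (α : ℂ) (l : ℤ) (x : Fin N → ℂ) :
    ∃ b, IsTrig ((N : ℂ) - 1) N 0 b (interpolant η ξ 1 α l x) := by
  choose b hb using interp_one_isTrig η ξ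
  refine ⟨_, (IsTrig.sum Finset.univ fun n _ => (hb n).const_mul (x n)).congr rfl rfl (by simp) rfl
    fun z => ?_⟩
  rw [interpolant, leadCoeff, if_neg one_ne_zero, zero_mul, zero_add]
  exact Finset.sum_congr rfl fun n _ => mul_comm _ _

lemma interpolant_node (hξ : InhomogeneityCondition η ξ) {a : Fin 2} (α : ℂ)
    (hc : a = 0 → cosh (η * N / 2) ≠ 0) (l : ℤ) (x : Fin N → ℂ) (n : Fin N) :
    interpolant η ξ a α l x (ξ n) = x n := by
  rw [interpolant, Finset.prod_eq_zero (Finset.mem_univ n) (by simp), mul_zero, zero_add,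
    Finset.sum_eq_single n]
  · rw [interp, Finset.prod_eq_one, mul_one, add_sub_cancel_right]
    · split_ifs with ha
      · rw [div_self (hc ha), one_mul]
      · rw [one_mul]
    · exact fun b hb => div_self (hξ.sinh_sub (Finset.ne_of_mem_erase hb).symm)
  · intro b _ hb
    rw [interp, Finset.prod_eq_zero (Finset.mem_erase.2 ⟨hb.symm, Finset.mem_univ n⟩) (by simp),
      mul_zero, zero_mul]
  · simp

/-- The quadratic equations are the fusion relations `t(ξₙ) t(ξₙ - η) = a(ξₙ) d(ξₙ - η) det K`. -/
lemma mem_solutions_iff (hξ : InhomogeneityCondition η ξ) {a : Fin 2} (α : ℂ)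
    (hc : a = 0 → cosh (η * N / 2) ≠ 0) (l : ℤ) (x : Fin N → ℂ) :
    x ∈ solutions η ξ a α l ↔
      (∀ n, interpolant η ξ a α l x (ξ n) * interpolant η ξ a α l x (ξ n - η) =
        aFun η ξ (ξ n) * dFun ξ (ξ n - η) * (twist a α).det) ∧ (a = 0 → SumRule η ξ α l x) := by
  refine and_congr_left' (forall_congr' fun n => ?_)
  rw [interpolant_node hξ α hc, interpolant]
  simp only [sub_right_comm _ η]

end Interpolation

/-! ### Sectors of the diagonal twist -/

section Sector

variable {N : ℕ} {η : ℂ} {ξ : Fin N → ℂ}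

/-- The leading coefficient of `T(z)` at `+∞` on the sector with `m` down spins, up to the factor
`topFactor`. -/
def secTop (N : ℕ) (η α : ℂ) (m : ℕ) : ℂ :=
  exp α * exp (η * (N - m)) + exp (-α) * exp (η * m)

/-- The leading coefficient of `T(z)` at `-∞` on the sector with `m` down spins, up to the factor
`botFactor`. -/
def secBot (N : ℕ) (η α : ℂ) (m : ℕ) : ℂ :=
  exp α * exp (-η * (N - m)) + exp (-α) * exp (-η * m)

lemma transfer_zero_mTrig (η : ℂ) (ξ : Fin N → ℂ) (α : ℂ) :
    MTrig N N (diagonal fun s => topFactor ξ * secTop N η α (downs s))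
      (diagonal fun s => botFactor ξ * secBot N η α (downs s)) (transfer η ξ 0 α) := by
  refine (((mono_zero_zero_mTrig η ξ).smul (exp α)).add
    ((mono_one_one_mTrig η ξ).smul (exp (-α)))).congr rfl rfl ?_ ?_ fun z => transfer_zero η ξ α z
  all_goals
    rw [← diagonal_smul, ← diagonal_smul, diagonal_add]
    congr 1; funext s
    simp only [Pi.smul_apply, smul_eq_mul, secTop, secBot]; ring

/-- The left-hand side of the sum rule. -/
def sumVal (N : ℕ) (η α : ℂ) (l : ℤ) : ℂ :=
  exp (η * N / 2) * cosh (η / 2 * l + α) - exp (-(η * N / 2)) * cosh (η / 2 * l - α)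

lemma leadCoeff_mul (hc : cosh (η * N / 2) ≠ 0) (α : ℂ) (l : ℤ) :
    leadCoeff N η 0 α l * cosh (η * N / 2) = cosh (η / 2 * l + α) + cosh (η / 2 * l - α) := by
  rw [leadCoeff, if_pos rfl, Complex.cosh_add, Complex.cosh_sub,
    show η * (l : ℂ) / 2 = η / 2 * l by ring]
  field_simp
  ring

lemma secTop_eq (hc : cosh (η * N / 2) ≠ 0) (α : ℂ) {l : ℤ} {m : ℕ} (hl : l = N - 2 * m) :
    leadCoeff N η 0 α l + exp (η * N / 2) / cosh (η * N / 2) * sumVal N η α l =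
      secTop N η α m := by
  have h1 : secTop N η α m = 2 * exp (η * N / 2) * cosh (η / 2 * l + α) := by
    rw [secTop, Complex.cosh, hl]
    push_cast
    rw [mul_assoc, mul_div_assoc', mul_add, ← Complex.exp_add, ← Complex.exp_add,
      ← Complex.exp_add, ← Complex.exp_add]
    ring_nf
  refine mul_right_cancel₀ hc ?_
  have h2 : exp (η * N / 2) * exp (-(η * N / 2)) = 1 := by rw [← Complex.exp_add]; simp
  have h3 := div_mul_cancel₀ (exp (η * N / 2)) hc
  have h4 : cosh (η * N / 2) = (exp (η * N / 2) + exp (-(η * N / 2))) / 2 := rfl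
  rw [add_mul, leadCoeff_mul hc, h1]
  have h5 : sumVal N η α l = exp (η * N / 2) * cosh (η / 2 * l + α) -
    exp (-(η * N / 2)) * cosh (η / 2 * l - α) := rfl
  linear_combination sumVal N η α l * h3 - 2 * exp (η * N / 2) * cosh (η / 2 * l + α) * h4 -
    (cosh (η / 2 * l - α) + cosh (η / 2 * l + α)) * h2 +
    exp (η * N / 2) * h5

lemma secBot_eq (hc : cosh (η * N / 2) ≠ 0) (α : ℂ) {l : ℤ} {m : ℕ} (hl : l = N - 2 * m) :
    leadCoeff N η 0 α l - exp (-(η * N / 2)) / cosh (η * N / 2) * sumVal N η α l =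
      secBot N η α m := by
  have h1 : secBot N η α m = 2 * exp (-(η * N / 2)) * cosh (η / 2 * l - α) := by
    rw [secBot, Complex.cosh, hl]
    push_cast
    rw [mul_assoc, mul_div_assoc', mul_add, ← Complex.exp_add, ← Complex.exp_add,
      ← Complex.exp_add, ← Complex.exp_add]
    ring_nf
  refine mul_right_cancel₀ hc ?_
  have h2 : exp (η * N / 2) * exp (-(η * N / 2)) = 1 := by rw [← Complex.exp_add]; simp
  have h3 := div_mul_cancel₀ (exp (-(η * N / 2))) hc
  have h4 : cosh (η * N / 2) = (exp (η * N / 2) + exp (-(η * N / 2))) / 2 := rfl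
  rw [sub_mul, leadCoeff_mul hc, h1]
  have h5 : sumVal N η α l = exp (η * N / 2) * cosh (η / 2 * l + α) -
    exp (-(η * N / 2)) * cosh (η / 2 * l - α) := rfl
  linear_combination -sumVal N η α l * h3 - 2 * exp (-(η * N / 2)) * cosh (η / 2 * l - α) * h4 -
    (cosh (η / 2 * l - α) + cosh (η / 2 * l + α)) * h2 -
    exp (-(η * N / 2)) * h5

lemma interpolant_isTrig_of_sumRule (hc : cosh (η * N / 2) ≠ 0) {α : ℂ} {l : ℤ} {m : ℕ}
    (hl : l = N - 2 * m) {x : Fin N → ℂ} (hx : SumRule η ξ α l x) :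
    IsTrig N N (topFactor ξ * secTop N η α m) (botFactor ξ * secBot N η α m)
      (interpolant η ξ 0 α l x) := by
  have h : sumVal N η α l = ∑ n, x n / delta ξ n := hx
  refine (interpolant_zero_isTrig η ξ α l x).congr rfl rfl ?_ ?_ fun z => rfl
  · rw [← h, secTop_eq hc α hl]
  · rw [← h, secBot_eq hc α hl]

/-- The sum rule expresses that both leading coefficients are those of one sector: the difference of
`t` and its interpolant vanishes at the nodes, which ties its two leading coefficients together. -/
lemma sumRule_of_isTrig (hξ : InhomogeneityCondition η ξ) (hc : cosh (η * N / 2) ≠ 0) {α : ℂ}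
    {l : ℤ} {m : ℕ} (hl : l = N - 2 * m) {t : ℂ → ℂ}
    (ht : IsTrig N N (topFactor ξ * secTop N η α m) (botFactor ξ * secBot N η α m) t) :
    SumRule η ξ α l (fun n => t (ξ n)) ∧
      ∀ z, t z = interpolant η ξ 0 α l (fun n => t (ξ n)) z := by
  have hnode := fun n => interpolant_node hξ α (a := 0) (fun _ => hc) l (fun n => t (ξ n)) n
  have hsum : SumRule η ξ α l (fun n => t (ξ n)) := by
    change sumVal N η α l = ∑ n, t (ξ n) / delta ξ n
    have hd := (((interpolant_zero_isTrig η ξ α l fun n => t (ξ n)).const_mul (-1)).add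
      ht).interpolation (exp_two_mul_injective hξ)
    have h := hd.2 fun n => by rw [hnode]; ring
    rw [← secTop_eq hc α hl, ← secBot_eq hc α hl, botFactor_eq] at h
    have hE : exp (η * N / 2) + exp (-(η * N / 2)) = 2 * cosh (η * N / 2) := by
      rw [Complex.cosh]; ring
    have hP : botFactor ξ ≠ 0 := botFactor_ne ξ
    rw [botFactor_eq] at hP
    refine sub_eq_zero.1 (mul_left_cancel₀ hP ?_)
    rw [mul_zero]
    have h2 : (exp (η * N / 2) / cosh (η * N / 2) + exp (-(η * N / 2)) / cosh (η * N / 2)) = 2 := by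
      rw [← add_div, hE, mul_div_assoc, div_self hc, mul_one]
    linear_combination (-1 / 2) * h - (1 / 2) * (topFactor ξ * ∏ n, -exp (2 * ξ n)) *
      (sumVal N η α l - ∑ n, t (ξ n) / delta ξ n) * h2
  exact ⟨hsum, IsTrig.ext_node hξ ht (interpolant_isTrig_of_sumRule hc hl hsum) fun n =>
    (hnode n).symm⟩

lemma eq_zero_of_exp_eq_one {α : ℂ} (h : DiagonalGeneric N η α) {d : ℤ} (hd : d.natAbs ≤ N)
    (he : exp (2 * (d * η)) = 1) : d = 0 := by
  by_contra h0
  obtain ⟨k, hk⟩ := (exp_two_mul_eq_iff (d * η) 0).1 (by rw [he, mul_zero, Complex.exp_zero])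
  rw [zero_add] at hk
  have hpos : 1 ≤ d.natAbs := by omega
  rcases Int.natAbs_eq d with h1 | h1
  · have h2 : (d : ℂ) = (d.natAbs : ℂ) := by
      rw [← Int.cast_natCast, ← h1]
    exact h.1 _ hpos hd k (by rw [← h2, hk])
  · have h2 : (d : ℂ) = -(d.natAbs : ℂ) := by
      rw [← Int.cast_natCast, ← Int.cast_neg, ← h1]
    refine h.1 _ hpos hd (-k) ?_
    rw [h2] at hk
    push_cast
    linear_combination -hk

lemma eq_of_exp_eq {α : ℂ} (h : DiagonalGeneric N η α) {m m' : ℕ} (hm : m ≤ N) (hm' : m' ≤ N)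
    (he : exp (2 * (η * m)) = exp (2 * (η * m'))) : m = m' := by
  have := eq_zero_of_exp_eq_one h (d := (m : ℤ) - m') (by omega) (by
    push_cast
    rw [show (2 : ℂ) * (((m : ℂ) - m') * η) = 2 * (η * m) - 2 * (η * m') by ring, Complex.exp_sub,
      he, div_self (Complex.exp_ne_zero _)])
  omega

/-- The two leading coefficients together determine the sector. -/
lemma sector_unique {α : ℂ} (h : DiagonalGeneric N η α)
    (hK : ∀ v : ℂ, twist 0 α ≠ v • (1 : Matrix (Fin 2) (Fin 2) ℂ)) {m m' : ℕ} (hm : m ≤ N)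
    (hm' : m' ≤ N) (htop : secTop N η α m = secTop N η α m')
    (hbot : secBot N η α m = secBot N η α m') : m = m' := by
  refine eq_of_exp_eq h hm hm' ?_
  set a := exp α with ha
  set E := exp (η * N) with hE
  set Y := exp (η * m) with hY
  set Y' := exp (η * m') with hY'
  have ha0 : a ≠ 0 := Complex.exp_ne_zero _
  have hE0 : E ≠ 0 := Complex.exp_ne_zero _
  have hY0 : Y ≠ 0 := Complex.exp_ne_zero _
  have hY0' : Y' ≠ 0 := Complex.exp_ne_zero _
  have e1 : ∀ k : ℂ, exp (η * (N - k)) = E / exp (η * k) := fun k => by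
    rw [mul_sub, Complex.exp_sub]
  have e2 : ∀ k : ℂ, exp (-η * (N - k)) = exp (η * k) / E := fun k => by
    rw [← Complex.exp_sub]; ring_nf
  have e3 : ∀ k : ℂ, exp (-η * k) = (exp (η * k))⁻¹ := fun k => by
    rw [← Complex.exp_neg]; ring_nf
  simp only [secTop, secBot, e1, e2, e3, Complex.exp_neg α, ← ha, ← hY, ← hY'] at htop hbot
  have hmul : ∀ k : ℂ, exp (2 * (η * k)) = exp (η * k) ^ 2 := fun k => by
    rw [← Complex.exp_nat_mul]; norm_num
  rw [hmul, hmul, ← hY, ← hY']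
  by_contra hne
  have hd : Y - Y' ≠ 0 := fun h0 => hne (by rw [sub_eq_zero.1 h0])
  have h1 : a ^ 2 * E = Y * Y' := by
    refine mul_left_cancel₀ hd ?_
    field_simp at htop
    linear_combination -htop
  have h2 : a ^ 2 * (Y * Y') = E := by
    refine mul_left_cancel₀ hd ?_
    field_simp at hbot
    linear_combination hbot
  -- `exp α` is a fourth root of unity; `exp (2 α) = 1` would make the twist scalar
  have h3 : (a ^ 2 - 1) * (a ^ 2 + 1) = 0 := by
    refine mul_left_cancel₀ hE0 ?_
    linear_combination a ^ 2 * h1 + h2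
  rcases mul_eq_zero.1 h3 with h4 | h4
  · refine hK a ?_
    have : exp (-α) = a := by
      rw [Complex.exp_neg, ← ha]; refine inv_eq_of_mul_eq_one_right ?_
      linear_combination h4
    ext i j
    fin_cases i <;> fin_cases j <;> simp [twist, this, ← ha]
  · -- here `exp (η (m + m' - N)) = -1`, which genericity forbids
    have h5 : Y * Y' = -E := by linear_combination E * h4 - h1
    have h6 : (m : ℤ) + m' - N = 0 := by
      refine eq_zero_of_exp_eq_one h (by omega) ?_
      push_cast
      rw [show (2 : ℂ) * (((m : ℂ) + m' - N) * η) = 2 * (η * m) + 2 * (η * m') - 2 * (η * N) by ring,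
        Complex.exp_sub, Complex.exp_add, hmul, hmul, hmul, ← hY, ← hY', ← hE, div_eq_one_iff_eq
        (pow_ne_zero 2 hE0)]
      linear_combination (Y * Y' - E) * h5
    have h7 : Y * Y' = E := by
      rw [hY, hY', hE, ← Complex.exp_add, ← mul_add]
      congr 2
      have : (m : ℤ) + m' = N := by omega
      exact_mod_cast this
    have h8 : 2 * E = 0 := by linear_combination h5 - h7
    exact hE0 ((mul_eq_zero.1 h8).resolve_left two_ne_zero)

end Sector

/-! ### The spectrum -/

section Spectrum

variable {N : ℕ} {η : ℂ} {ξ : Fin N → ℂ} {a : Fin 2} {α : ℂ} {t : ℂ → ℂ} {ψ : Space N}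

lemma transfer_fusion (a : Fin 2) (α : ℂ) (n : Fin N) :
    transfer η ξ a α (ξ n) * transfer η ξ a α (ξ n - η) =
      (aFun η ξ (ξ n) * dFun ξ (ξ n - η) * (twist a α).det) • 1 := by
  rcases Fin.exists_fin_two.1 ⟨a, rfl⟩ with rfl | rfl
  · exact transfer_zero_fusion α n
  · exact transfer_one_fusion α n

lemma IsEigenvector.exists_ne (h : IsEigenvector η ξ a α t ψ) : ∃ s, ψ s ≠ 0 :=
  Function.ne_iff.1 h.1

lemma IsEigenvector.fusion (h : IsEigenvector η ξ a α t ψ)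
    (n : Fin N) : t (ξ n) * t (ξ n - η) =
      aFun η ξ (ξ n) * dFun ξ (ξ n - η) * (twist a α).det := by
  have h1 := congrArg (· *ᵥ ψ) (transfer_fusion (η := η) (ξ := ξ) a α n)
  simp only [← mulVec_mulVec, h.2, mulVec_smul, smul_mulVec, one_mulVec, smul_smul] at h1
  rw [mul_comm]
  exact smul_left_injective ℂ h.1 h1

lemma IsEigenvector.isTrig (h : IsEigenvector η ξ 0 α t ψ) {s : Spins N} (hs : ψ s ≠ 0) :
    IsTrig N N (topFactor ξ * secTop N η α (downs s)) (botFactor ξ * secBot N η α (downs s)) t :=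
  (transfer_zero_mTrig η ξ α).eigenvalue_diagonal h.2 hs

lemma mem_spinValues (m : ℕ) (hm : m ≤ N) : (N : ℤ) - 2 * m ∈ spinValues N := ⟨m, hm, rfl⟩

lemma mem_spectrumPart_of_isEigenvector_one (hξ : InhomogeneityCondition η ξ)
    (h : IsEigenvector η ξ 1 α t ψ) (l : ℤ) : t ∈ spectrumPart η ξ 1 α l := by
  obtain ⟨s, hs⟩ := h.exists_ne
  obtain ⟨B, hB⟩ := transfer_one_mTrig (η := η) (ξ := ξ) α
  have ht := (hB.eigenvalue h.2 hs).congr rfl rfl (t' := 0) (by simp) rfl fun z => rfl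
  obtain ⟨b, hb⟩ := interpolant_one_isTrig η ξ α l fun n => t (ξ n)
  have hc : (1 : Fin 2) = 0 → cosh (η * N / 2) ≠ 0 := fun h => absurd h one_ne_zero
  have heq : ∀ z, t z = interpolant η ξ 1 α l (fun n => t (ξ n)) z :=
    IsTrig.ext_node hξ ht hb fun n =>
      (interpolant_node hξ α hc l (fun n => t (ξ n)) n).symm
  refine ⟨_, (mem_solutions_iff hξ α hc l _).2 ⟨fun n => ?_, fun h => absurd h one_ne_zero⟩, heq⟩
  rw [← heq, ← heq, h.fusion n]

lemma mem_spectrumPart_of_isEigenvector_zero (hξ : InhomogeneityCondition η ξ)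
    (hg : DiagonalGeneric N η α) (h : IsEigenvector η ξ 0 α t ψ) {s : Spins N} (hs : ψ s ≠ 0) :
    t ∈ spectrumPart η ξ 0 α (N - 2 * downs s) := by
  have hc := cosh_ne_of_generic hg
  obtain ⟨hsum, heq⟩ := sumRule_of_isTrig hξ hc (l := N - 2 * downs s) rfl
    (h.isTrig hs)
  refine ⟨_, (mem_solutions_iff hξ α (fun _ => hc) _ _).2 ⟨fun n => ?_, fun _ => hsum⟩, heq⟩
  rw [← heq, ← heq, h.fusion n]

lemma mem_spectrum_one (hη : ∀ m : ℤ, η ≠ I * m * Real.pi) (hξ : InhomogeneityCondition η ξ)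
    {l : ℤ} (ht : t ∈ spectrumPart η ξ 1 α l) : t ∈ spectrum η ξ 1 α := by
  obtain ⟨x, hx, hxt⟩ := ht
  rw [mem_solutions_iff hξ α fun h => absurd h one_ne_zero] at hx
  obtain ⟨b, hb⟩ := interpolant_one_isTrig η ξ α l x
  obtain ⟨B, hB⟩ := transfer_one_mTrig (η := η) (ξ := ξ) α
  exact exists_eigenvector_of_det_ne_zero hξ (hB.congr rfl rfl (zero_smul ℂ 1).symm rfl fun z => rfl)
    (transfer_one_commute hξ α) (transfer_one_fusion α) (det_sovMat_one_ne_zero hη hξ α)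
    (hb.congr rfl rfl rfl rfl hxt) fun n => by rw [hxt, hxt, hx.1 n]

lemma dynTransfer_mulVec (κ z : ℂ) (φ : Space N) : dynTransfer η ξ κ z *ᵥ φ =
    κ • (mono η ξ z N 0 0 *ᵥ fun s => exp (η * downs s) * φ s) +
      mono η ξ z N 1 1 *ᵥ fun s => exp (-η * downs s) * φ s := by
  have h : ∀ f : Spins N → ℂ, (diagonal f *ᵥ φ) = fun s => f s * φ s := fun f =>
    funext fun s => mulVec_diagonal f φ s
  rw [dynTransfer, pencil, add_mulVec, smul_mulVec, ← mulVec_mulVec, ← mulVec_mulVec, h, h]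

lemma dynTransfer_mulVec_apply {s₀ : Spins N} (hs : ∀ s, downs s = downs s₀ → s = s₀) (κ z : ℂ)
    (φ : Space N) : (dynTransfer η ξ κ z *ᵥ φ) s₀ =
      (κ * mono η ξ z N 0 0 s₀ s₀ * exp (η * downs s₀) +
        mono η ξ z N 1 1 s₀ s₀ * exp (-η * downs s₀)) * φ s₀ := by
  rw [dynTransfer_mulVec, Pi.add_apply, Pi.smul_apply, smul_eq_mul,
    mulVec_apply_of_unique (mono_diag_conserve η ξ z 0) hs,
    mulVec_apply_of_unique (mono_diag_conserve η ξ z 1) hs]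
  ring

/-- With `κ = e^{2(α - η m)}` the operators `dynTransfer` and `T(z)` are proportional on the sector with
`m` down spins. -/
lemma dynTransfer_mulVec_of_sector {m : ℕ} {φ : Space N} (hφ : ∀ s, φ s ≠ 0 → downs s = m) (z : ℂ) :
    dynTransfer η ξ (exp (2 * (α - η * m))) z *ᵥ φ =
      exp (α - η * m) • (transfer η ξ 0 α z *ᵥ φ) := by
  have h : ∀ f : ℕ → ℂ, (fun s => f (downs s) * φ s) = f m • φ := fun f => by
    funext s
    by_cases hs : φ s = 0
    · simp [hs]
    · rw [hφ s hs]; rfl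
  rw [dynTransfer_mulVec, h fun m => exp (η * m), h fun m => exp (-η * m), transfer_zero,
    add_mulVec, smul_mulVec, smul_mulVec, mulVec_smul, mulVec_smul, smul_add, smul_smul, smul_smul,
    smul_smul, ← Complex.exp_add, ← Complex.exp_add, ← Complex.exp_add]
  ring_nf

/-- The sectors on which an eigenvector of `dynTransfer` can be supported. -/
lemma downs_of_bot_eq (hg : DiagonalGeneric N η α) {m d : ℕ} (hm : m ≤ N) (hd : d ≤ N)
    (h : exp (2 * (α - η * m)) * (exp (-η * (N - d)) * exp (η * d)) +
      exp (-η * d) * exp (-η * d) = exp (α - η * m) * secBot N η α m) :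
    d = m ∨ ((d = 0 ∨ d = N) ∧ exp (2 * α) * exp (2 * (η * d)) = exp (η * N)) := by
  set E := exp (η * N) with hE
  set A := exp (2 * α) with hA
  set X := exp (2 * (η * d)) with hX
  set Y := exp (2 * (η * m)) with hY
  have hE0 : E ≠ 0 := Complex.exp_ne_zero _
  have hX0 : X ≠ 0 := Complex.exp_ne_zero _
  have hY0 : Y ≠ 0 := Complex.exp_ne_zero _
  have h1 : A / Y * (X / E) + X⁻¹ = A / E + Y⁻¹ := by
    have e1 : A / Y * (X / E) = exp (2 * (α - η * m)) * (exp (-η * (N - d)) * exp (η * d)) := by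
      rw [hA, hY, hX, hE, ← Complex.exp_sub, ← Complex.exp_sub, ← Complex.exp_add,
        ← Complex.exp_add, ← Complex.exp_add]
      ring_nf
    have e2 : X⁻¹ = exp (-η * d) * exp (-η * d) := by
      rw [hX, ← Complex.exp_neg, ← Complex.exp_add]
      ring_nf
    have e3 : A / E + Y⁻¹ = exp (α - η * m) * secBot N η α m := by
      rw [secBot, mul_add, hA, hE, hY, ← Complex.exp_sub, ← Complex.exp_neg, ← Complex.exp_add,
        ← Complex.exp_add, ← Complex.exp_add, ← Complex.exp_add]
      ring_nf
    rw [e1, e2, h, e3]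
  have h2 : (X - Y) * (A * X - E) = 0 := by
    field_simp at h1
    linear_combination h1
  rcases mul_eq_zero.1 h2 with h3 | h3
  · exact Or.inl (eq_of_exp_eq hg hd hm (sub_eq_zero.1 h3))
  · refine Or.inr ⟨?_, sub_eq_zero.1 h3⟩
    by_contra! hne
    obtain ⟨k, hk⟩ := (exp_two_mul_eq_iff α (η * ((N : ℂ) / 2 - d))).1 (by
      rw [show 2 * (η * ((N : ℂ) / 2 - d)) = η * N - 2 * (η * d) by ring, Complex.exp_sub,
        eq_div_iff hX0]
      exact sub_eq_zero.1 h3)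
    exact hg.2 d (Nat.one_le_iff_ne_zero.2 hne.1) (lt_of_le_of_ne hd hne.2) k hk

/-- The eigenvector of `dynTransfer` is supported on the sector with `m` down spins, and then it is
an eigenvector of the transfer matrix, or it has a component along a ferromagnetic state. In the
latter case `t` is explicit and belongs to a spin helix state. -/
lemma mem_spectrum_zero_of_isTrig (hη : ∀ m : ℤ, η ≠ I * m * Real.pi)
    (hξ : InhomogeneityCondition η ξ) (hg : DiagonalGeneric N η α) {m : ℕ} (hm : m ≤ N)
    (ht : IsTrig N N (topFactor ξ * secTop N η α m) (botFactor ξ * secBot N η α m) t)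
    (htf : ∀ n, t (ξ n) * t (ξ n - η) = aFun η ξ (ξ n) * dFun ξ (ξ n - η)) :
    t ∈ spectrum η ξ 0 α := by
  set κ := exp (2 * (α - η * m)) with hκ
  set c := exp (α - η * m) with hc
  have hc0 : c ≠ 0 := Complex.exp_ne_zero _
  have hcκ : c * c = κ := by rw [hc, hκ, ← Complex.exp_add]; ring_nf
  have ht' : IsTrig N N (dynTop η ξ κ) (botFactor ξ * (c * secBot N η α m)) fun z => c * t z := by
    refine (ht.const_mul c).congr rfl rfl ?_ (by ring) fun z => rfl
    rw [dynTop, secTop, mul_left_comm, mul_add c, hc, hκ, ← Complex.exp_add, ← Complex.exp_add,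
      ← Complex.exp_add, ← Complex.exp_add, ← Complex.exp_add]
    congr 2
    · ring_nf
    · rw [Complex.exp_eq_one_iff]
      exact ⟨0, by push_cast; ring⟩
  obtain ⟨φ, hφ, hdyn⟩ := exists_eigenvector_dynTransfer hη hξ ht' fun n => by
    rw [← htf, ← hcκ]; ring
  have hsec : ∀ s, φ s ≠ 0 → downs s = m ∨
      ((downs s = 0 ∨ downs s = N) ∧ exp (2 * α) * exp (2 * (η * downs s)) = exp (η * N)) := by
    intro s hs
    have hd : dynTop η ξ κ • (1 : Matrix (Spins N) (Spins N) ℂ) =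
        diagonal fun _ => dynTop η ξ κ := by
      rw [← diagonal_one, ← diagonal_smul]
      congr 1; funext s; simp
    have h := (((dynTransfer_mTrig η ξ κ).congr rfl rfl hd rfl fun z => rfl).eigenvalue_diagonal
      hdyn hs).unique ht'
    exact downs_of_bot_eq hg hm (downs_le s) (mul_left_cancel₀ (botFactor_ne ξ) h.2)
  -- a component in another sector must be ferromagnetic and fixes `exp (2 α)`
  by_cases hall : ∀ s, φ s ≠ 0 → downs s = m
  · refine ⟨φ, hφ, fun z => ?_⟩
    have h := hdyn z
    rw [dynTransfer_mulVec_of_sector hall, ← smul_smul] at h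
    exact smul_right_injective _ hc0 h
  push Not at hall
  obtain ⟨s, hs, hne⟩ := hall
  obtain ⟨h0 | h0, hα⟩ := (hsec s hs).resolve_left hne
  · obtain rfl := downs_eq_zero h0
    have hα' : exp (2 * α) = exp (-(-1 * η * N)) := by
      rw [h0] at hα
      simpa using hα
    convert helix_mem_spectrum η ξ (Or.inr rfl) α hm hα' using 1
    funext z
    have h := congrFun (hdyn z) (allUp N)
    rw [dynTransfer_mulVec_apply (fun s hs => downs_eq_zero (hs.trans h0)), Pi.smul_apply,
      smul_eq_mul, (mono_allUp η ξ z).1, (mono_allUp η ξ z).2, h0] at h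
    refine mul_left_cancel₀ hc0 ((mul_right_cancel₀ hs h).symm.trans ?_)
    have e1 : c * exp (α + -1 * η * m) = κ := by rw [← hcκ, hc]; ring_nf
    have e2 : c * exp (-(α + -1 * η * m)) = 1 := by rw [hc, ← Complex.exp_add]; ring_nf; simp
    rw [mul_add, ← mul_assoc, ← mul_assoc, e1, e2]
    simp
  · obtain rfl := downs_eq_top h0
    have hα' : exp (2 * α) = exp (-(1 * η * N)) := by
      rw [h0] at hα
      refine mul_right_cancel₀ (Complex.exp_ne_zero (2 * (η * N))) (hα.trans ?_)
      rw [← Complex.exp_add]; ring_nf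
    convert helix_mem_spectrum η ξ (Or.inl rfl) α hm hα' using 1
    funext z
    have h := congrFun (hdyn z) (allDown N)
    rw [dynTransfer_mulVec_apply (fun s hs => downs_eq_top (hs.trans h0)), Pi.smul_apply,
      smul_eq_mul, (mono_allDown η ξ z).1, (mono_allDown η ξ z).2, h0] at h
    refine mul_left_cancel₀ hc0 ((mul_right_cancel₀ hs h).symm.trans ?_)
    have e1 : c * exp (α + 1 * η * m) = exp (-η * N) := by
      rw [hc, ← Complex.exp_add, show α - η * m + (α + 1 * η * m) = 2 * α by ring, hα']
      ring_nf
    have e2 : c * exp (-(α + 1 * η * m)) = κ * exp (η * N) := by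
      have h1 : κ = exp (2 * α) * exp (-(2 * (η * m))) := by
        rw [hκ, ← Complex.exp_add]; ring_nf
      rw [h1, hα', hc, ← Complex.exp_add, ← Complex.exp_add, ← Complex.exp_add]
      ring_nf
    rw [mul_add, ← mul_assoc, ← mul_assoc, e1, e2]
    ring

lemma spectrum_eq (hη : ∀ m : ℤ, η ≠ I * m * Real.pi) (hξ : InhomogeneityCondition η ξ)
    (a : Fin 2) (α : ℂ) (hg : a = 0 → DiagonalGeneric N η α) :
    spectrum η ξ a α = ⋃ l ∈ spinValues N, spectrumPart η ξ a α l := by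
  ext t
  simp only [Set.mem_iUnion, exists_prop]
  rcases Fin.exists_fin_two.1 ⟨a, rfl⟩ with rfl | rfl
  · have hg := hg rfl
    have hc := cosh_ne_of_generic hg
    constructor
    · rintro ⟨ψ, h⟩
      obtain ⟨s, hs⟩ := h.exists_ne
      exact ⟨_, mem_spinValues _ (downs_le s), mem_spectrumPart_of_isEigenvector_zero hξ hg h hs⟩
    · rintro ⟨l, ⟨m, hm, hl⟩, x, hx, hxt⟩
      rw [mem_solutions_iff hξ α fun _ => hc] at hx
      refine mem_spectrum_zero_of_isTrig hη hξ hg hm ((interpolant_isTrig_of_sumRule hc hl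
        (hx.2 rfl)).congr rfl rfl rfl rfl hxt) fun n => ?_
      rw [hxt, hxt, hx.1 n, twist_zero_det, mul_one]
  · constructor
    · rintro ⟨ψ, h⟩
      exact ⟨_, mem_spinValues 0 (Nat.zero_le N), mem_spectrumPart_of_isEigenvector_one hξ h _⟩
    · rintro ⟨l, -, h⟩
      exact mem_spectrum_one hη hξ h

lemma solutions_unique (hη : ∀ m : ℤ, η ≠ I * m * Real.pi) (hξ : InhomogeneityCondition η ξ)
    (hg : DiagonalGeneric N η α)
    (hK : ∀ v : ℂ, twist 0 α ≠ v • (1 : Matrix (Fin 2) (Fin 2) ℂ)) {l l' : ℤ}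
    (hl : l ∈ spinValues N) (hl' : l' ∈ spinValues N) {x : Fin N → ℂ}
    (hx : x ∈ solutions η ξ 0 α l) (hx' : x ∈ solutions η ξ 0 α l') : l' = l := by
  have hc := cosh_ne_of_generic hg
  obtain ⟨m, hm, rfl⟩ := hl
  obtain ⟨m', hm', rfl⟩ := hl'
  rcases Nat.eq_zero_or_pos N with rfl | hN
  · obtain rfl : m = 0 := by omega
    obtain rfl : m' = 0 := by omega
    rfl
  -- the products `xₙ t(ξₙ - η)` agree and `xₙ ≠ 0`, so the leading coefficients agree
  have hlead : leadCoeff N η 0 α (N - 2 * m) = leadCoeff N η 0 α (N - 2 * m') := by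
    have h1 := hx.1 ⟨0, hN⟩
    have h2 := hx'.1 ⟨0, hN⟩
    have hd := dFun_ne hη hξ ⟨0, hN⟩
    have hx0 : x ⟨0, hN⟩ ≠ 0 := fun h0 => by
      rw [h0, zero_mul, twist_zero_det, mul_one] at h1
      exact mul_ne_zero (aFun_ne hη hξ _) hd h1.symm
    have h3 := mul_left_cancel₀ hx0 (h1.trans h2.symm)
    simp only [dFun, sub_right_comm _ η] at hd
    exact mul_right_cancel₀ hd (add_right_cancel h3)
  have hfun : ∀ z, interpolant η ξ 0 α (N - 2 * m) x z = interpolant η ξ 0 α (N - 2 * m') x z :=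
    fun z => by rw [interpolant, interpolant, hlead]
  have h := (interpolant_isTrig_of_sumRule hc rfl (hx.2 rfl)).unique
    ((interpolant_isTrig_of_sumRule hc (m := m') rfl (hx'.2 rfl)).congr rfl rfl
      rfl rfl hfun)
  rw [sector_unique hg hK hm hm' (mul_left_cancel₀ (topFactor_ne ξ) h.1)
    (mul_left_cancel₀ (botFactor_ne ξ) h.2)]

lemma spinZ_apply_eq (s : Spins N) :
    ∑ n : Fin N, (if s n = 0 then (1 : ℂ) else -1) = N - 2 * downs s := by
  have h : ∀ n, (if s n = 0 then (1 : ℂ) else -1) = 1 - 2 * ((s n : ℕ) : ℂ) := fun n => by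
    rcases Fin.exists_fin_two.1 ⟨s n, rfl⟩ with h | h <;> simp [h]
    norm_num
  simp only [h, Finset.sum_sub_distrib, ← Finset.mul_sum, downs, Nat.cast_sum]
  simp

lemma spinZ_mulVec_of_mem (hg : DiagonalGeneric N η α)
    (hK : ∀ v : ℂ, twist 0 α ≠ v • (1 : Matrix (Fin 2) (Fin 2) ℂ)) {l : ℤ}
    (hl : l ∈ spinValues N) (ht : t ∈ spectrumPart η ξ 0 α l) (h : IsEigenvector η ξ 0 α t ψ) :
    spinZ N *ᵥ ψ = (l : ℂ) • ψ := by
  obtain ⟨m, hm, rfl⟩ := hl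
  obtain ⟨x, hx, hxt⟩ := ht
  funext s
  rw [spinZ, mulVec_diagonal, Pi.smul_apply, smul_eq_mul, spinZ_apply_eq]
  by_cases hs : ψ s = 0
  · rw [hs, mul_zero, mul_zero]
  have hu := (h.isTrig hs).unique ((interpolant_isTrig_of_sumRule (cosh_ne_of_generic hg)
    rfl (hx.2 rfl)).congr rfl rfl rfl rfl hxt)
  rw [sector_unique hg hK (downs_le s) hm (mul_left_cancel₀ (topFactor_ne ξ) hu.1)
    (mul_left_cancel₀ (botFactor_ne ξ) hu.2)]
  push_cast
  rfl

end Spectrum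

/-! ### Factorized wave functions -/

section WaveFunctions

variable {N : ℕ} {η : ℂ} {ξ : Fin N → ℂ} {a : Fin 2} {α : ℂ} {t : ℂ → ℂ} {ψ φ : Space N}
  {S : Space N}

lemma sovCovector_dotProduct (h : IsEigenvector η ξ a α t ψ) (S : Space N) (k : Fin N → Fin 2) :
    sovCovector η ξ a α S k ⬝ᵥ ψ =
      (∏ n, (t (ξ n) / sovNorm η ξ a α n) ^ (k n : ℕ)) * (S ⬝ᵥ ψ) := by
  have h1 : ∀ n, ((sovNorm η ξ a α n)⁻¹ • transfer η ξ a α (ξ n)) *ᵥ ψ =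
      (t (ξ n) / sovNorm η ξ a α n) • ψ := fun n => by
    rw [smul_mulVec, h.2, smul_smul, div_eq_inv_mul]
  have h2 : ∀ n (j : ℕ), (((sovNorm η ξ a α n)⁻¹ • transfer η ξ a α (ξ n)) ^ j) *ᵥ ψ =
      ((t (ξ n) / sovNorm η ξ a α n) ^ j) • ψ := fun n j => by
    induction j with
    | zero => simp
    | succ j ih => rw [pow_succ, ← mulVec_mulVec, h1, mulVec_smul, ih, smul_smul, pow_succ, mul_comm]
  have h3 : ((List.finRange N).map fun n =>
      ((sovNorm η ξ a α n)⁻¹ • transfer η ξ a α (ξ n)) ^ (k n : ℕ)).prod *ᵥ ψ =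
      (∏ n, (t (ξ n) / sovNorm η ξ a α n) ^ (k n : ℕ)) • ψ := by
    rw [← List.prod_ofFn, List.ofFn_eq_map]
    induction List.finRange N with
    | nil => simp
    | cons n l ih =>
      rw [List.map_cons, List.prod_cons, ← mulVec_mulVec, ih, mulVec_smul, h2, smul_smul,
        List.map_cons, List.prod_cons, mul_comm]
  rw [sovCovector, ← dotProduct_mulVec, h3, dotProduct_smul, smul_eq_mul]

lemma eq_zero_of_sovCovector (hS : IsSovBasis η ξ a α S)
    (h : ∀ k, sovCovector η ξ a α S k ⬝ᵥ ψ = 0) : ψ = 0 := by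
  have hall : ∀ v : Space N, v ⬝ᵥ ψ = 0 := fun v => by
    have hv : v ∈ Submodule.span ℂ (Set.range (sovCovector η ξ a α S)) := by rw [hS.2]; trivial
    induction hv using Submodule.span_induction with
    | mem x hx => obtain ⟨k, rfl⟩ := hx; exact h k
    | zero => exact zero_dotProduct ψ
    | add x y _ _ hx hy => rw [add_dotProduct, hx, hy, add_zero]
    | smul c x _ hx => rw [smul_dotProduct, hx, smul_zero]
  funext s
  simpa using hall (Pi.single s 1)

lemma IsEigenvector.dotProduct_ne_zero (hS : IsSovBasis η ξ a α S)
    (h : IsEigenvector η ξ a α t ψ) : S ⬝ᵥ ψ ≠ 0 := fun h0 =>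
  h.1 (eq_zero_of_sovCovector hS fun k => by rw [sovCovector_dotProduct h, h0, mul_zero])

lemma IsEigenvector.eq_of_dotProduct_eq (hS : IsSovBasis η ξ a α S)
    (h : IsEigenvector η ξ a α t ψ) (h' : IsEigenvector η ξ a α t φ) (heq : S ⬝ᵥ φ = S ⬝ᵥ ψ) :
    φ = ψ :=
  sub_eq_zero.1 (eq_zero_of_sovCovector hS fun k => by
    rw [dotProduct_sub, sovCovector_dotProduct h, sovCovector_dotProduct h', heq, sub_self])

lemma IsEigenvector.smul (h : IsEigenvector η ξ a α t ψ) {c : ℂ} (hc : c ≠ 0) :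
    IsEigenvector η ξ a α t (c • ψ) :=
  ⟨smul_ne_zero hc h.1, fun z => by rw [mulVec_smul, h.2, smul_comm]⟩

lemma isWSimple_of_isSovBasis (hS : IsSovBasis η ξ a α S) : IsWSimple η ξ a α := by
  rintro t ⟨ψ, h⟩
  refine ⟨ψ, h, fun φ h' => ⟨(S ⬝ᵥ φ) / (S ⬝ᵥ ψ), ?_⟩⟩
  have h0 := h.dotProduct_ne_zero hS
  refine (h.smul (div_ne_zero (h'.dotProduct_ne_zero hS) h0)).eq_of_dotProduct_eq hS h' ?_
  rw [dotProduct_smul, smul_eq_mul, div_mul_cancel₀ _ h0]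

lemma existsUnique_normalized (hS : IsSovBasis η ξ a α S) (ht : t ∈ spectrum η ξ a α) :
    ∃! ψ : Space N, IsEigenvector η ξ a α t ψ ∧ S ⬝ᵥ ψ = 1 := by
  obtain ⟨ψ, h⟩ := ht
  have h0 := h.dotProduct_ne_zero hS
  have h1 : S ⬝ᵥ ((S ⬝ᵥ ψ)⁻¹ • ψ) = 1 := by
    rw [dotProduct_smul, smul_eq_mul, inv_mul_cancel₀ h0]
  exact ⟨_, ⟨h.smul (inv_ne_zero h0), h1⟩, fun φ hφ =>
    (h.smul (inv_ne_zero h0)).eq_of_dotProduct_eq hS hφ.1 (hφ.2.trans h1.symm)⟩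

end WaveFunctions

end XXZ

end

theorem mainTheorem9 (N : ℕ) (η : ℂ) (ξ : Fin N → ℂ)
    (hη : ∀ m : ℤ, η ≠ Complex.I * m * Real.pi)
    (hξ : XXZ.InhomogeneityCondition η ξ) :
    -- existence of the left SoV basis for almost every covector `S`
    (∀ α : ℂ, ∀ᵐ S : XXZ.Space N ∂MeasureTheory.volume, XXZ.IsSovBasis η ξ 1 α S) ∧
    (∃ F : Finset ℂ, ∀ α : ℂ, Complex.exp (2 * α) ∉ F →
      ∀ᵐ S : XXZ.Space N ∂MeasureTheory.volume, XXZ.IsSovBasis η ξ 0 α S) ∧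
    ∀ (a : Fin 2) (α : ℂ),
      (∀ v : ℂ, XXZ.twist a α ≠ v • (1 : Matrix (Fin 2) (Fin 2) ℂ)) →
      (a = 0 → XXZ.DiagonalGeneric N η α) →
      -- characterization of the spectrum
      XXZ.spectrum η ξ a α = ⋃ l ∈ XXZ.spinValues N, XXZ.spectrumPart η ξ a α l ∧
      -- for the diagonal twist, `l` is unambiguous and is the eigenvalue of `S_z`
      (a = 0 → ∀ l ∈ XXZ.spinValues N,
        (∀ x ∈ XXZ.solutions η ξ a α l,
          ∀ l' ∈ XXZ.spinValues N, x ∈ XXZ.solutions η ξ a α l' → l' = l) ∧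
        (∀ t ∈ XXZ.spectrumPart η ξ a α l, ∀ ψ : XXZ.Space N,
          XXZ.IsEigenvector η ξ a α t ψ →
            Matrix.mulVec (XXZ.spinZ N) ψ = (l : ℂ) • ψ)) ∧
      -- simplicity and factorized wave functions in every left SoV basis
      (∀ S : XXZ.Space N, XXZ.IsSovBasis η ξ a α S →
        XXZ.IsWSimple η ξ a α ∧
        ∀ t ∈ XXZ.spectrum η ξ a α,
          (∃! ψ : XXZ.Space N,
            XXZ.IsEigenvector η ξ a α t ψ ∧ dotProduct S ψ = 1) ∧
          ∀ ψ : XXZ.Space N, XXZ.IsEigenvector η ξ a α t ψ → dotProduct S ψ = 1 →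
            ∀ h : Fin N → Fin 2,
              dotProduct (XXZ.sovCovector η ξ a α S h) ψ =
                ∏ n, (t (ξ n) / XXZ.sovNorm η ξ a α n) ^ (h n : ℕ)) := by
  refine ⟨XXZ.ae_isSovBasis_one hη hξ, XXZ.ae_isSovBasis_zero hη hξ, fun a α hK hg =>
    ⟨XXZ.spectrum_eq hη hξ a α hg, ?_, fun S hS => ⟨XXZ.isWSimple_of_isSovBasis hS, fun t ht =>
      ⟨XXZ.existsUnique_normalized hS ht, fun ψ hψ hn h => ?_⟩⟩⟩⟩
  · rintro rfl l hl
    exact ⟨fun x hx l' hl' hx' => XXZ.solutions_unique hη hξ (hg rfl) hK hl hl' hx hx',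
      fun t ht ψ hψ => XXZ.spinZ_mulVec_of_mem (hg rfl) hK hl ht hψ⟩
  · rw [XXZ.sovCovector_dotProduct hψ, hn, mul_one]
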